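/- For a set $S\subseteq\mathbb{R}^2$, points $p,q\in S$ are *Manhattan-connected* in $S$ if there are points $p=x_0,x_1,\dots,x_k=q$ of $S$ such that $x_i$ and $x_{i+1}$ have a common $x$- or a common $y$-coordinate for all $0\le i<k$, and $\sum_{i=0}^{k-1}\|x_i-x_{i+1}\|_1=\|p-q\|_1$. An instance of the problem MinGMConn (Minimum Generalized Manhattan Connections) is a pair $(P,D)$ consisting of a finite set $P\subseteq\mathbb{Z}^2$ of input points, no two of which have the same $x$-coordinate or the same $y$-coordinate, and a set of demands $D\subseteq P\times P$. A finite set $Q\subseteq\mathbb{R}^2$ is feasible for $(P,D)$ if $p$ and $q$ are Manhattan-connected in $P\cup Q$ for every $(p,q)\in D$, and $\mathrm{OPT}(P,D)$ denotes the minimum cardinality of a feasible set. **Theorem.** MinGMConn admits an efficient $O(\sqrt{\log n})$-approximation: there are a constant $C$ and a deterministic algorithm that, given any instance $(P,D)$ of MinGMConn with $n=|P|$ input points (as lists of the points and of the demands, with coordinates in binary), computes, in time polynomial in the bit length of the input, a feasible set $Q\subseteq\mathbb{Z}^2$ for $(P,D)$ with $$|Q|\le C\,\sqrt{\log n}\cdot\mathrm{OPT}(P,D).$$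 Running time is measured on a random access machine with logarithmic cost. -/

import Mathlib

namespace MinGMConn

/-! ### Manhattan connections -/

/-- The `ℓ¹` distance of two points of the plane. -/
def l1Dist (a b : ℝ × ℝ) : ℝ := |a.1 - b.1| + |a.2 - b.2|

/-- Two points are horizontally or vertically aligned. -/
def Aligned (a b : ℝ × ℝ) : Prop := a.1 = b.1 ∨ a.2 = b.2

/-- `p` and `q` are Manhattan-connected in `S`: there are points `p = x 0, x 1, …, x k = q` of `S`,
consecutive ones aligned, of total length `‖p - q‖₁`. -/
def MConnected (S : Set (ℝ × ℝ)) (p q : ℝ × ℝ) : Prop :=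
  ∃ (k : ℕ) (x : ℕ → ℝ × ℝ), x 0 = p ∧ x k = q ∧ (∀ i ≤ k, x i ∈ S) ∧
    (∀ i < k, Aligned (x i) (x (i + 1))) ∧
    ∑ i ∈ Finset.range k, l1Dist (x i) (x (i + 1)) = l1Dist p q

/-- A point of the integer grid as a point of the plane. -/
def toPlane (p : ℤ × ℤ) : ℝ × ℝ := ((p.1 : ℝ), (p.2 : ℝ))

/-- An instance: a finite set `P` of input points of the integer grid, no two of them in the same
column or in the same row, and a set `D` of demands between input points. -/
structure Instance where
  P : Finset (ℤ × ℤ)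
  D : Finset ((ℤ × ℤ) × (ℤ × ℤ))
  demand_mem : ∀ d ∈ D, d.1 ∈ P ∧ d.2 ∈ P
  column_inj : ∀ p ∈ P, ∀ q ∈ P, p.1 = q.1 → p = q
  row_inj : ∀ p ∈ P, ∀ q ∈ P, p.2 = q.2 → p = q

/-- `Q` is a feasible set of auxiliary points: every demand is connected in `P ∪ Q`. -/
def Instance.Feasible (I : Instance) (Q : Set (ℝ × ℝ)) : Prop :=
  ∀ d ∈ I.D, MConnected (toPlane '' (I.P : Set (ℤ × ℤ)) ∪ Q) (toPlane d.1) (toPlane d.2)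

/-- The least cardinality of a feasible set of points of the plane. -/
noncomputable def Instance.opt (I : Instance) : ℕ :=
  sInf {k : ℕ | ∃ Q : Finset (ℝ × ℝ), I.Feasible (Q : Set (ℝ × ℝ)) ∧ Q.card = k}

/-! ### Random access machines with logarithmic cost

The memory consists of integer registers and of integer arrays; a program names only finitely many
of them. Programs are built from assignments, array writes, conditionals and loops. Every operation
is charged the bit length of all the integers that it handles, so that running times agree with
those of Turing machines up to a polynomial. -/

/-- The memory: registers `var 0, var 1, …` and arrays `arr 0, arr 1, …`. -/
structure Store where
  var : ℕ → ℤ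
  arr : ℕ → ℤ → ℤ

/-- Write a register. -/
def Store.setVar (s : Store) (x : ℕ) (v : ℤ) : Store :=
  { s with var := Function.update s.var x v }

/-- Write one cell of an array. -/
def Store.setArr (s : Store) (a : ℕ) (i v : ℤ) : Store :=
  { s with arr := Function.update s.arr a (Function.update (s.arr a) i v) }

/-- One (for the sign) plus the number of binary digits. -/
def bitLength (z : ℤ) : ℕ := 1 + Nat.size z.natAbs

/-- Arithmetic expressions; `read a e` is the cell of the array `a` with index `e`. -/
inductive Expr where
  | const (c : ℤ)
  | var (x : ℕ)
  | read (a : ℕ) (e : Expr)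
  | add (e f : Expr)
  | sub (e f : Expr)
  | mul (e f : Expr)
  | div (e f : Expr)

/-- The value of an expression (division is integer division, with value `0` for divisor `0`). -/
def Expr.eval (s : Store) : Expr → ℤ
  | .const c => c
  | .var x => s.var x
  | .read a e => s.arr a (e.eval s)
  | .add e f => e.eval s + f.eval s
  | .sub e f => e.eval s - f.eval s
  | .mul e f => e.eval s * f.eval s
  | .div e f => e.eval s / f.eval s

/-- The cost of evaluating an expression: the total bit length of the values of all its
subexpressions, itself included. -/
def Expr.cost (s : Store) : Expr → ℕ
  | .const c => bitLength c
  | .var x => bitLength (s.var x)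
  | .read a e => e.cost s + bitLength (s.arr a (e.eval s))
  | .add e f => e.cost s + f.cost s + bitLength (e.eval s + f.eval s)
  | .sub e f => e.cost s + f.cost s + bitLength (e.eval s - f.eval s)
  | .mul e f => e.cost s + f.cost s + bitLength (e.eval s * f.eval s)
  | .div e f => e.cost s + f.cost s + bitLength (e.eval s / f.eval s)

/-- Programs. The tests of `ite` and `loop` succeed if the value of the expression is positive. -/
inductive Program where
  | skip
  | assign (x : ℕ) (e : Expr)
  | write (a : ℕ) (i e : Expr)
  | seq (c d : Program)
  | ite (e : Expr) (c d : Program)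
  | loop (e : Expr) (c : Program)

/-- `Exec c s t s'`: started in the memory `s`, the program `c` halts, at cost `t`, in `s'`. -/
inductive Exec : Program → Store → ℕ → Store → Prop where
  | skip (s : Store) : Exec .skip s 1 s
  | assign (x : ℕ) (e : Expr) (s : Store) :
      Exec (.assign x e) s (1 + e.cost s) (s.setVar x (e.eval s))
  | write (a : ℕ) (i e : Expr) (s : Store) :
      Exec (.write a i e) s (1 + i.cost s + e.cost s) (s.setArr a (i.eval s) (e.eval s))
  | seq {c d : Program} {s s' s'' : Store} {t t' : ℕ} :
      Exec c s t s' → Exec d s' t' s'' → Exec (.seq c d) s (t + t') s''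
  | ite_true {e : Expr} {c d : Program} {s s' : Store} {t : ℕ} :
      0 < e.eval s → Exec c s t s' → Exec (.ite e c d) s (1 + e.cost s + t) s'
  | ite_false {e : Expr} {c d : Program} {s s' : Store} {t : ℕ} :
      ¬ 0 < e.eval s → Exec d s t s' → Exec (.ite e c d) s (1 + e.cost s + t) s'
  | loop_true {e : Expr} {c : Program} {s s' s'' : Store} {t t' : ℕ} :
      0 < e.eval s → Exec c s t s' → Exec (.loop e c) s' t' s'' →
      Exec (.loop e c) s (1 + e.cost s + t + t') s''
  | loop_false {e : Expr} {c : Program} {s : Store} :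
      ¬ 0 < e.eval s → Exec (.loop e c) s (1 + e.cost s) s

/-- Programs are deterministic: the final memory and the cost are determined by the input. -/
theorem Exec.deterministic {c : Program} {s s₁ s₂ : Store} {t₁ t₂ : ℕ}
    (h₁ : Exec c s t₁ s₁) (h₂ : Exec c s t₂ s₂) : t₁ = t₂ ∧ s₁ = s₂ := by
  induction h₁ generalizing t₂ s₂ with
  | skip | assign | write => cases h₂; exact ⟨rfl, rfl⟩
  | seq _ _ ih ih' =>
    cases h₂ with
    | seq a b => obtain ⟨rfl, rfl⟩ := ih a; obtain ⟨rfl, rfl⟩ := ih' b; exact ⟨rfl, rfl⟩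
  | ite_true h _ ih =>
    cases h₂ with
    | ite_true _ a => obtain ⟨rfl, rfl⟩ := ih a; exact ⟨rfl, rfl⟩
    | ite_false h' _ => exact absurd h h'
  | ite_false h _ ih =>
    cases h₂ with
    | ite_true h' _ => exact absurd h' h
    | ite_false _ a => obtain ⟨rfl, rfl⟩ := ih a; exact ⟨rfl, rfl⟩
  | loop_true h _ _ ih ih' =>
    cases h₂ with
    | loop_true _ a b => obtain ⟨rfl, rfl⟩ := ih a; obtain ⟨rfl, rfl⟩ := ih' b; exact ⟨rfl, rfl⟩
    | loop_false h' => exact absurd h h'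
  | loop_false h =>
    cases h₂ with
    | loop_true h' _ _ => exact absurd h' h
    | loop_false _ => exact ⟨rfl, rfl⟩

/-! ### Input, output and approximation algorithms -/

/-- `ps` and `ds` list the input points and the demands of `I`, in some order and without
repetition. -/
structure Instance.ListedBy (I : Instance) (ps : List (ℤ × ℤ))
    (ds : List ((ℤ × ℤ) × (ℤ × ℤ))) : Prop where
  nodup_points : ps.Nodup
  mem_points : ∀ p, p ∈ ps ↔ p ∈ I.P
  nodup_demands : ds.Nodup
  mem_demands : ∀ d, d ∈ ds ↔ d ∈ I.D

/-- The array that holds the list `l` in its cells `0, …, l.length - 1` and `0` elsewhere. -/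
def arrayOf (l : List ℤ) (i : ℤ) : ℤ := if 0 ≤ i then l.getD i.toNat 0 else 0

/-- The initial memory. Registers `0` and `1` hold the number of points and of demands. The arrays
`0`, `1` hold the coordinates of the points; `2`, `3` and `4`, `5` those of the first and of the
second points of the demands. Everything else is `0`. -/
def inputStore (ps : List (ℤ × ℤ)) (ds : List ((ℤ × ℤ) × (ℤ × ℤ))) : Store where
  var
    | 0 => ps.length
    | 1 => ds.length
    | _ => 0
  arr
    | 0 => arrayOf (ps.map fun p => p.1)
    | 1 => arrayOf (ps.map fun p => p.2)
    | 2 => arrayOf (ds.map fun d => d.1.1)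
    | 3 => arrayOf (ds.map fun d => d.1.2)
    | 4 => arrayOf (ds.map fun d => d.2.1)
    | 5 => arrayOf (ds.map fun d => d.2.2)
    | _ => fun _ => 0

/-- The total bit length of the input. -/
def inputSize (ps : List (ℤ × ℤ)) (ds : List ((ℤ × ℤ) × (ℤ × ℤ))) : ℕ :=
  bitLength ps.length + bitLength ds.length
    + (ps.map fun p => bitLength p.1 + bitLength p.2).sum
    + (ds.map fun d => bitLength d.1.1 + bitLength d.1.2 + bitLength d.2.1 + bitLength d.2.2).sum

/-- The output: register `2` holds a number `k`, and the arrays `6`, `7` hold in their cells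
`0, …, k - 1` the coordinates of the auxiliary points. -/
def outputPoints (s : Store) : Finset (ℤ × ℤ) :=
  (Finset.range (s.var 2).toNat).image fun i : ℕ => (s.arr 6 (i : ℤ), s.arr 7 (i : ℤ))

/-- `prog` is a polynomial-time algorithm that computes, for every instance with `n` input points,
a feasible solution of cardinality at most `ρ n` times the optimum. -/
def IsPolyTimeApproximation (prog : Program) (ρ : ℕ → ℝ) : Prop :=
  ∃ time : Polynomial ℕ,
    ∀ (I : Instance) (ps : List (ℤ × ℤ)) (ds : List ((ℤ × ℤ) × (ℤ × ℤ))), I.ListedBy ps ds →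
      ∃ (t : ℕ) (s : Store),
        Exec prog (inputStore ps ds) t s ∧
        t ≤ time.eval (inputSize ps ds) ∧
        I.Feasible (toPlane '' (outputPoints s : Set (ℤ × ℤ))) ∧
        ((outputPoints s).card : ℝ) ≤ ρ I.P.card * (I.opt : ℝ)

end MinGMConn

namespace MinGMConn

/-! ### A language of bounded sums and tables, compiled to programs -/

/-- The binary operations of expressions. -/
inductive BinOp where
  | add | sub | mul | div

/-- The value of a binary operation. -/
def BinOp.eval : BinOp → ℤ → ℤ → ℤ
  | .add, a, b => a + b
  | .sub, a, b => a - b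
  | .mul, a, b => a * b
  | .div, a, b => a / b

/-- A binary operation applied to two registers. -/
def BinOp.expr : BinOp → ℕ → ℕ → Expr
  | .add, x, y => .add (.var x) (.var y)
  | .sub, x, y => .sub (.var x) (.var y)
  | .mul, x, y => .mul (.var x) (.var y)
  | .div, x, y => .div (.var x) (.var y)

/-- Terms with bounded sums (`agg false`) and bounded products (`agg true`): in `agg b x r t` the
register `x` runs through all values from `0` to the value of the register `r`, exclusive. -/
inductive Term where
  | const (c : ℤ)
  | var (x : ℕ)
  | read (a : ℕ) (t : Term)
  | bin (op : BinOp) (t u : Term)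
  | ite (c t u : Term)
  | agg (b : Bool) (x r : ℕ) (t : Term)

/-- The sum or the product of the first `n` values of a function. -/
def aggregate (b : Bool) (f : ℕ → ℤ) (n : ℕ) : ℤ :=
  if b then ∏ i ∈ Finset.range n, f i else ∑ i ∈ Finset.range n, f i

/-- The value of a term. -/
def Term.eval : Term → Store → ℤ
  | .const c, _ => c
  | .var x, s => s.var x
  | .read a t, s => s.arr a (t.eval s)
  | .bin op t u, s => op.eval (t.eval s) (u.eval s)
  | .ite c t u, s => if 0 < c.eval s then t.eval s else u.eval s
  | .agg b x r t, s => aggregate b (fun i => t.eval (s.setVar x i)) (s.var r).toNat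

/-- All registers of the term are below `S`, and no loop counter is its own bound. -/
def Term.wf (S : ℕ) : Term → Bool
  | .const _ => true
  | .var x => x < S
  | .read _ t => t.wf S
  | .bin _ t u => t.wf S && u.wf S
  | .ite c t u => c.wf S && t.wf S && u.wf S
  | .agg _ x r t => (x < S) && (r < S) && (x != r) && t.wf S

/-- The term does not read the array `a`. -/
def Term.avoids (a : ℕ) : Term → Bool
  | .const _ => true
  | .var _ => true
  | .read a' t => (a' != a) && t.avoids a
  | .bin _ t u => t.avoids a && u.avoids a
  | .ite c t u => c.avoids a && t.avoids a && u.avoids a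
  | .agg _ _ _ t => t.avoids a

/-- A program that writes the value of a term to the register `d` and that uses the registers from
`d` on as scratch space. -/
def Term.comp : Term → ℕ → Program
  | .const c, d => .assign d (.const c)
  | .var x, d => .assign d (.var x)
  | .read a t, d => .seq (t.comp d) (.assign d (.read a (.var d)))
  | .bin op t u, d => .seq (t.comp d) (.seq (u.comp (d + 1)) (.assign d (op.expr d (d + 1))))
  | .ite c t u, d => .seq (c.comp d) (.ite (.var d) (t.comp d) (u.comp d))
  | .agg b x r t, d =>
      .seq (.assign d (.var x)) <| .seq (.assign (d + 1) (.const (if b then 1 else 0))) <|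
      .seq (.assign x (.const 0)) <|
      .seq (.loop (.sub (.var r) (.var x))
        (.seq (t.comp (d + 2))
          (.seq (.assign (d + 1) ((if b then BinOp.mul else BinOp.add).expr (d + 1) (d + 2)))
            (.assign x (.add (.var x) (.const 1)))))) <|
      .seq (.assign x (.var d)) (.assign d (.var (d + 1)))

/-- Statements: assignments to registers, parallel assignments to the cells of an array, and
repetitions. -/
inductive Stm where
  | set (x : ℕ) (t : Term)
  | tab (a x r : ℕ) (t : Term)
  | seq (c d : Stm)
  | rep (r : ℕ) (c : Stm)

/-- Write the first `n` cells of an array. -/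
def Store.setCells (s : Store) (a : ℕ) (n : ℤ) (f : ℤ → ℤ) : Store :=
  { s with arr := Function.update s.arr a (fun i => if 0 ≤ i ∧ i < n then f i else s.arr a i) }

/-- The effect of a statement. -/
def Stm.den : Stm → Store → Store
  | .set x t, s => s.setVar x (t.eval s)
  | .tab a x r t, s => s.setCells a (s.var r) (fun i => t.eval (s.setVar x i))
  | .seq c d, s => d.den (c.den s)
  | .rep r c, s => c.den^[(s.var r).toNat] s

/-- All registers are below `S`, and no table reads the array that it defines. -/
def Stm.wf (S : ℕ) : Stm → Bool
  | .set x t => (x < S) && t.wf S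
  | .tab a x r t => (x < S) && (r < S) && (x != r) && t.wf S && t.avoids a
  | .seq c d => c.wf S && d.wf S
  | .rep r c => (r < S) && c.wf S

/-- A program for the statement, with the registers from `d` on as scratch space. -/
def Stm.comp : Stm → ℕ → Program
  | .set x t, d => .seq (t.comp d) (.assign x (.var d))
  | .tab a x r t, d =>
      .seq (.assign d (.var x)) <| .seq (.assign x (.const 0)) <|
      .seq (.loop (.sub (.var r) (.var x))
        (.seq (t.comp (d + 1))
          (.seq (.write a (.var x) (.var (d + 1))) (.assign x (.add (.var x) (.const 1)))))) <|
      .assign x (.var d)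
  | .seq c d', d => .seq (c.comp d) (d'.comp d)
  | .rep r c, d =>
      .seq (.assign d (.var r))
        (.loop (.var d) (.seq (c.comp (d + 1)) (.assign d (.sub (.var d) (.const 1)))))

/-- The registers below `S` are at most `B`, and the cells of the arrays at most `2 ^ B`. -/
structure Bdd (S B : ℕ) (s : Store) : Prop where
  var_le : ∀ x < S, |s.var x| ≤ B
  arr_le : ∀ a i, |s.arr a i| ≤ 2 ^ B

/-- All stores that occur are bounded. -/
def Stm.Safe (S B : ℕ) : Stm → Store → Prop
  | .set x t, s => Bdd S B s ∧ Bdd S B ((Stm.set x t).den s)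
  | .tab a x r t, s => Bdd S B s ∧ Bdd S B ((Stm.tab a x r t).den s)
  | .seq c d, s => c.Safe S B s ∧ d.Safe S B (c.den s)
  | .rep r c, s => Bdd S B s ∧ ∀ i < (s.var r).toNat, c.Safe S B (c.den^[i] s)

/-- Two stores with the same arrays and the same registers below `d`. -/
structure Agree (d : ℕ) (s s' : Store) : Prop where
  arr_eq : s'.arr = s.arr
  var_eq : ∀ x < d, s'.var x = s.var x

@[simp] theorem Store.setVar_arr (s : Store) (x : ℕ) (v : ℤ) : (s.setVar x v).arr = s.arr := rfl

@[simp] theorem Store.setVar_var (s : Store) (x : ℕ) (v : ℤ) (y : ℕ) :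
    (s.setVar x v).var y = if y = x then v else s.var y := by
  simp [Store.setVar, Function.update_apply]

@[simp] theorem Store.setCells_var (s : Store) (a : ℕ) (n : ℤ) (f : ℤ → ℤ) :
    (s.setCells a n f).var = s.var := rfl

theorem Store.setCells_arr (s : Store) (a : ℕ) (n : ℤ) (f : ℤ → ℤ) (b : ℕ) (i : ℤ) :
    (s.setCells a n f).arr b i =
      if b = a then if 0 ≤ i ∧ i < n then f i else s.arr a i else s.arr b i := by
  by_cases h : b = a
  · subst h; simp [Store.setCells]
  · simp [Store.setCells, h]

theorem Agree.refl (d : ℕ) (s : Store) : Agree d s s := ⟨rfl, fun _ _ => rfl⟩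

theorem Agree.trans {d : ℕ} {s s' s'' : Store} (h : Agree d s s') (h' : Agree d s' s'') :
    Agree d s s'' :=
  ⟨h'.1.trans h.1, fun x hx => (h'.2 x hx).trans (h.2 x hx)⟩

theorem Agree.mono {d e : ℕ} {s s' : Store} (h : Agree d s s') (he : e ≤ d) : Agree e s s' :=
  ⟨h.1, fun x hx => h.2 x (hx.trans_le he)⟩

theorem Agree.setVar_right {d x : ℕ} {s s' : Store} (h : Agree d s s') (hx : d ≤ x) (v : ℤ) :
    Agree d s (s'.setVar x v) :=
  ⟨h.1, fun y hy => by rw [Store.setVar_var, if_neg (by omega)]; exact h.2 y hy⟩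

theorem Agree.setVar_both {d : ℕ} {s s' : Store} (h : Agree d s s') (x : ℕ) (v : ℤ) :
    Agree d (s.setVar x v) (s'.setVar x v) :=
  ⟨h.1, fun y hy => by simp only [Store.setVar_var, h.2 y hy]⟩

theorem Bdd.of_agree {S d B : ℕ} {s s' : Store} (h : Bdd S B s) (ha : Agree d s s') (hd : S ≤ d) :
    Bdd S B s' :=
  ⟨fun x hx => by rw [ha.2 x (by omega)]; exact h.1 x hx, fun a i => by rw [ha.1]; exact h.2 a i⟩

theorem Bdd.setVar {S B : ℕ} {s : Store} (h : Bdd S B s) (x : ℕ) {v : ℤ} (hv : |v| ≤ B) :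
    Bdd S B (s.setVar x v) :=
  ⟨fun y hy => by rw [Store.setVar_var]; split_ifs; exacts [hv, h.1 y hy], h.2⟩

theorem Bdd.setCells {S B : ℕ} {s : Store} (h : Bdd S B s) (a : ℕ) {n : ℤ} {f : ℤ → ℤ}
    (hf : ∀ i, 0 ≤ i → i < n → |f i| ≤ 2 ^ B) : Bdd S B (s.setCells a n f) :=
  ⟨h.1, fun b i => by
    rw [Store.setCells_arr]
    split_ifs with h1 h2
    exacts [hf i h2.1 h2.2, h.2 _ _, h.2 _ _]⟩

theorem Bdd.mono {S B B' : ℕ} {s : Store} (h : Bdd S B s) (hB : B ≤ B') : Bdd S B' s :=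
  ⟨fun x hx => (h.1 x hx).trans (by exact_mod_cast hB),
    fun a i => (h.2 a i).trans (pow_le_pow_right₀ (by norm_num) hB)⟩

theorem Term.eval_congr {S : ℕ} (t : Term) (ht : t.wf S) {s s' : Store} (h : Agree S s s') :
    t.eval s' = t.eval s := by
  induction t generalizing s s' with
  | const c => rfl
  | var x => exact h.2 x (by simpa [Term.wf] using ht)
  | read a t ih => simp only [Term.eval, h.1, ih ht h]
  | bin op t u iht ihu =>
    simp only [Term.wf, Bool.and_eq_true] at ht
    simp only [Term.eval, iht ht.1 h, ihu ht.2 h]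
  | ite c t u ihc iht ihu =>
    simp only [Term.wf, Bool.and_eq_true] at ht
    simp only [Term.eval, ihc ht.1.1 h, iht ht.1.2 h, ihu ht.2 h]
  | agg b x r t ih =>
    simp only [Term.wf, Bool.and_eq_true, decide_eq_true_eq] at ht
    simp only [Term.eval, h.2 r ht.1.1.2]
    congr 1
    funext i
    exact ih ht.2 (h.setVar_both x i)

theorem Term.eval_of_avoids {a : ℕ} (t : Term) (ht : t.avoids a) {s s' : Store}
    (hv : s'.var = s.var) (ha : ∀ b ≠ a, s'.arr b = s.arr b) : t.eval s' = t.eval s := by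
  induction t generalizing s s' with
  | const c => rfl
  | var x => exact congrFun hv x
  | read b t ih =>
    simp only [Term.avoids, Bool.and_eq_true, bne_iff_ne, ne_eq] at ht
    simp only [Term.eval, ih ht.2 hv ha, ha b ht.1]
  | bin op t u iht ihu =>
    simp only [Term.avoids, Bool.and_eq_true] at ht
    simp only [Term.eval, iht ht.1 hv ha, ihu ht.2 hv ha]
  | ite c t u ihc iht ihu =>
    simp only [Term.avoids, Bool.and_eq_true] at ht
    simp only [Term.eval, ihc ht.1.1 hv ha, iht ht.1.2 hv ha, ihu ht.2 hv ha]
  | agg b x r t ih =>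
    simp only [Term.eval, hv]
    congr 1
    funext i
    exact ih ht (by funext y; simp [hv]) (by simpa using ha)

theorem bitLength_le {z : ℤ} {v : ℕ} (h : |z| ≤ 2 ^ v) : bitLength z ≤ v + 2 := by
  have : z.natAbs < 2 ^ (v + 1) := by
    have h1 : z.natAbs ≤ 2 ^ v := by zify; exact h
    calc z.natAbs ≤ 2 ^ v := h1
      _ < 2 ^ (v + 1) := Nat.pow_lt_pow_right (by norm_num) (by omega)
  have := Nat.size_le.2 this
  unfold bitLength
  omega

theorem abs_le_two_pow {z : ℤ} {B : ℕ} (h : |z| ≤ B) : |z| ≤ 2 ^ B :=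
  h.trans (by exact_mod_cast (Nat.lt_two_pow_self (n := B)).le)

theorem BinOp.eval_bound (op : BinOp) {a b : ℤ} {v w : ℕ} (ha : |a| ≤ 2 ^ v) (hb : |b| ≤ 2 ^ w) :
    |op.eval a b| ≤ 2 ^ (v + w + 1) := by
  have h1 : (1 : ℤ) ≤ 2 ^ v := one_le_pow₀ (by norm_num)
  have h2 : (1 : ℤ) ≤ 2 ^ w := one_le_pow₀ (by norm_num)
  have h3 : (2 : ℤ) ^ (v + w + 1) = 2 * (2 ^ v * 2 ^ w) := by ring
  rw [h3]
  have hs : (2 : ℤ) ^ v + 2 ^ w ≤ 2 * (2 ^ v * 2 ^ w) := by nlinarith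
  cases op with
  | add => exact (abs_add_le a b).trans (by linarith)
  | sub => exact (abs_sub a b).trans (by linarith)
  | mul =>
    simp only [BinOp.eval, abs_mul]
    calc |a| * |b| ≤ 2 ^ v * 2 ^ w := by gcongr
      _ ≤ _ := by nlinarith
  | div =>
    simp only [BinOp.eval]
    have : |a / b| ≤ |a| := Int.abs_ediv_le_abs a b
    nlinarith

theorem aggregate_bound (b : Bool) {f : ℕ → ℤ} {n B v : ℕ} (hn : n ≤ B)
    (hf : ∀ i < n, |f i| ≤ 2 ^ v) : |aggregate b f n| ≤ 2 ^ (B + v + B * v) := by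
  cases b with
  | false =>
    simp only [aggregate, Bool.false_eq_true, if_false]
    calc |∑ i ∈ Finset.range n, f i| ≤ ∑ i ∈ Finset.range n, |f i| := Finset.abs_sum_le_sum_abs _ _
      _ ≤ ∑ i ∈ Finset.range n, 2 ^ v :=
        Finset.sum_le_sum fun i hi => hf i (Finset.mem_range.1 hi)
      _ = n * 2 ^ v := by simp
      _ ≤ 2 ^ B * 2 ^ v := by
        gcongr
        exact_mod_cast hn.trans (Nat.lt_two_pow_self (n := B)).le
      _ ≤ 2 ^ (B + v + B * v) := by
        rw [← pow_add]; exact pow_le_pow_right₀ (by norm_num) (by omega)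
  | true =>
    simp only [aggregate, if_true, Finset.abs_prod]
    calc ∏ i ∈ Finset.range n, |f i| ≤ ∏ i ∈ Finset.range n, 2 ^ v :=
        Finset.prod_le_prod (fun _ _ => abs_nonneg _) fun i hi => hf i (Finset.mem_range.1 hi)
      _ = 2 ^ (v * n) := by simp [pow_mul]
      _ ≤ 2 ^ (B + v + B * v) := pow_le_pow_right₀ (by norm_num) (by nlinarith)

theorem Bdd.setVar_nat {S B r : ℕ} {s : Store} (h : Bdd S B s) (hr : r < S) (x : ℕ) {i : ℕ}
    (hi : i ≤ (s.var r).toNat) : Bdd S B (s.setVar x i) := by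
  refine h.setVar x ?_
  have := h.1 r hr
  rw [abs_le] at this
  rw [Nat.abs_cast]
  omega

theorem Bdd.toNat_le {S B r : ℕ} {s : Store} (h : Bdd S B s) (hr : r < S) :
    (s.var r).toNat ≤ B := by
  have := h.1 r hr
  rw [abs_le] at this
  omega

theorem Term.eval_bound {S : ℕ} (t : Term) (ht : t.wf S) :
    ∃ v : Polynomial ℕ, ∀ B s, Bdd S B s → |t.eval s| ≤ 2 ^ (v.eval B) := by
  induction t with
  | const c =>
    refine ⟨Polynomial.C c.natAbs, fun B s _ => ?_⟩
    simp only [Polynomial.eval_C, Term.eval]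
    exact abs_le_two_pow (by simp)
  | var x =>
    refine ⟨Polynomial.X, fun B s h => ?_⟩
    simp only [Polynomial.eval_X, Term.eval]
    exact abs_le_two_pow (h.1 x (by simpa [Term.wf] using ht))
  | read a t ih => exact ⟨Polynomial.X, fun B s h => by simpa [Term.eval] using h.2 a (t.eval s)⟩
  | bin op t u iht ihu =>
    simp only [Term.wf, Bool.and_eq_true] at ht
    obtain ⟨v, hv⟩ := iht ht.1
    obtain ⟨w, hw⟩ := ihu ht.2
    refine ⟨v + w + 1, fun B s h => ?_⟩
    simpa [Term.eval] using op.eval_bound (hv B s h) (hw B s h)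
  | ite c t u ihc iht ihu =>
    simp only [Term.wf, Bool.and_eq_true] at ht
    obtain ⟨v, hv⟩ := iht ht.1.2
    obtain ⟨w, hw⟩ := ihu ht.2
    refine ⟨v + w, fun B s h => ?_⟩
    simp only [Term.eval, Polynomial.eval_add]
    split_ifs
    · exact (hv B s h).trans (pow_le_pow_right₀ (by norm_num) (by omega))
    · exact (hw B s h).trans (pow_le_pow_right₀ (by norm_num) (by omega))
  | agg b x r t ih =>
    simp only [Term.wf, Bool.and_eq_true, decide_eq_true_eq] at ht
    obtain ⟨v, hv⟩ := ih ht.2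
    refine ⟨Polynomial.X + v + Polynomial.X * v, fun B s h => ?_⟩
    simp only [Term.eval, Polynomial.eval_add, Polynomial.eval_mul, Polynomial.eval_X]
    exact aggregate_bound b (h.toNat_le ht.1.1.2)
      fun i hi => hv B _ (h.setVar_nat ht.1.1.2 x hi.le)

theorem BinOp.expr_eval (op : BinOp) (s : Store) (x y : ℕ) :
    (op.expr x y).eval s = op.eval (s.var x) (s.var y) := by
  cases op <;> rfl

theorem BinOp.expr_cost (op : BinOp) (s : Store) (x y : ℕ) :
    (op.expr x y).cost s =
      bitLength (s.var x) + bitLength (s.var y) + bitLength (op.eval (s.var x) (s.var y)) := by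
  cases op <;> rfl

theorem bitLength_natCast_le {i B : ℕ} (h : i ≤ B) : bitLength (i : ℤ) ≤ B + 2 :=
  bitLength_le (abs_le_two_pow (by rw [Nat.abs_cast]; exact_mod_cast h))

theorem aggregate_succ (b : Bool) (f : ℕ → ℤ) (n : ℕ) :
    aggregate b f (n + 1) =
      (if b then BinOp.mul else BinOp.add).eval (aggregate b f n) (f n) := by
  cases b
  · simp [aggregate, BinOp.eval, Finset.sum_range_succ]
  · simp [aggregate, BinOp.eval, Finset.prod_range_succ]

theorem bitLength_one : bitLength 1 = 2 := by simp [bitLength]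

theorem bitLength_zero : bitLength 0 = 1 := by simp [bitLength]

/-- The loop `for x from i to n` of a counter `x` and a bound `r`: if the body preserves an
invariant and costs at most `q`, then the loop halts. -/
theorem exec_count_loop {r x B : ℕ} {c : Program} {n q : ℕ} (hn : n ≤ B) (J : ℕ → Store → Prop)
    (hr : ∀ i s, J i s → (s.var r).toNat = n ∧ |s.var r| ≤ B)
    (hx : ∀ i s, J i s → s.var x = i)
    (hc : ∀ i < n, ∀ s, J i s → ∃ T s', Exec c s T s' ∧ T ≤ q ∧ J (i + 1) s') :
    ∀ m i, i + m = n → ∀ s, J i s → ∃ T s',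
      Exec (.loop (.sub (.var r) (.var x)) c) s T s' ∧
        T ≤ (m + 1) * (4 * B + q + 12) ∧ J n s' := by
  have key : ∀ i ≤ n, ∀ s, J i s → (Expr.sub (.var r) (.var x)).cost s ≤ 4 * B + 7 := by
    intro i hi s hJ
    obtain ⟨-, h2⟩ := hr i s hJ
    have h3 := hx i s hJ
    have h4 : |s.var x| ≤ B := by
      rw [h3, Nat.abs_cast]; exact_mod_cast hi.trans hn
    have e1 := bitLength_le (abs_le_two_pow h2)
    have e2 := bitLength_le (abs_le_two_pow h4)
    have e3 := bitLength_le (BinOp.sub.eval_bound (abs_le_two_pow h2) (abs_le_two_pow h4))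
    simp only [Expr.cost, Expr.eval]
    simp only [BinOp.eval] at e3
    omega
  intro m
  induction m with
  | zero =>
    intro i hi s hJ
    have hin : i = n := by omega
    subst hin
    refine ⟨_, s, Exec.loop_false ?_, ?_, hJ⟩
    · have := (hr i s hJ).1
      simp only [Expr.eval, hx i s hJ]
      omega
    · have := key i le_rfl s hJ
      omega
  | succ m ih =>
    intro i hi s hJ
    have hin : i < n := by omega
    obtain ⟨T, s', h1, h2, h3⟩ := hc i hin s hJ
    obtain ⟨T', s'', h1', h2', h3'⟩ := ih (i + 1) (by omega) s' h3
    refine ⟨_, s'', Exec.loop_true ?_ h1 h1', ?_, h3'⟩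
    · have := (hr i s hJ).1
      simp only [Expr.eval, hx i s hJ]
      omega
    · have := key i hin.le s hJ
      have e : (m + 1 + 1) * (4 * B + q + 12) = (m + 1) * (4 * B + q + 12) + (4 * B + q + 12) := by
        ring
      omega

theorem Term.exec {S : ℕ} (t : Term) (ht : t.wf S) :
    ∃ p : Polynomial ℕ, ∀ B s d, S ≤ d → Bdd S B s → ∃ T s', Exec (t.comp d) s T s' ∧
      T ≤ p.eval B ∧ Agree d s s' ∧ s'.var d = t.eval s := by
  induction t with
  | const c =>
    refine ⟨Polynomial.C (1 + bitLength c), fun B s d _ _ => ⟨_, _, Exec.assign _ _ _, ?_,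
      (Agree.refl d s).setVar_right le_rfl _, by simp [Term.eval, Expr.eval]⟩⟩
    simp [Expr.cost]
  | var x =>
    have hx : x < S := by simpa [Term.wf] using ht
    refine ⟨Polynomial.X + 3, fun B s d _ h => ⟨_, _, Exec.assign _ _ _, ?_,
      (Agree.refl d s).setVar_right le_rfl _, by simp [Term.eval, Expr.eval]⟩⟩
    have := bitLength_le (abs_le_two_pow (h.1 x hx))
    simp [Expr.cost]
    omega
  | read a t ih =>
    obtain ⟨p, hp⟩ := ih ht
    obtain ⟨v, hv⟩ := t.eval_bound ht
    refine ⟨p + v + Polynomial.X + 5, fun B s d hd h => ?_⟩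
    obtain ⟨T, s', h1, h2, h3, h4⟩ := hp B s d hd h
    refine ⟨_, _, Exec.seq h1 (Exec.assign _ _ _), ?_, h3.setVar_right le_rfl _, ?_⟩
    · have e1 := bitLength_le (hv B s h)
      have e2 := bitLength_le (h.2 a (t.eval s))
      simp only [Expr.cost, Expr.eval, h4, h3.1]
      simp
      omega
    · simp [Expr.eval, Term.eval, h4, h3.1]
  | bin op t u iht ihu =>
    simp only [Term.wf, Bool.and_eq_true] at ht
    obtain ⟨p, hp⟩ := iht ht.1
    obtain ⟨v, hv⟩ := t.eval_bound ht.1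
    obtain ⟨p', hp'⟩ := ihu ht.2
    obtain ⟨w, hw⟩ := u.eval_bound ht.2
    refine ⟨p + p' + 2 * v + 2 * w + 8, fun B s d hd h => ?_⟩
    obtain ⟨T, s', h1, h2, h3, h4⟩ := hp B s d hd h
    obtain ⟨T', s'', h1', h2', h3', h4'⟩ := hp' B s' (d + 1) (by omega) (h.of_agree h3 hd)
    have e4 : s''.var d = t.eval s := by rw [h3'.2 d (by omega), h4]
    have e4' : s''.var (d + 1) = u.eval s := by rw [h4', u.eval_congr ht.2 (h3.mono hd)]
    refine ⟨_, _, Exec.seq h1 (Exec.seq h1' (Exec.assign _ _ _)), ?_,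
      (h3.trans (h3'.mono (by omega))).setVar_right le_rfl _, ?_⟩
    · have e1 := bitLength_le (hv B s h)
      have e2 := bitLength_le (hw B s h)
      have e3 := bitLength_le (op.eval_bound (hv B s h) (hw B s h))
      rw [op.expr_cost, e4, e4']
      simp
      omega
    · simp [op.expr_eval, e4, e4', Term.eval]
  | ite c t u ihc iht ihu =>
    simp only [Term.wf, Bool.and_eq_true] at ht
    obtain ⟨p, hp⟩ := ihc ht.1.1
    obtain ⟨v, hv⟩ := c.eval_bound ht.1.1
    obtain ⟨p', hp'⟩ := iht ht.1.2
    obtain ⟨p'', hp''⟩ := ihu ht.2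
    refine ⟨p + p' + p'' + v + 3, fun B s d hd h => ?_⟩
    obtain ⟨T, s', h1, h2, h3, h4⟩ := hp B s d hd h
    have e1 := bitLength_le (hv B s h)
    by_cases hc : 0 < c.eval s
    · obtain ⟨T', s'', h1', h2', h3', h4'⟩ := hp' B s' d hd (h.of_agree h3 hd)
      refine ⟨_, _, Exec.seq h1 (Exec.ite_true (by simpa [Expr.eval, h4] using hc) h1'), ?_,
        h3.trans h3', ?_⟩
      · simp only [Expr.cost, h4]
        simp
        omega
      · simp [Term.eval, hc, h4', t.eval_congr ht.1.2 (h3.mono hd)]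
    · obtain ⟨T', s'', h1', h2', h3', h4'⟩ := hp'' B s' d hd (h.of_agree h3 hd)
      refine ⟨_, _, Exec.seq h1 (Exec.ite_false (by simpa [Expr.eval, h4] using hc) h1'), ?_,
        h3.trans h3', ?_⟩
      · simp only [Expr.cost, h4]
        simp
        omega
      · simp [Term.eval, hc, h4', u.eval_congr ht.2 (h3.mono hd)]
  | agg b x r t ih =>
    simp only [Term.wf, Bool.and_eq_true, decide_eq_true_eq, bne_iff_ne] at ht
    obtain ⟨⟨⟨hxS, hrS⟩, hxr⟩, ht⟩ := ht
    obtain ⟨p, hp⟩ := ih ht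
    obtain ⟨v, hv⟩ := t.eval_bound ht
    set V : Polynomial ℕ := Polynomial.X + v + Polynomial.X * v with hV
    refine ⟨(Polynomial.X + 1) * (4 * Polynomial.X + (p + 2 * V + 2 * v + 2 * Polynomial.X + 20) + 12)
      + 2 * V + 2 * Polynomial.X + 20, fun B s d hd h => ?_⟩
    set n := (s.var r).toNat with hn
    have hnB : n ≤ B := h.toNat_le hrS
    set f : ℕ → ℤ := fun i => t.eval (s.setVar x i) with hf
    have hfb : ∀ i < n, |f i| ≤ 2 ^ v.eval B := fun i hi => hv B _ (h.setVar_nat hrS x hi.le)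
    have hagg : ∀ i ≤ n, |aggregate b f i| ≤ 2 ^ V.eval B := by
      intro i hi
      simp only [hV, Polynomial.eval_add, Polynomial.eval_mul, Polynomial.eval_X]
      exact aggregate_bound b (hi.trans hnB) fun j hj => hfb j (by omega)
    let J : ℕ → Store → Prop := fun i s' => Agree d (s.setVar x i) s' ∧ s'.var d = s.var x ∧
      s'.var (d + 1) = aggregate b f i ∧ i ≤ n
    have hJr : ∀ i s', J i s' → (s'.var r).toNat = n ∧ |s'.var r| ≤ B := by
      rintro i s' ⟨h1, -⟩
      have : s'.var r = s.var r := by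
        rw [h1.2 r (by omega), Store.setVar_var, if_neg (Ne.symm hxr)]
      rw [this]
      exact ⟨rfl, h.1 r hrS⟩
    have hJx : ∀ i s', J i s' → s'.var x = i := by
      rintro i s' ⟨h1, -⟩
      rw [h1.2 x (by omega), Store.setVar_var, if_pos rfl]
    have hbody := exec_count_loop (r := r) (x := x) (B := B)
      (c := .seq (t.comp (d + 2))
          (.seq (.assign (d + 1) ((if b then BinOp.mul else BinOp.add).expr (d + 1) (d + 2)))
            (.assign x (.add (.var x) (.const 1))))) (n := n)
      (q := (p + 2 * V + 2 * v + 2 * Polynomial.X + 20).eval B) hnB J hJr hJx (by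
        intro i hi s' hJ
        obtain ⟨h1, h2, h3, -⟩ := hJ
        have hx' : s'.var x = i := hJx i s' ⟨h1, h2, h3, hi.le⟩
        have hb' : Bdd S B s' := (h.setVar_nat hrS x hi.le).of_agree h1 hd
        obtain ⟨T, s'', g1, g2, g3, g4⟩ := hp B s' (d + 2) (by omega) hb'
        have hfi : s''.var (d + 2) = f i := by rw [g4, t.eval_congr ht (h1.mono hd)]
        have hac : s''.var (d + 1) = aggregate b f i := by rw [g3.2 _ (by omega), h3]
        have hxi : s''.var x = i := by rw [g3.2 _ (by omega), hx']
        refine ⟨_, _, Exec.seq g1 (Exec.seq (Exec.assign _ _ _) (Exec.assign _ _ _)), ?_, ?_⟩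
        · have e1 := bitLength_le (hagg i hi.le)
          have e2 := bitLength_le (hfb i hi)
          have e3 := bitLength_le
            ((if b then BinOp.mul else BinOp.add).eval_bound (hagg i hi.le) (hfb i hi))
          have e4 := bitLength_natCast_le (hi.le.trans hnB)
          have e5 := bitLength_natCast_le (i := i + 1) (B := B) (by omega)
          push_cast at e5
          rw [BinOp.expr_cost, BinOp.expr_eval, hfi, hac]
          simp only [Expr.cost, Expr.eval, Store.setVar_var, bitLength_one,
            if_neg (show x ≠ d + 1 by omega), hxi]
          simp
          omega
        · refine ⟨⟨?_, ?_⟩, ?_, ?_, hi⟩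
          · simp [g3.1, h1.1]
          · intro y hy
            simp only [Store.setVar_var, Expr.eval, if_neg (show x ≠ d + 1 by omega), hxi,
              if_neg (show y ≠ d + 1 by omega)]
            split_ifs
            · push_cast; ring
            · rw [g3.2 y (by omega), h1.2 y hy, Store.setVar_var, if_neg (by assumption)]
          · simp only [Store.setVar_var, if_neg (show d ≠ x by omega),
              if_neg (show d ≠ d + 1 by omega)]
            rw [g3.2 d (by omega), h2]
          · simp only [Store.setVar_var, if_neg (show d + 1 ≠ x by omega), if_true]
            rw [BinOp.expr_eval, hfi, hac, aggregate_succ])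
    set s1 := ((s.setVar d (s.var x)).setVar (d + 1) (if b then 1 else 0)).setVar x 0 with hs1
    have hJ0 : J 0 s1 := by
      refine ⟨⟨rfl, ?_⟩, ?_, ?_, Nat.zero_le _⟩
      · intro y hy
        simp only [hs1, Store.setVar_var, if_neg (show y ≠ d + 1 by omega),
          if_neg (show y ≠ d by omega), Nat.cast_zero]
      · simp [hs1, show d ≠ x by omega]
      · simp only [hs1, Store.setVar_var, if_neg (show d + 1 ≠ x by omega), if_true]
        cases b <;> simp [aggregate]
    obtain ⟨T, s2, g1, g2, g3⟩ := hbody n 0 (by omega) s1 hJ0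
    obtain ⟨k1, k2, k3, -⟩ := g3
    refine ⟨_, _, Exec.seq (Exec.assign _ _ _) (Exec.seq (Exec.assign _ _ _)
      (Exec.seq (Exec.assign _ _ _) (Exec.seq g1 (Exec.seq (Exec.assign _ _ _)
      (Exec.assign _ _ _))))), ?_, ?_, ?_⟩
    · have e1 := bitLength_le (abs_le_two_pow (h.1 x hxS))
      have e2 := bitLength_le (hagg n le_rfl)
      have e3 : bitLength (if b then 1 else 0) ≤ 2 := by cases b <;> simp [bitLength]
      simp only [Expr.cost, Expr.eval, Store.setVar_var, if_neg (show d + 1 ≠ x by omega), k2, k3,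
        bitLength_zero]
      have e4 : (n + 1) * (4 * B + (p + 2 * V + 2 * v + 2 * Polynomial.X + 20).eval B + 12)
        ≤ (B + 1) * (4 * B + (p + 2 * V + 2 * v + 2 * Polynomial.X + 20).eval B + 12) := by gcongr
      have e5 := g2.trans e4
      simp only [Polynomial.eval_add, Polynomial.eval_mul, Polynomial.eval_X,
        Polynomial.eval_ofNat, Polynomial.eval_one] at e5 ⊢
      omega
    · refine ⟨by simp [k1.1], fun y hy => ?_⟩
      simp only [Store.setVar_var, if_neg (show y ≠ d by omega), Expr.eval, k2]
      split_ifs with hyx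
      · rw [hyx]
      · rw [k1.2 y hy, Store.setVar_var, if_neg hyx]
    · simp [Expr.eval, show d + 1 ≠ x by omega, k3, Term.eval, hn, hf]

theorem Stm.exec {S : ℕ} (c : Stm) (hc : c.wf S) :
    ∃ p : Polynomial ℕ, ∀ B s s₀ d, S ≤ d → c.Safe S B s → Agree S s s₀ →
      ∃ T s₁, Exec (c.comp d) s₀ T s₁ ∧ T ≤ p.eval B ∧ Agree S (c.den s) s₁ ∧
        ∀ x, S ≤ x → x < d → s₁.var x = s₀.var x := by
  induction c with
  | set x t =>
    simp only [Stm.wf, Bool.and_eq_true, decide_eq_true_eq] at hc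
    obtain ⟨p, hp⟩ := t.exec hc.2
    obtain ⟨v, hv⟩ := t.eval_bound hc.2
    refine ⟨p + v + 3, fun B s s₀ d hd hs ha => ?_⟩
    have hb := hs.1.of_agree ha le_rfl
    obtain ⟨T, s', h1, h2, h3, h4⟩ := hp B s₀ d hd hb
    have h5 := t.eval_congr hc.2 ha
    refine ⟨_, _, Exec.seq h1 (Exec.assign _ _ _), ?_, ⟨?_, ?_⟩, ?_⟩
    · have e := bitLength_le (hv B s₀ hb)
      simp only [Expr.cost, h4]
      simp
      omega
    · simp [Stm.den, h3.1, ha.1]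
    · intro y hy
      simp only [Stm.den, Store.setVar_var, Expr.eval, h4, h5, h3.2 y (by omega), ha.2 y hy]
    · intro y hy hyd
      simp [show y ≠ x by omega, h3.2 y hyd]
  | tab a x r t =>
    simp only [Stm.wf, Bool.and_eq_true, decide_eq_true_eq, bne_iff_ne] at hc
    obtain ⟨⟨⟨⟨hxS, hrS⟩, hxr⟩, ht⟩, hta⟩ := hc
    obtain ⟨p, hp⟩ := t.exec ht
    obtain ⟨v, hv⟩ := t.eval_bound ht
    refine ⟨(Polynomial.X + 1) * (4 * Polynomial.X + (p + v + 3 * Polynomial.X + 20) + 12)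
      + 2 * Polynomial.X + 20, fun B s s₀ d hd hs ha => ?_⟩
    obtain ⟨h, h'⟩ := hs
    set n := (s.var r).toNat with hn
    have hnB : n ≤ B := h.toNat_le hrS
    set f : ℤ → ℤ := fun i => t.eval (s.setVar x i) with hf
    have hmid : ∀ i ≤ n, Bdd S B (s.setCells a i f) := by
      intro i hi
      refine h.setCells a fun j hj hji => ?_
      have := h'.2 a j
      simp only [Stm.den, Store.setCells_arr, if_true] at this
      rwa [if_pos ⟨hj, by omega⟩] at this
    let J : ℕ → Store → Prop := fun i s' => Agree S ((s.setCells a i f).setVar x i) s' ∧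
      (∀ y, S ≤ y → y < d → s'.var y = s₀.var y) ∧ s'.var d = s.var x ∧ i ≤ n
    have hJr : ∀ i s', J i s' → (s'.var r).toNat = n ∧ |s'.var r| ≤ B := by
      rintro i s' ⟨h1, -⟩
      have : s'.var r = s.var r := by
        rw [h1.2 r (by omega), Store.setVar_var, if_neg (Ne.symm hxr)]; rfl
      rw [this]
      exact ⟨rfl, h.1 r hrS⟩
    have hJx : ∀ i s', J i s' → s'.var x = i := by
      rintro i s' ⟨h1, -⟩
      rw [h1.2 x (by omega), Store.setVar_var, if_pos rfl]
    have hbody := exec_count_loop (r := r) (x := x) (B := B)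
      (c := .seq (t.comp (d + 1))
          (.seq (.write a (.var x) (.var (d + 1))) (.assign x (.add (.var x) (.const 1))))) (n := n)
      (q := (p + v + 3 * Polynomial.X + 20).eval B) hnB J hJr hJx (by
        intro i hi s' hJ
        obtain ⟨h1, h2, h3, -⟩ := hJ
        have hx' : s'.var x = i := hJx i s' ⟨h1, h2, h3, hi.le⟩
        have hb' : Bdd S B s' :=
          ((hmid i hi.le).setVar_nat (r := r) hrS x (by simpa using hi.le)).of_agree h1 le_rfl
        obtain ⟨T, s'', g1, g2, g3, g4⟩ := hp B s' (d + 1) (by omega) hb'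
        have hfi : s''.var (d + 1) = f i := by
          rw [g4, t.eval_congr ht h1]
          refine t.eval_of_avoids hta ?_ ?_
          · funext y; simp
          · intro b hb; funext j; simp [Store.setCells_arr, hb]
        have hxi : s''.var x = i := by rw [g3.2 _ (by omega), hx']
        refine ⟨_, _, Exec.seq g1 (Exec.seq (Exec.write _ _ _ _) (Exec.assign _ _ _)), ?_, ?_⟩
        · have e2 := bitLength_le (hv B _ hb')
          rw [← g4] at e2
          have e4 := bitLength_natCast_le (hi.le.trans hnB)
          have e5 := bitLength_natCast_le (i := i + 1) (B := B) (by omega)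
          push_cast at e5
          simp only [Expr.cost, Expr.eval, Store.setArr, bitLength_one, hxi]
          simp
          omega
        · refine ⟨⟨?_, ?_⟩, ?_, ?_, hi⟩
          · funext b j
            simp only [Store.setVar_arr, Store.setArr, Function.update_apply, Expr.eval, hxi, hfi,
              g3.1, h1.1, Store.setCells_arr]
            by_cases hb : b = a
            · subst hb
              simp only [if_true, Function.update_apply, Store.setCells_arr]
              by_cases hj : j = i
              · subst hj; simp
              · rw [if_neg hj]
                have : (0 ≤ j ∧ j < (i : ℤ)) ↔ (0 ≤ j ∧ j < ((i + 1 : ℕ) : ℤ)) := by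
                  push_cast; omega
                simp only [this]
            · simp [hb, Store.setCells_arr]
          · intro y hy
            simp only [Store.setVar_var, Expr.eval, Store.setArr, hxi]
            split_ifs
            · push_cast; ring
            · rw [g3.2 y (by omega), h1.2 y hy, Store.setVar_var, if_neg (by assumption)]
              rfl
          · intro y hy hyd
            simp only [Store.setVar_var, if_neg (show y ≠ x by omega), Store.setArr]
            rw [g3.2 y (by omega), h2 y hy hyd]
          · simp only [Store.setVar_var, if_neg (show d ≠ x by omega), Store.setArr]
            rw [g3.2 d (by omega), h3])
    set s1 := (s₀.setVar d (s₀.var x)).setVar x 0 with hs1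
    have hJ0 : J 0 s1 := by
      refine ⟨⟨?_, ?_⟩, ?_, ?_, Nat.zero_le _⟩
      · funext b j
        have : ¬ (0 ≤ j ∧ j < 0) := by omega
        simp only [hs1, Store.setVar_arr, ha.1, Store.setCells_arr, Nat.cast_zero, if_neg this]
        split_ifs with hb
        · rw [hb]
        · rfl
      · intro y hy
        simp only [hs1, Store.setVar_var,
          if_neg (show y ≠ d by omega), Nat.cast_zero, Store.setCells_var, ha.2 y hy]
      · intro y hy hyd
        simp [hs1, show y ≠ x by omega, show y ≠ d by omega]
      · simp [hs1, show d ≠ x by omega, ha.2 x hxS]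
    obtain ⟨T, s2, g1, g2, g3⟩ := hbody n 0 (by omega) s1 hJ0
    obtain ⟨k1, k2, k3, -⟩ := g3
    refine ⟨_, _, Exec.seq (Exec.assign _ _ _) (Exec.seq (Exec.assign _ _ _)
      (Exec.seq g1 (Exec.assign _ _ _))), ?_, ⟨?_, ?_⟩, ?_⟩
    · have e1 := bitLength_le (abs_le_two_pow (h.1 x hxS))
      simp only [Expr.cost, k3, bitLength_zero, ha.2 x hxS]
      have e4 : (n + 1) * (4 * B + (p + v + 3 * Polynomial.X + 20).eval B + 12)
        ≤ (B + 1) * (4 * B + (p + v + 3 * Polynomial.X + 20).eval B + 12) := by gcongr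
      have e5 := g2.trans e4
      simp only [Polynomial.eval_add, Polynomial.eval_mul, Polynomial.eval_X,
        Polynomial.eval_ofNat, Polynomial.eval_one] at e5 ⊢
      omega
    · funext b j
      simp only [Store.setVar_arr, k1.1, Stm.den, Store.setCells_arr]
      have : (0 ≤ j ∧ j < (n : ℤ)) ↔ (0 ≤ j ∧ j < s.var r) := by omega
      simp only [this]
      rfl
    · intro y hy
      simp only [Store.setVar_var, Expr.eval, k3, Stm.den, Store.setCells_var]
      split_ifs with hyx
      · rw [hyx]
      · rw [k1.2 y hy, Store.setVar_var, if_neg hyx]; rfl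
    · intro y hy hyd
      simp only [Store.setVar_var, if_neg (show y ≠ x by omega)]
      exact k2 y hy hyd
  | seq c d ihc ihd =>
    simp only [Stm.wf, Bool.and_eq_true] at hc
    obtain ⟨p, hp⟩ := ihc hc.1
    obtain ⟨p', hp'⟩ := ihd hc.2
    refine ⟨p + p', fun B s s₀ e he hs ha => ?_⟩
    obtain ⟨T, s', h1, h2, h3, h4⟩ := hp B s s₀ e he hs.1 ha
    obtain ⟨T', s'', h1', h2', h3', h4'⟩ := hp' B _ s' e he hs.2 h3
    refine ⟨_, _, Exec.seq h1 h1', by simp; omega, h3', fun x hx hxe => ?_⟩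
    rw [h4' x hx hxe, h4 x hx hxe]
  | rep r c ih =>
    simp only [Stm.wf, Bool.and_eq_true, decide_eq_true_eq] at hc
    obtain ⟨hrS, hc⟩ := hc
    obtain ⟨p, hp⟩ := ih hc
    refine ⟨(Polynomial.X + 1) * (p + 3 * Polynomial.X + 20) + Polynomial.X + 5,
      fun B s s₀ d hd hs ha => ?_⟩
    obtain ⟨h, hs⟩ := hs
    set n := (s.var r).toNat with hn
    have hnB : n ≤ B := h.toNat_le hrS
    have hloop : ∀ m i, i + m = n → ∀ s', Agree S (c.den^[i] s) s' →
        (∀ y, S ≤ y → y < d → s'.var y = s₀.var y) → (s'.var d).toNat = m → |s'.var d| ≤ B →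
        ∃ T s'', Exec (.loop (.var d) (.seq (c.comp (d + 1))
            (.assign d (.sub (.var d) (.const 1))))) s' T s'' ∧
          T ≤ (m + 1) * ((p.eval B) + 3 * B + 20) ∧ Agree S (c.den^[n] s) s'' ∧
          ∀ y, S ≤ y → y < d → s''.var y = s₀.var y := by
      intro m
      induction m with
      | zero =>
        intro i hi s' h1 h2 h3 h4
        have hin : i = n := by omega
        subst hin
        refine ⟨_, s', Exec.loop_false (by simp only [Expr.eval]; omega), ?_, h1, h2⟩
        have := bitLength_le (abs_le_two_pow h4)
        simp only [Expr.cost]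
        omega
      | succ m ihm =>
        intro i hi s' h1 h2 h3 h4
        obtain ⟨T, s'', g1, g2, g3, g4⟩ := hp B _ s' (d + 1) (by omega) (hs i (by omega)) h1
        have hd'' : s''.var d = s'.var d := g4 d hd (by omega)
        obtain ⟨T', s3, k1, k2, k3, k4⟩ := ihm (i + 1) (by omega)
          (s''.setVar d (s''.var d - 1))
          (by rw [Function.iterate_succ_apply']; exact g3.setVar_right hd _)
          (by
            intro y hy hyd
            rw [Store.setVar_var, if_neg (by omega), g4 y hy (by omega), h2 y hy hyd])
          (by rw [Store.setVar_var, if_pos rfl]; omega)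
          (by
            rw [Store.setVar_var, if_pos rfl, hd'']
            rw [abs_le] at h4 ⊢
            omega)
        refine ⟨_, s3, Exec.loop_true (by simp only [Expr.eval]; omega)
          (Exec.seq g1 (Exec.assign _ _ _)) k1, ?_, k3, k4⟩
        have e1 := bitLength_le (abs_le_two_pow h4)
        have e2 : bitLength (s'.var d - 1) ≤ B + 2 := by
          refine bitLength_le (abs_le_two_pow ?_)
          rw [abs_le] at h4 ⊢
          omega
        simp only [Expr.cost, Expr.eval, hd'', bitLength_one]
        have e : (m + 1 + 1) * (p.eval B + 3 * B + 20)
          = (m + 1) * (p.eval B + 3 * B + 20) + (p.eval B + 3 * B + 20) := by ring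
        omega
    obtain ⟨T, s2, g1, g2, g3, g4⟩ := hloop n 0 (by omega) (s₀.setVar d (s₀.var r))
      (ha.setVar_right hd _)
      (by intro y hy hyd; rw [Store.setVar_var, if_neg (by omega)])
      (by rw [Store.setVar_var, if_pos rfl, ha.2 r hrS])
      (by rw [Store.setVar_var, if_pos rfl, ha.2 r hrS]; exact h.1 r hrS)
    refine ⟨_, _, Exec.seq (Exec.assign _ _ _) g1, ?_, g3, g4⟩
    have e1 := bitLength_le (abs_le_two_pow (h.1 r hrS))
    have e4 : (n + 1) * (p.eval B + 3 * B + 20) ≤ (B + 1) * (p.eval B + 3 * B + 20) := by gcongr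
    have e5 := g2.trans e4
    simp only [Expr.cost, ha.2 r hrS]
    simp only [Polynomial.eval_add, Polynomial.eval_mul, Polynomial.eval_X,
        Polynomial.eval_ofNat, Polynomial.eval_one] at e5 ⊢
    omega

/-! ### Fractional hitting sets by doubling weights -/

/-- A hitting set problem: sets with indices below `M` of elements below `N`; only the active sets
have to be hit. -/
structure HitProblem where
  N : ℕ
  M : ℕ
  act : ℕ → Prop
  mem : ℕ → ℕ → Prop

open Classical in
/-- The weight of a set. -/
noncomputable def HitProblem.weight (X : HitProblem) (w : ℕ → ℤ) (c : ℕ) : ℤ :=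
  ∑ u ∈ Finset.range X.N, if X.mem c u then w u else 0

/-- The total weight. -/
def HitProblem.total (X : HitProblem) (w : ℕ → ℤ) : ℤ := ∑ u ∈ Finset.range X.N, w u

/-- An active set that has less than a `1 / (4 K)` fraction of the total weight. -/
def HitProblem.Light (X : HitProblem) (K : ℤ) (w : ℕ → ℤ) (c : ℕ) : Prop :=
  X.act c ∧ 4 * K * X.weight w c < X.total w

/-- No set is light. -/
def HitProblem.Good (X : HitProblem) (K : ℤ) (w : ℕ → ℤ) : Prop := ∀ c < X.M, ¬ X.Light K w c

/-- The first light set. -/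
def HitProblem.First (X : HitProblem) (K : ℤ) (w : ℕ → ℤ) (c : ℕ) : Prop :=
  X.Light K w c ∧ ∀ c' < c, ¬ X.Light K w c'

open Classical in
/-- Double the weights of the elements of the first light set. -/
noncomputable def HitProblem.step (X : HitProblem) (K : ℤ) (w : ℕ → ℤ) (u : ℕ) : ℤ :=
  w u * (1 + ∑ c ∈ Finset.range X.M, if X.First K w c then if X.mem c u then 1 else 0 else 0)

/-- The number of doublings. -/
def HitProblem.rounds (X : HitProblem) : ℕ := 2 * X.N * X.N + 1

open Classical in
/-- Pass on to the next value of `K` if there is a light set. -/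
noncomputable def HitProblem.advance (X : HitProblem) (z : ℤ × (ℕ → ℤ)) : ℤ × (ℕ → ℤ) :=
  if X.Good z.1 z.2 then z else (z.1 + 1, (X.step (z.1 + 1))^[X.rounds] fun _ => 1)

namespace HitProblem

variable {X : HitProblem} {K : ℤ} {w : ℕ → ℤ}

theorem step_of_good (h : X.Good K w) : X.step K w = w := by
  funext u
  have : ∀ c ∈ Finset.range X.M, ¬ X.First K w c := fun c hc hf => h c (Finset.mem_range.1 hc) hf.1
  unfold step
  rw [Finset.sum_eq_zero fun c hc => if_neg (this c hc)]
  ring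

open Classical in
theorem step_of_not_good (h : ¬ X.Good K w) :
    ∃ c < X.M, X.Light K w c ∧ ∀ u, X.step K w u = if X.mem c u then 2 * w u else w u := by
  unfold Good at h
  push Not at h
  have hex : ∃ c, c < X.M ∧ X.Light K w c := h
  refine ⟨Nat.find hex, (Nat.find_spec hex).1, (Nat.find_spec hex).2, fun u => ?_⟩
  have hfirst : ∀ c ∈ Finset.range X.M, X.First K w c ↔ c = Nat.find hex := by
    intro c hc
    constructor
    · rintro ⟨h1, h2⟩
      refine le_antisymm ?_ (Nat.find_min' hex ⟨Finset.mem_range.1 hc, h1⟩)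
      by_contra hlt
      exact h2 _ (not_le.1 hlt) (Nat.find_spec hex).2
    · rintro rfl
      refine ⟨(Nat.find_spec hex).2, fun c' hc' hl => Nat.find_min hex hc' ⟨?_, hl⟩⟩
      exact hc'.trans (Nat.find_spec hex).1
  unfold step
  rw [Finset.sum_congr rfl fun c hc => if_congr (hfirst c hc) rfl rfl, Finset.sum_ite_eq',
    if_pos (Finset.mem_range.2 (Nat.find_spec hex).1)]
  split_ifs <;> ring

theorem step_bounds (hw : ∀ u, 1 ≤ w u) (u : ℕ) :
    w u ≤ X.step K w u ∧ X.step K w u ≤ 2 * w u := by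
  have := hw u
  by_cases h : X.Good K w
  · rw [step_of_good h]; constructor <;> linarith
  · obtain ⟨c, -, -, hc⟩ := step_of_not_good h
    rw [hc]; split_ifs <;> constructor <;> linarith

theorem iterate_step_bounds (i u : ℕ) :
    1 ≤ ((X.step K)^[i] fun _ => 1) u ∧ ((X.step K)^[i] fun _ => 1) u ≤ 2 ^ i := by
  induction i generalizing u with
  | zero => simp
  | succ i ih =>
    rw [Function.iterate_succ_apply']
    have h := step_bounds (X := X) (K := K) (fun v => (ih v).1) u
    have := ih u
    rw [pow_succ]
    constructor <;> linarith

theorem total_step_of_not_good (h : ¬ X.Good K w) :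
    4 * K * X.total (X.step K w) ≤ (4 * K + 1) * X.total w := by
  obtain ⟨c, -, hl, hc⟩ := step_of_not_good h
  have : X.total (X.step K w) = X.total w + X.weight w c := by
    unfold total weight
    rw [← Finset.sum_add_distrib]
    refine Finset.sum_congr rfl fun u _ => ?_
    rw [hc]; split_ifs <;> ring
  rw [this]
  have := hl.2
  linarith

theorem prod_step_of_not_good {H : Finset ℕ} (hw : ∀ u, 1 ≤ w u)
    (hH : ∀ c < X.M, X.act c → ∃ u ∈ H, X.mem c u) (h : ¬ X.Good K w) :
    2 * ∏ u ∈ H, w u ≤ ∏ u ∈ H, X.step K w u := by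
  classical
  obtain ⟨c, hcM, hl, hc⟩ := step_of_not_good h
  obtain ⟨u, hu, hm⟩ := hH c hcM hl.1
  rw [← Finset.mul_prod_erase H _ hu, ← Finset.mul_prod_erase H _ hu, hc u, if_pos hm, ← mul_assoc]
  refine mul_le_mul_of_nonneg_left ?_ (by linarith [hw u])
  exact Finset.prod_le_prod (fun v _ => by linarith [hw v]) fun v _ => (step_bounds hw v).1

theorem good_iterate {H : Finset ℕ} (hHN : H ⊆ Finset.range X.N)
    (hH : ∀ c < X.M, X.act c → ∃ u ∈ H, X.mem c u) :
    X.Good H.card ((X.step H.card)^[X.rounds] fun _ => 1) := by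
  set K := H.card with hK
  by_contra hbad
  set W : ℕ → ℕ → ℤ := fun i => (X.step K)^[i] fun _ => 1 with hW
  have hWs : ∀ i, W (i + 1) = X.step K (W i) := fun i => Function.iterate_succ_apply' _ _ _
  have hW1 : ∀ i u, 1 ≤ W i u := fun i u => (iterate_step_bounds i u).1
  have hall : ∀ i ≤ X.rounds, ¬ X.Good K (W i) := by
    intro i hi hg
    have : ∀ j, X.Good K (W (i + j)) := by
      intro j
      induction j with
      | zero => exact hg
      | succ j ih => rw [← add_assoc, hWs, step_of_good ih]; exact ih
    have h2 := this (X.rounds - i)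
    rw [Nat.add_sub_cancel' hi] at h2
    exact hbad h2
  have hKpos : 0 < K := by
    have := hall 0 (Nat.zero_le _)
    obtain ⟨c, hcM, hl, -⟩ := step_of_not_good this
    obtain ⟨u, hu, -⟩ := hH c hcM hl.1
    exact Finset.card_pos.2 ⟨u, hu⟩
  have hKN : K ≤ X.N := by simpa using Finset.card_le_card hHN
  have hprod : ∀ i ≤ X.rounds, (2 : ℤ) ^ i ≤ ∏ u ∈ H, W i u := by
    intro i
    induction i with
    | zero => intro _; simp [hW]
    | succ i ih =>
      intro hi
      have h1 := prod_step_of_not_good (hW1 i) hH (hall i (by omega))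
      have h2 := ih (by omega)
      rw [hWs, pow_succ]
      linarith
  have htot : ∀ i ≤ X.rounds, (4 * K : ℤ) ^ i * X.total (W i) ≤ (4 * K + 1) ^ i * X.N := by
    intro i
    induction i with
    | zero => intro _; simp [hW, total]
    | succ i ih =>
      intro hi
      have h1 := total_step_of_not_good (hall i (by omega))
      have h2 := ih (by omega)
      rw [hWs, pow_succ, pow_succ]
      calc (4 * K : ℤ) ^ i * (4 * K) * X.total (X.step K (W i))
          = (4 * K) ^ i * (4 * K * X.total (X.step K (W i))) := by ring
        _ ≤ (4 * K) ^ i * ((4 * K + 1) * X.total (W i)) := by gcongr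
        _ = (4 * K + 1) * ((4 * K) ^ i * X.total (W i)) := by ring
        _ ≤ (4 * K + 1) * ((4 * K + 1) ^ i * X.N) := by gcongr
        _ = _ := by ring
  set T := X.rounds with hT
  have hle : ∏ u ∈ H, W T u ≤ X.total (W T) ^ K := by
    rw [hK]
    rw [← Finset.prod_const]
    refine Finset.prod_le_prod (fun u _ => by linarith [hW1 T u]) fun u hu => ?_
    exact Finset.single_le_sum (f := W T) (fun v _ => by linarith [hW1 T v]) (hHN hu)
  have h1 : (2 : ℝ) ^ T ≤ (X.total (W T) : ℝ) ^ K := by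
    exact_mod_cast (hprod T le_rfl).trans hle
  have h2 : (4 * K : ℝ) ^ T * (X.total (W T) : ℝ) ≤ (4 * K + 1) ^ T * X.N := by
    exact_mod_cast htot T le_rfl
  have hKR : (0 : ℝ) < 4 * K := by positivity
  have h3 : (X.total (W T) : ℝ) ≤ Real.exp (1 / (4 * K)) ^ T * X.N := by
    have e : (4 * K + 1 : ℝ) ≤ 4 * K * Real.exp (1 / (4 * K)) := by
      have := Real.add_one_le_exp (1 / (4 * K : ℝ))
      calc (4 * K + 1 : ℝ) = 4 * K * (1 / (4 * K) + 1) := by field_simp; ring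
        _ ≤ _ := by gcongr
    have e2 : (4 * K + 1 : ℝ) ^ T ≤ (4 * K * Real.exp (1 / (4 * K))) ^ T := by gcongr
    rw [mul_pow] at e2
    have e3 : (4 * K : ℝ) ^ T * (X.total (W T) : ℝ)
        ≤ (4 * K : ℝ) ^ T * (Real.exp (1 / (4 * K)) ^ T * X.N) := by
      refine h2.trans ?_
      rw [← mul_assoc]
      gcongr
    exact le_of_mul_le_mul_left e3 (by positivity)
  have hnn : (0 : ℝ) ≤ X.total (W T) := by
    have : 0 ≤ X.total (W T) := Finset.sum_nonneg fun u _ => by linarith [hW1 T u]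
    exact_mod_cast this
  have h4 : ((2 : ℝ) ^ T) ^ 4 ≤ 4 ^ T * (X.N : ℝ) ^ (4 * K) := by
    calc ((2 : ℝ) ^ T) ^ 4 ≤ ((X.total (W T) : ℝ) ^ K) ^ 4 := by gcongr
      _ = (X.total (W T) : ℝ) ^ (4 * K) := by rw [← pow_mul, mul_comm]
      _ ≤ (Real.exp (1 / (4 * K)) ^ T * X.N) ^ (4 * K) := by gcongr
      _ = (Real.exp (1 / (4 * K)) ^ (4 * K)) ^ T * (X.N : ℝ) ^ (4 * K) := by
        rw [mul_pow, ← pow_mul, ← pow_mul, mul_comm T]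
      _ = Real.exp 1 ^ T * (X.N : ℝ) ^ (4 * K) := by
        rw [← Real.exp_nat_mul]
        congr 3
        push_cast
        field_simp
      _ ≤ 4 ^ T * (X.N : ℝ) ^ (4 * K) := by
        gcongr
        linarith [Real.exp_one_lt_d9]
  have h5 : (2 : ℝ) ^ (2 * T) ≤ (X.N : ℝ) ^ (4 * K) := by
    have e : ((2 : ℝ) ^ T) ^ 4 = 4 ^ T * 2 ^ (2 * T) := by
      rw [show (4 : ℝ) = 2 ^ 2 by norm_num, ← pow_mul, ← pow_mul, ← pow_add]
      congr 1; ring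
    rw [e] at h4
    exact le_of_mul_le_mul_left h4 (by positivity)
  have h6 : 2 ^ (2 * T) ≤ X.N ^ (4 * K) := by exact_mod_cast h5
  have h7 : X.N ^ (4 * K) ≤ 2 ^ (X.N * (4 * X.N)) := by
    calc X.N ^ (4 * K) ≤ (2 ^ X.N) ^ (4 * K) := by
          gcongr; exact Nat.lt_two_pow_self.le
      _ = 2 ^ (X.N * (4 * K)) := (pow_mul _ _ _).symm
      _ ≤ _ := by gcongr; norm_num
  have h8 := (Nat.pow_le_pow_iff_right (by norm_num : 1 < 2)).1 (h6.trans h7)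
  simp only [hT, rounds] at h8
  nlinarith

theorem iterate_advance {H : Finset ℕ} (hHN : H ⊆ Finset.range X.N)
    (hH : ∀ c < X.M, X.act c → ∃ u ∈ H, X.mem c u) :
    let z := X.advance^[X.N + 1] (0, fun _ => 1)
    X.Good z.1 z.2 ∧ 0 ≤ z.1 ∧ z.1 ≤ H.card := by
  have key : ∀ i, let z := X.advance^[i] (0, fun _ => 1)
      (0 ≤ z.1 ∧ z.1 ≤ H.card) ∧ (X.Good z.1 z.2 ∨ (z.1 = i ∧ i < H.card)) := by
    intro i
    induction i with
    | zero =>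
      simp only [Function.iterate_zero, id, le_refl, Nat.cast_nonneg, true_and, Nat.cast_zero]
      rcases Nat.eq_zero_or_pos H.card with h | h
      · left
        intro c hc hl
        obtain ⟨u, hu, -⟩ := hH c hc hl.1
        rw [Finset.card_eq_zero.1 h] at hu
        simp at hu
      · exact Or.inr h
    | succ i ih =>
      rw [Function.iterate_succ_apply']
      set z := X.advance^[i] (0, fun _ => 1) with hz
      obtain ⟨⟨h0, h1⟩, h2⟩ := ih
      by_cases hg : X.Good z.1 z.2
      · simp only [advance, if_pos hg]
        exact ⟨⟨h0, h1⟩, Or.inl hg⟩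
      · obtain ⟨h3, h4⟩ := h2.resolve_left hg
        simp only [advance, if_neg hg, h3]
        refine ⟨⟨by positivity, by exact_mod_cast h4⟩, ?_⟩
        rcases Nat.lt_or_ge (i + 1) H.card with h5 | h5
        · exact Or.inr ⟨by simp, h5⟩
        · left
          have : ((i : ℤ) + 1) = (H.card : ℕ) := by omega
          rw [this]
          exact good_iterate hHN hH
  obtain ⟨h1, h2⟩ := key (X.N + 1)
  refine ⟨h2.resolve_right ?_, h1⟩
  rintro ⟨-, h3⟩
  have : H.card ≤ X.N := by simpa using Finset.card_le_card hHN
  omega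

theorem advance_bounds (i : ℕ) :
    let z := X.advance^[i] (0, fun _ => 1)
    0 ≤ z.1 ∧ z.1 ≤ i ∧ ∀ u, 1 ≤ z.2 u ∧ z.2 u ≤ 2 ^ X.rounds := by
  induction i with
  | zero => simp [one_le_pow₀]
  | succ i ih =>
    rw [Function.iterate_succ_apply']
    set z := X.advance^[i] (0, fun _ => 1) with hz
    obtain ⟨h0, h1, h2⟩ := ih
    simp only [advance]
    split_ifs
    · exact ⟨h0, by push_cast; linarith, h2⟩
    · exact ⟨by simp only; linarith, by push_cast; linarith, fun u => iterate_step_bounds _ u⟩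

end HitProblem

/-! ### Nets for intervals -/

/-- The scaled and rounded weight of the first `u` elements grows at `u`. -/
def Jump (N : ℕ) (K : ℤ) (w : ℕ → ℤ) (u : ℕ) : Prop :=
  8 * K * (∑ v ∈ Finset.range u, w v) / (∑ v ∈ Finset.range N, w v)
    < 8 * K * (∑ v ∈ Finset.range (u + 1), w v) / (∑ v ∈ Finset.range N, w v)

open Classical in
theorem card_jumps_le {N : ℕ} {K : ℤ} {w : ℕ → ℤ} (hK : 0 ≤ K) (hw : ∀ u, 1 ≤ w u) :
    (((Finset.range N).filter (Jump N K w)).card : ℤ) ≤ 8 * K := by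
  set W := ∑ v ∈ Finset.range N, w v with hW
  have hW0 : 0 ≤ W := Finset.sum_nonneg fun u _ => by linarith [hw u]
  have key : ∀ m, (((Finset.range m).filter (Jump N K w)).card : ℤ)
      ≤ 8 * K * (∑ v ∈ Finset.range m, w v) / W := by
    intro m
    induction m with
    | zero => simp
    | succ m ih =>
      rw [Finset.range_add_one, Finset.filter_insert]
      split_ifs with hj
      · rw [Finset.card_insert_of_notMem (by simp)]
        have := hj
        unfold Jump at this
        rw [← hW] at this
        rw [← Finset.range_add_one]
        push_cast
        omega
      · refine ih.trans ?_
        rcases hW0.eq_or_lt with h | h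
        · rw [← h]; simp
        · refine Int.ediv_le_ediv h (mul_le_mul_of_nonneg_left ?_ (by linarith))
          rw [← Finset.range_add_one, Finset.sum_range_succ]
          linarith [hw m]
  refine (key N).trans ?_
  rcases hW0.eq_or_lt with h | h
  · rw [← hW, ← h]; simp; linarith
  · rw [← hW, Int.mul_ediv_cancel _ h.ne']

theorem exists_jump {N : ℕ} {K : ℤ} {w : ℕ → ℤ} {l r : ℕ}
    (hW : 0 < ∑ v ∈ Finset.range N, w v)
    (h : ∑ v ∈ Finset.range N, w v ≤ 8 * K * ∑ v ∈ Finset.Ico l r, w v) :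
    ∃ u, l ≤ u ∧ u < r ∧ Jump N K w u := by
  set W := ∑ v ∈ Finset.range N, w v with hWdef
  by_contra hno
  push Not at hno
  have hlr : l ≤ r := by
    by_contra hlt
    rw [Finset.Ico_eq_empty (by omega)] at h
    simp at h
    omega
  have key : ∀ m, l + m ≤ r → 8 * K * (∑ v ∈ Finset.range (l + m), w v) / W
      ≤ 8 * K * (∑ v ∈ Finset.range l, w v) / W := by
    intro m
    induction m with
    | zero => intro _; rfl
    | succ m ih =>
      intro hm
      have h1 := ih (by omega)
      have h2 := hno (l + m) (by omega) (by omega)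
      unfold Jump at h2
      rw [not_lt] at h2
      exact h2.trans h1
  have h1 := key (r - l) (by omega)
  rw [Nat.add_sub_cancel' hlr] at h1
  rw [Finset.sum_Ico_eq_sub _ hlr] at h
  have h2 : (8 * K * (∑ v ∈ Finset.range l, w v) + W) / W
      ≤ 8 * K * (∑ v ∈ Finset.range r, w v) / W :=
    Int.ediv_le_ediv hW (by linarith)
  have h3 := Int.add_mul_ediv_right (8 * K * (∑ v ∈ Finset.range l, w v)) 1 hW.ne'
  rw [one_mul] at h3
  omega

/-- If all the two-part sets with thresholds `h₀ ≤ n` are heavy, then there are jumps in both parts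
in the right order. -/
theorem exists_jump_pair {N n : ℕ} {K : ℤ} {w : ℕ → ℤ} {A B a b : ℕ} (hw : ∀ u, 1 ≤ w u)
    (hK : 0 ≤ K) (hN : 0 < N) (hb : b < n)
    (h : ∀ h₀ ≤ n, ∑ v ∈ Finset.range N, w v ≤ 4 * K * ∑ u ∈ Finset.range N,
      if (A + a ≤ u ∧ u < A + h₀) ∨ (B + h₀ ≤ u ∧ u ≤ B + b) then w u else 0) :
    ∃ v v', a ≤ v ∧ v ≤ v' ∧ v' ≤ b ∧ Jump N K w (A + v) ∧ Jump N K w (B + v') := by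
  set W := ∑ v ∈ Finset.range N, w v with hWdef
  have hW : 0 < W := Finset.sum_pos (fun u _ => by linarith [hw u]) ⟨0, by simpa using hN⟩
  have hpart : ∀ h₀ ≤ n, W ≤ 4 * K * (∑ u ∈ Finset.Ico (A + a) (A + h₀), w u
      + ∑ u ∈ Finset.Ico (B + h₀) (B + b + 1), w u) := by
    intro h₀ hh
    refine (h h₀ hh).trans ?_
    refine mul_le_mul_of_nonneg_left ?_ (by linarith)
    rw [← Finset.sum_filter, ← Finset.sum_union_inter]
    have e1 : 0 ≤ ∑ u ∈ Finset.Ico (A + a) (A + h₀) ∩ Finset.Ico (B + h₀) (B + b + 1), w u :=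
      Finset.sum_nonneg fun u _ => by linarith [hw u]
    refine le_trans (Finset.sum_le_sum_of_subset_of_nonneg ?_ fun u _ _ => by linarith [hw u])
      (le_add_of_nonneg_right e1)
    intro u hu
    simp only [Finset.mem_filter, Finset.mem_union, Finset.mem_Ico] at hu ⊢
    omega
  have hbW : W ≤ 8 * K * ∑ u ∈ Finset.Ico (A + a) (A + b + 1), w u := by
    have := hpart (b + 1) hb
    rw [Finset.Ico_eq_empty (a := B + (b + 1)) (by omega), Finset.sum_empty, add_zero,
      ← add_assoc] at this
    have e1 : 0 ≤ K * ∑ u ∈ Finset.Ico (A + a) (A + b + 1), w u :=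
      mul_nonneg hK (Finset.sum_nonneg fun u _ => by linarith [hw u])
    linarith
  have hex : ∃ h₀, W ≤ 8 * K * ∑ u ∈ Finset.Ico (A + a) (A + h₀ + 1), w u := ⟨b, hbW⟩
  classical
  set h₀ := Nat.find hex with hh₀
  have hspec := Nat.find_spec hex
  rw [← hh₀] at hspec
  have hleb : h₀ ≤ b := Nat.find_min' hex hbW
  have hlow : 8 * K * ∑ u ∈ Finset.Ico (A + a) (A + h₀), w u < W := by
    rcases Nat.eq_zero_or_pos h₀ with h0 | h0
    · rw [h0, Finset.Ico_eq_empty (by omega)]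
      simpa using hW
    · have := Nat.find_min hex (m := h₀ - 1) (by omega)
      rw [not_le, show A + (h₀ - 1) + 1 = A + h₀ by omega] at this
      exact this
  have hhigh : W ≤ 8 * K * ∑ u ∈ Finset.Ico (B + h₀) (B + b + 1), w u := by
    have := hpart h₀ (by omega)
    linarith
  obtain ⟨u, hu1, hu2, hu3⟩ := exists_jump hW hspec
  obtain ⟨u', hu1', hu2', hu3'⟩ := exists_jump hW hhigh
  refine ⟨u - A, u' - B, by omega, by omega, by omega, ?_, ?_⟩
  · rwa [Nat.add_sub_cancel' (by omega)]
  · rwa [Nat.add_sub_cancel' (by omega)]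

/-! ### Monotone paths -/

theorem le_succ_of_sum_abs_le {f : ℕ → ℝ} {K : ℕ}
    (h : ∑ i ∈ Finset.range K, |f i - f (i + 1)| ≤ |f 0 - f K|) (h0 : f 0 ≤ f K) :
    ∀ i < K, f i ≤ f (i + 1) := by
  have hs : ∑ i ∈ Finset.range K, (|f i - f (i + 1)| - (f (i + 1) - f i)) ≤ 0 := by
    rw [Finset.sum_sub_distrib, Finset.sum_range_sub]
    rw [abs_of_nonpos (by linarith : f 0 - f K ≤ 0)] at h
    linarith
  have hnn : ∀ i ∈ Finset.range K, 0 ≤ |f i - f (i + 1)| - (f (i + 1) - f i) := by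
    intro i _
    have := neg_abs_le (f i - f (i + 1))
    linarith
  have hz := (Finset.sum_eq_zero_iff_of_nonneg hnn).1 (le_antisymm hs (Finset.sum_nonneg hnn))
  intro i hi
  have := hz i (Finset.mem_range.2 hi)
  have := abs_nonneg (f i - f (i + 1))
  linarith

theorem le_of_le_succ {f : ℕ → ℝ} {K : ℕ} (h : ∀ i < K, f i ≤ f (i + 1)) {i j : ℕ} (hij : i ≤ j)
    (hj : j ≤ K) : f i ≤ f j := by
  induction j, hij using Nat.le_induction with
  | base => exact le_rfl
  | succ j hij ih => exact (ih (by omega)).trans (h j (by omega))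

theorem abs_sums_of_l1Dist {x : ℕ → ℝ × ℝ} {K : ℕ}
    (h : ∑ i ∈ Finset.range K, l1Dist (x i) (x (i + 1)) = l1Dist (x 0) (x K)) :
    ∑ i ∈ Finset.range K, |(x i).1 - (x (i + 1)).1| ≤ |(x 0).1 - (x K).1| ∧
      ∑ i ∈ Finset.range K, |(x i).2 - (x (i + 1)).2| ≤ |(x 0).2 - (x K).2| := by
  have h1 := dist_le_range_sum_dist (fun i => (x i).1) K
  have h2 := dist_le_range_sum_dist (fun i => (x i).2) K
  simp only [Real.dist_eq] at h1 h2
  simp only [l1Dist, Finset.sum_add_distrib] at h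
  constructor <;> linarith

theorem l1Dist_comm (a b : ℝ × ℝ) : l1Dist a b = l1Dist b a := by
  simp only [l1Dist, abs_sub_comm]

theorem MConnected.symm {S : Set (ℝ × ℝ)} {p q : ℝ × ℝ} (h : MConnected S p q) :
    MConnected S q p := by
  obtain ⟨k, x, h0, hk, hS, ha, hs⟩ := h
  refine ⟨k, fun i => x (k - i), by simpa using hk, by simpa using h0,
    fun i _ => hS _ (Nat.sub_le _ _), fun i hi => ?_, ?_⟩
  · have := ha (k - (i + 1)) (by omega)
    rw [show k - (i + 1) + 1 = k - i by omega] at this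
    exact this.imp Eq.symm Eq.symm
  · rw [l1Dist_comm q p, ← hs, ← Finset.sum_range_reflect]
    refine Finset.sum_congr rfl fun i hi => ?_
    rw [Finset.mem_range] at hi
    beta_reduce
    rw [l1Dist_comm, show k - (k - 1 - i) = i + 1 by omega, show k - (k - 1 - i + 1) = i by omega]

/-! ### Strips of the levels of a tree of degree `2 ^ k` -/

/-- The strip of level `l` of the rank `r`. -/
def strip (k l r : ℕ) : ℕ := r / 2 ^ (k * l)

theorem strip_mono (k l : ℕ) {r r' : ℕ} (h : r ≤ r') : strip k l r ≤ strip k l r' :=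
  Nat.div_le_div_right h

theorem strip_le (k l r : ℕ) : strip k l r ≤ r := Nat.div_le_self _ _

theorem strip_eq_of_le {k l l' r r' : ℕ} (hl : l ≤ l') (h : strip k l r = strip k l r') :
    strip k l' r = strip k l' r' := by
  obtain ⟨m, rfl⟩ := Nat.exists_eq_add_of_le hl
  unfold strip at *
  rw [mul_add, pow_add, ← Nat.div_div_eq_div_mul, ← Nat.div_div_eq_div_mul, h]

/-- The triples of a level, a strip and a row of points of `S` such that the row leaves the strip,
but not its parent, in the direction `ε`. -/
noncomputable def crossings (S : Finset (ℝ × ℝ)) (ρ : ℝ → ℕ) (k n : ℕ) (ε : ℝ) :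
    Finset (ℕ × ℕ × ℝ) :=
  open Classical in
  (Finset.range k ×ˢ Finset.range n ×ˢ S.image Prod.snd).filter fun c =>
    ∃ x ∈ S, ∃ x' ∈ S, x.2 = c.2.2 ∧ x'.2 = c.2.2 ∧ ε * x.1 < ε * x'.1 ∧
      strip k c.1 (ρ x.1) = c.2.1 ∧ strip k c.1 (ρ x'.1) ≠ c.2.1 ∧
      strip k (c.1 + 1) (ρ x.1) = strip k (c.1 + 1) (ρ x'.1)

theorem card_crossings_le {R Q : Finset (ℝ × ℝ)} {ρ : ℝ → ℕ} (hρ : Monotone ρ) (k n : ℕ) {ε : ℝ}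
    (hε : ε = 1 ∨ ε = -1) (hR : ∀ x ∈ R, ∀ y ∈ R, x.2 = y.2 → x = y) :
    (crossings (R ∪ Q) ρ k n ε).card ≤ 2 * Q.card := by
  classical
  set S := R ∪ Q with hS
  set E := S.filter fun x => ∃ x' ∈ S, x'.2 = x.2 ∧ ε * x.1 < ε * x'.1 with hE
  have h1 : (crossings S ρ k n ε).card ≤ E.card := by
    refine Finset.card_le_card_of_forall_subsingleton
      (fun c x => x.2 = c.2.2 ∧ strip k c.1 (ρ x.1) = c.2.1 ∧
        (∀ y ∈ S, y.2 = c.2.2 → strip k c.1 (ρ y.1) = c.2.1 → ε * y.1 ≤ ε * x.1) ∧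
        ∃ x' ∈ S, x'.2 = c.2.2 ∧ ε * x.1 < ε * x'.1 ∧
          strip k (c.1 + 1) (ρ x.1) = strip k (c.1 + 1) (ρ x'.1)) ?_ ?_
    · rintro ⟨l, i, h⟩ hc
      simp only [crossings, Finset.mem_filter] at hc
      obtain ⟨-, x, hx, x', hx', e1, e2, e3, e4, e5, e6⟩ := hc
      obtain ⟨z, hz, hmax⟩ := Finset.exists_max_image
        (S.filter fun y => y.2 = h ∧ strip k l (ρ y.1) = i) (fun y => ε * y.1)
        ⟨x, by simp [hx, e1, e4]⟩
      simp only [Finset.mem_filter] at hz hmax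
      have hzx' : ε * z.1 < ε * x'.1 := by
        by_contra hle
        rw [not_lt] at hle
        apply e5
        have a1 := hz.2.2
        rcases hε with rfl | rfl
        · simp only [one_mul] at e3 hle
          have := strip_mono k l (hρ e3.le)
          have := strip_mono k l (hρ hle)
          omega
        · have e3' : x'.1 < x.1 := by linarith
          have hle' : z.1 ≤ x'.1 := by linarith
          have := strip_mono k l (hρ e3'.le)
          have := strip_mono k l (hρ hle')
          omega
      refine ⟨z, ?_, hz.2.1, hz.2.2, fun y hy a b => hmax y ⟨hy, a, b⟩, x', hx', e2, hzx', ?_⟩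
      · simp only [hE, Finset.mem_filter]
        exact ⟨hz.1, x', hx', by rw [e2, hz.2.1], hzx'⟩
      · rw [← e6]
        exact strip_eq_of_le (Nat.le_succ l) (hz.2.2.trans e4.symm)
    · rintro x hx ⟨l, i, h⟩ ⟨-, e1, e2, e3, x', hx', e4, e5, e6⟩
        ⟨l', i', h'⟩ ⟨-, f1, f2, f3, y', hy', f4, f5, f6⟩
      simp only at e1 e2 e3 e4 e5 e6 f1 f2 f3 f4 f5 f6
      have hll : l = l' := by
        rcases lt_trichotomy l l' with h | h | h
        · have := f3 x' hx' (by rw [e4, ← e1, f1])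
            (by rw [← strip_eq_of_le (show l + 1 ≤ l' from h) e6, f2])
          linarith
        · exact h
        · have := e3 y' hy' (by rw [f4, ← f1, e1])
            (by rw [← strip_eq_of_le (show l' + 1 ≤ l from h) f6, e2])
          linarith
      subst hll
      rw [← e1, ← e2, ← f1, ← f2]
  have h2 : (E.filter fun x => x ∈ Q).card ≤ Q.card :=
    Finset.card_le_card fun x hx => (Finset.mem_filter.1 hx).2
  have h3 : (E.filter fun x => ¬ x ∈ Q).card ≤ Q.card := by
    refine Finset.card_le_card_of_forall_subsingleton (fun x y => x.2 = y.2) ?_ ?_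
    · intro x hx
      simp only [hE, hS, Finset.mem_filter, Finset.mem_union] at hx
      obtain ⟨⟨h1, x', h2, h3, h4⟩, h5⟩ := hx
      rcases h2 with h2 | h2
      · have := hR x' h2 x (h1.resolve_right h5) h3
        rw [this] at h4
        exact absurd h4 (lt_irrefl _)
      · exact ⟨x', h2, h3.symm⟩
    · rintro y hy x ⟨hx, hxy⟩ x' ⟨hx', hxy'⟩
      simp only [hE, hS, Finset.mem_filter, Finset.mem_union] at hx hx'
      exact hR x (hx.1.1.resolve_right hx.2) x' (hx'.1.1.resolve_right hx'.2) (hxy.trans hxy'.symm)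
  have h4 := Finset.card_filter_add_card_filter_not (s := E) (fun x => x ∈ Q)
  omega

/-- A path between points of different strips with the same parent leaves the first strip and,
later, enters the last one. -/
theorem exists_crossings {S : Finset (ℝ × ℝ)} {ρ : ℝ → ℕ} (hρ : Monotone ρ) {k n l : ℕ}
    (hn : ∀ x, ρ x < n) (hl : l < k) {p q : ℝ × ℝ} (hpq : p.1 < q.1)
    (h1 : strip k l (ρ p.1) ≠ strip k l (ρ q.1))
    (h2 : strip k (l + 1) (ρ p.1) = strip k (l + 1) (ρ q.1))
    (h : MConnected (S : Set (ℝ × ℝ)) p q) :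
    ∃ y y', (l, strip k l (ρ p.1), y) ∈ crossings S ρ k n 1 ∧
      (l, strip k l (ρ q.1), y') ∈ crossings S ρ k n (-1) ∧
      ((p.2 ≤ q.2 ∧ p.2 ≤ y ∧ y ≤ y' ∧ y' ≤ q.2) ∨ (q.2 ≤ p.2 ∧ q.2 ≤ y' ∧ y' ≤ y ∧ y ≤ p.2)) := by
  classical
  obtain ⟨K, x, rfl, rfl, hS, ha, hs⟩ := h
  obtain ⟨s1, s2⟩ := abs_sums_of_l1Dist hs
  have hx := le_succ_of_sum_abs_le s1 hpq.le
  have hxm : ∀ i j, i ≤ j → j ≤ K → (x i).1 ≤ (x j).1 := fun i j hij hj =>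
    le_of_le_succ (f := fun i => (x i).1) hx hij hj
  set g : ℕ → ℕ := fun t => strip k l (ρ (x t).1) with hg
  have hgm : ∀ i j, i ≤ j → j ≤ K → g i ≤ g j := fun i j hij hj =>
    strip_mono k l (hρ (hxm i j hij hj))
  have hpar : ∀ i ≤ K, strip k (l + 1) (ρ (x i).1) = strip k (l + 1) (ρ (x 0).1) := by
    intro i hi
    have e1 := strip_mono k (l + 1) (hρ (hxm 0 i (Nat.zero_le _) hi))
    have e2 := strip_mono k (l + 1) (hρ (hxm i K hi le_rfl))
    omega
  have hrow : ∀ i < K, g i ≠ g (i + 1) → (x i).2 = (x (i + 1)).2 := by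
    intro i hi hne
    refine (ha i hi).resolve_left fun he => hne ?_
    simp only [hg, he]
  have hlt : ∀ i < K, g i ≠ g (i + 1) → (x i).1 < (x (i + 1)).1 := by
    intro i hi hne
    refine lt_of_le_of_ne (hx i hi) fun he => hne ?_
    simp only [hg, he]
  have hexE : ∃ t, t ≤ K ∧ g t ≠ g 0 := ⟨K, le_rfl, fun he => h1 he.symm⟩
  have hexF : ∃ t, t ≤ K ∧ g t = g K := ⟨K, le_rfl, rfl⟩
  obtain ⟨he1, he2⟩ := Nat.find_spec hexE
  obtain ⟨hf1, hf2⟩ := Nat.find_spec hexF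
  have heF : Nat.find hexE ≤ Nat.find hexF :=
    Nat.find_min' hexE ⟨hf1, by rw [hf2]; exact fun he => h1 he.symm⟩
  have he0 : Nat.find hexE ≠ 0 := fun h0 => he2 (by rw [h0])
  have hem := fun m hm => Nat.find_min hexE (m := m) hm
  have hfm := fun m hm => Nat.find_min hexF (m := m) hm
  generalize Nat.find hexE = E at *
  generalize Nat.find hexF = F at *
  obtain ⟨e, rfl⟩ := Nat.exists_eq_succ_of_ne_zero he0
  obtain ⟨f, rfl⟩ := Nat.exists_eq_succ_of_ne_zero (show F ≠ 0 by omega)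
  simp only [Nat.succ_eq_add_one] at *
  have hge : g e = g 0 := by
    by_contra hne
    exact hem e (by omega) ⟨by omega, hne⟩
  have hgf : g f ≠ g K := fun he => hfm f (by omega) ⟨by omega, he⟩
  have hne1 : g e ≠ g (e + 1) := by rw [hge]; exact he2.symm
  have hne2 : g f ≠ g (f + 1) := by rw [hf2]; exact hgf
  refine ⟨(x (e + 1)).2, (x (f + 1)).2, ?_, ?_, ?_⟩
  · simp only [crossings, Finset.mem_filter, Finset.mem_product, Finset.mem_range,
      Finset.mem_image]
    refine ⟨⟨hl, (strip_le _ _ _).trans_lt (hn _), x (e + 1), hS _ (by omega), rfl⟩,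
      x e, hS _ (by omega), x (e + 1), hS _ (by omega), hrow e (by omega) hne1, rfl, ?_, hge,
      he2, ?_⟩
    · simpa using hlt e (by omega) hne1
    · rw [hpar e (by omega), hpar (e + 1) (by omega)]
  · simp only [crossings, Finset.mem_filter, Finset.mem_product, Finset.mem_range,
      Finset.mem_image]
    refine ⟨⟨hl, (strip_le _ _ _).trans_lt (hn _), x (f + 1), hS _ (by omega), rfl⟩,
      x (f + 1), hS _ (by omega), x f, hS _ (by omega), rfl, hrow f (by omega) hne2, ?_, hf2,
      hgf, ?_⟩
    · have := hlt f (by omega) hne2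
      linarith
    · rw [hpar f (by omega), hpar (f + 1) (by omega)]
  · rcases le_total (x 0).2 (x K).2 with hy | hy
    · left
      have hyi := le_succ_of_sum_abs_le s2 hy
      have hym : ∀ i j, i ≤ j → j ≤ K → (x i).2 ≤ (x j).2 := fun i j hij hj =>
        le_of_le_succ (f := fun i => (x i).2) hyi hij hj
      exact ⟨hy, hym _ _ (by omega) (by omega), hym _ _ (by omega) (by omega),
        hym _ _ (by omega) (by omega)⟩
    · right
      have hyi := le_succ_of_sum_abs_le (f := fun i => -(x i).2) (K := K)
        (by
          simp only [neg_sub_neg]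
          simp only [abs_sub_comm (x (_ + 1)).2, abs_sub_comm (x K).2]
          exact s2) (by simpa using hy)
      have hym : ∀ i j, i ≤ j → j ≤ K → (x j).2 ≤ (x i).2 := fun i j hij hj => by
        have := le_of_le_succ (f := fun i => -(x i).2) hyi hij hj
        simpa using this
      exact ⟨hy, hym _ _ (by omega) (by omega), hym _ _ (by omega) (by omega),
        hym _ _ (by omega) (by omega)⟩

theorem card_filter_not_range {p : ℕ → Prop} [DecidablePred p] (hp : ∀ i, p i → p (i + 1))
    (h : ∃ i, p i) {n : ℕ} (hn : Nat.find h ≤ n) :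
    ((Finset.range n).filter fun i => ¬ p i).card = Nat.find h := by
  have hmono : ∀ i j, i ≤ j → p i → p j := fun i j hij hi =>
    Nat.le_induction hi (fun m _ => hp m) j hij
  have : ((Finset.range n).filter fun i => ¬ p i) = Finset.range (Nat.find h) := by
    ext i
    simp only [Finset.mem_filter, Finset.mem_range, Nat.lt_find_iff]
    constructor
    · rintro ⟨-, h1⟩ m hm h2
      exact h1 (hmono m i hm h2)
    · intro h1
      refine ⟨lt_of_lt_of_le ?_ hn, h1 i le_rfl⟩
      exact (Nat.lt_find_iff h i).2 h1
  rw [this, Finset.card_range]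

namespace Instance

variable (I : Instance)

/-! ### Ranks -/

/-- The number of points whose coordinate is less than `z`. -/
def rank (f : ℤ × ℤ → ℤ) (z : ℤ) : ℕ := (I.P.filter fun p => f p < z).card

/-- The coordinate of rank `m`. -/
def coord (f : ℤ × ℤ → ℤ) (m : ℕ) : ℤ := ∑ p ∈ I.P, if I.rank f (f p) = m then f p else 0

/-- The rank of the last coordinate up to `x`. -/
noncomputable def floorRank (f : ℤ × ℤ → ℤ) (x : ℝ) : ℕ :=
  (I.P.filter fun p => ((f p : ℤ) : ℝ) ≤ x).card - 1

variable {I} {f : ℤ × ℤ → ℤ}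

theorem injOn_fst : Set.InjOn (Prod.fst : ℤ × ℤ → ℤ) (I.P : Set (ℤ × ℤ)) :=
  fun p hp q hq h => I.column_inj p hp q hq h

theorem injOn_snd : Set.InjOn (Prod.snd : ℤ × ℤ → ℤ) (I.P : Set (ℤ × ℤ)) :=
  fun p hp q hq h => I.row_inj p hp q hq h

theorem rank_lt_rank {p : ℤ × ℤ} (hp : p ∈ I.P) {z : ℤ} (h : f p < z) :
    I.rank f (f p) < I.rank f z := by
  refine Finset.card_lt_card (Finset.ssubset_iff_of_subset ?_ |>.2 ⟨p, by simp [hp, h], by simp⟩)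
  intro q hq
  simp only [Finset.mem_filter] at hq ⊢
  exact ⟨hq.1, hq.2.trans h⟩

theorem rank_lt_card {p : ℤ × ℤ} (hp : p ∈ I.P) : I.rank f (f p) < I.P.card := by
  refine Finset.card_lt_card (Finset.ssubset_iff_of_subset (Finset.filter_subset _ _) |>.2
    ⟨p, hp, by simp⟩)

theorem eq_of_rank_eq (hf : Set.InjOn f (I.P : Set (ℤ × ℤ))) {p q : ℤ × ℤ} (hp : p ∈ I.P)
    (hq : q ∈ I.P) (h : I.rank f (f p) = I.rank f (f q)) : p = q := by
  rcases lt_trichotomy (f p) (f q) with h1 | h1 | h1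
  · have := rank_lt_rank hp h1; omega
  · exact hf hp hq h1
  · have := rank_lt_rank hq h1; omega

theorem exists_rank_eq (hf : Set.InjOn f (I.P : Set (ℤ × ℤ))) {m : ℕ} (hm : m < I.P.card) :
    ∃ p ∈ I.P, I.rank f (f p) = m := by
  have := Finset.surj_on_of_inj_on_of_card_le (s := I.P) (t := Finset.range I.P.card)
    (fun p _ => I.rank f (f p)) (fun p hp => Finset.mem_range.2 (rank_lt_card hp))
    (fun p q hp hq h => eq_of_rank_eq hf hp hq h) (by simp) m (Finset.mem_range.2 hm)
  obtain ⟨p, hp, h⟩ := this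
  exact ⟨p, hp, h.symm⟩

theorem coord_rank (hf : Set.InjOn f (I.P : Set (ℤ × ℤ))) {p : ℤ × ℤ} (hp : p ∈ I.P) :
    I.coord f (I.rank f (f p)) = f p := by
  unfold coord
  rw [Finset.sum_eq_single p]
  · simp
  · intro q hq hne
    rw [if_neg fun h => hne (eq_of_rank_eq hf hq hp h)]
  · exact fun h => absurd hp h

theorem coord_mono (hf : Set.InjOn f (I.P : Set (ℤ × ℤ))) {m m' : ℕ} (h : m ≤ m')
    (hm' : m' < I.P.card) : I.coord f m ≤ I.coord f m' := by
  obtain ⟨p, hp, rfl⟩ := exists_rank_eq hf (h.trans_lt hm')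
  obtain ⟨q, hq, rfl⟩ := exists_rank_eq hf hm'
  rw [coord_rank hf hp, coord_rank hf hq]
  by_contra hlt
  have := rank_lt_rank hq (not_le.1 hlt)
  omega

theorem floorRank_mono : Monotone (I.floorRank f) := fun x y h =>
  Nat.sub_le_sub_right (Finset.card_le_card fun p hp => by
    simp only [Finset.mem_filter] at hp ⊢
    exact ⟨hp.1, hp.2.trans h⟩) 1

theorem floorRank_lt (h : 0 < I.P.card) (x : ℝ) : I.floorRank f x < I.P.card := by
  have := Finset.card_filter_le I.P fun p => ((f p : ℤ) : ℝ) ≤ x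
  unfold floorRank
  omega

theorem floorRank_coe (hf : Set.InjOn f (I.P : Set (ℤ × ℤ))) {p : ℤ × ℤ} (hp : p ∈ I.P) :
    I.floorRank f (f p : ℝ) = I.rank f (f p) := by
  unfold floorRank rank
  have : (I.P.filter fun q => ((f q : ℤ) : ℝ) ≤ (f p : ℝ))
      = insert p (I.P.filter fun q => f q < f p) := by
    ext q
    simp only [Finset.mem_filter, Finset.mem_insert, Int.cast_le]
    constructor
    · rintro ⟨h1, h2⟩
      rcases h2.eq_or_lt with h | h
      · exact Or.inl (hf h1 hp h)
      · exact Or.inr ⟨h1, h⟩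
    · rintro (rfl | ⟨h1, h2⟩)
      · exact ⟨hp, le_rfl⟩
      · exact ⟨h1, h2.le⟩
  rw [this, Finset.card_insert_of_notMem (by simp)]
  omega

/-! ### The tree -/

variable (I)

/-- The depth of the tree, and the logarithm of its degree. -/
def depth : ℕ := ((Finset.range I.P.card).filter fun i => 2 ^ (i * i) < I.P.card).card

theorem depth_spec : I.P.card ≤ 2 ^ (I.depth * I.depth) ∧
    ∀ i < I.depth, 2 ^ (i * i) < I.P.card := by
  have hex : ∃ i, I.P.card ≤ 2 ^ (i * i) := by
    refine ⟨I.P.card, (Nat.lt_two_pow_self (n := I.P.card)).le.trans ?_⟩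
    exact Nat.pow_le_pow_right (by norm_num) (Nat.le_mul_self _)
  have : I.depth = Nat.find hex := by
    have hmono : ∀ i, I.P.card ≤ 2 ^ (i * i) → I.P.card ≤ 2 ^ ((i + 1) * (i + 1)) := fun i hi =>
      hi.trans (Nat.pow_le_pow_right (by norm_num) (by nlinarith))
    rw [← card_filter_not_range (n := I.P.card) hmono hex ?_]
    · simp only [depth, not_le]
    · refine Nat.find_min' hex ((Nat.lt_two_pow_self (n := I.P.card)).le.trans ?_)
      exact Nat.pow_le_pow_right (by norm_num) (Nat.le_mul_self _)
  rw [this]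
  exact ⟨Nat.find_spec hex, fun i hi => not_le.1 (Nat.find_min hex hi)⟩

/-- The level of the tree at which two ranks are in different strips with the same parent. -/
def level (r r' : ℕ) : ℕ :=
  ((Finset.range I.depth).filter fun l =>
    ¬ strip I.depth (l + 1) r = strip I.depth (l + 1) r').card

theorem level_spec {r r' : ℕ} (hr : r < I.P.card) (hr' : r' < I.P.card) (hne : r ≠ r') :
    I.level r r' < I.depth ∧ strip I.depth (I.level r r') r ≠ strip I.depth (I.level r r') r' ∧
      strip I.depth (I.level r r' + 1) r = strip I.depth (I.level r r' + 1) r' := by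
  have hd := I.depth_spec.1
  have hk : 0 < I.depth := by
    by_contra h0
    have : I.depth = 0 := by omega
    rw [this] at hd
    norm_num at hd
    omega
  have hlast : strip I.depth (I.depth - 1 + 1) r = strip I.depth (I.depth - 1 + 1) r' := by
    rw [Nat.sub_add_cancel hk]
    unfold strip
    rw [Nat.div_eq_of_lt (by omega), Nat.div_eq_of_lt (by omega)]
  have hex : ∃ l, strip I.depth (l + 1) r = strip I.depth (l + 1) r' := ⟨_, hlast⟩
  have hle := Nat.find_min' hex hlast
  have : I.level r r' = Nat.find hex :=
    card_filter_not_range (p := fun l => strip I.depth (l + 1) r = strip I.depth (l + 1) r')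
      (fun l hl => strip_eq_of_le (by omega) hl) hex (by omega)
  rw [this]
  refine ⟨by omega, ?_, Nat.find_spec hex⟩
  rcases Nat.eq_zero_or_pos (Nat.find hex) with h0 | h0
  · rw [h0]; simpa [strip] using hne
  · have := Nat.find_min hex (m := Nat.find hex - 1) (by omega)
    rwa [Nat.sub_add_cancel h0] at this

/-! ### Demands -/

/-- The left point of a demand. -/
def left (d : (ℤ × ℤ) × (ℤ × ℤ)) : ℤ × ℤ := if d.1.1 < d.2.1 then d.1 else d.2

/-- The right point of a demand. -/
def right (d : (ℤ × ℤ) × (ℤ × ℤ)) : ℤ × ℤ := if d.1.1 < d.2.1 then d.2 else d.1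

/-- The orientation of a demand: `1` if it descends. -/
def ori (d : (ℤ × ℤ) × (ℤ × ℤ)) : ℕ :=
  if I.rank Prod.snd (right d).2 < I.rank Prod.snd (left d).2 then 1 else 0

/-- Reverse the order of the ranks for the orientation `1`. -/
def flip (o v : ℕ) : ℕ := if o = 1 then I.P.card - 1 - v else v

/-- The rank of the left point. -/
def lrank (d : (ℤ × ℤ) × (ℤ × ℤ)) : ℕ := I.rank Prod.fst (left d).1

/-- The rank of the right point. -/
def rrank (d : (ℤ × ℤ) × (ℤ × ℤ)) : ℕ := I.rank Prod.fst (right d).1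

/-- The level of a demand. -/
def lev (d : (ℤ × ℤ) × (ℤ × ℤ)) : ℕ := I.level (I.lrank d) (I.rrank d)

/-- The first row of a demand, in its orientation. -/
def low (d : (ℤ × ℤ) × (ℤ × ℤ)) : ℕ := I.flip (I.ori d) (I.rank Prod.snd (left d).2)

/-- The last row of a demand, in its orientation. -/
def high (d : (ℤ × ℤ) × (ℤ × ℤ)) : ℕ := I.flip (I.ori d) (I.rank Prod.snd (right d).2)

/-- The first index that belongs to an orientation, a side, a level and a strip. -/
def offset (o side l i : ℕ) : ℕ := (((o * 2 + side) * I.depth + l) * I.P.card + i) * I.P.card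

/-- The offset of the strip that a demand leaves. -/
def outOffset (d : (ℤ × ℤ) × (ℤ × ℤ)) : ℕ :=
  I.offset (I.ori d) 0 (I.lev d) (strip I.depth (I.lev d) (I.lrank d))

/-- The offset of the strip that a demand enters. -/
def inOffset (d : (ℤ × ℤ) × (ℤ × ℤ)) : ℕ :=
  I.offset (I.ori d) 1 (I.lev d) (strip I.depth (I.lev d) (I.rrank d))

/-- The number of indices. -/
def size : ℕ := 4 * I.depth * I.P.card * I.P.card

variable {I}

theorem offset_add_lt {o side l i v : ℕ} (ho : o < 2) (hs : side < 2) (hl : l < I.depth)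
    (hi : i < I.P.card) (hv : v < I.P.card) : I.offset o side l i + v < I.size := by
  unfold offset size
  have h1 : (o * 2 + side) * I.depth + l + 1 ≤ 4 * I.depth := by
    have : o * 2 + side ≤ 3 := by omega
    nlinarith
  have h2 : ((o * 2 + side) * I.depth + l) * I.P.card + i + 1 ≤ 4 * I.depth * I.P.card := by
    nlinarith
  nlinarith

theorem ori_lt (d : (ℤ × ℤ) × (ℤ × ℤ)) : I.ori d < 2 := by
  unfold ori; split_ifs <;> omega

theorem flip_lt {o v : ℕ} (hv : v < I.P.card) : I.flip o v < I.P.card := by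
  unfold flip; split_ifs <;> omega

theorem left_mem {d : (ℤ × ℤ) × (ℤ × ℤ)} (hd : d ∈ I.D) : left d ∈ I.P := by
  unfold left; split_ifs; exacts [(I.demand_mem d hd).1, (I.demand_mem d hd).2]

theorem right_mem {d : (ℤ × ℤ) × (ℤ × ℤ)} (hd : d ∈ I.D) : right d ∈ I.P := by
  unfold right; split_ifs; exacts [(I.demand_mem d hd).2, (I.demand_mem d hd).1]

theorem left_lt_right {d : (ℤ × ℤ) × (ℤ × ℤ)} (hd : d ∈ I.D) (hne : d.1 ≠ d.2) :
    (left d).1 < (right d).1 := by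
  have := I.demand_mem d hd
  have h2 : d.1.1 ≠ d.2.1 := fun h => hne (I.column_inj _ this.1 _ this.2 h)
  unfold left right
  split_ifs with h
  · exact h
  · omega

theorem lrank_lt_rrank {d : (ℤ × ℤ) × (ℤ × ℤ)} (hd : d ∈ I.D) (hne : d.1 ≠ d.2) :
    I.lrank d < I.rrank d :=
  rank_lt_rank (f := Prod.fst) (left_mem hd) (left_lt_right hd hne)

theorem rrank_lt {d : (ℤ × ℤ) × (ℤ × ℤ)} (hd : d ∈ I.D) : I.rrank d < I.P.card :=
  rank_lt_card (f := Prod.fst) (right_mem hd)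

theorem lrank_lt {d : (ℤ × ℤ) × (ℤ × ℤ)} (hd : d ∈ I.D) : I.lrank d < I.P.card :=
  rank_lt_card (f := Prod.fst) (left_mem hd)

theorem lev_spec {d : (ℤ × ℤ) × (ℤ × ℤ)} (hd : d ∈ I.D) (hne : d.1 ≠ d.2) :
    I.lev d < I.depth ∧
      strip I.depth (I.lev d) (I.lrank d) < strip I.depth (I.lev d) (I.rrank d) ∧
      strip I.depth (I.lev d + 1) (I.lrank d) = strip I.depth (I.lev d + 1) (I.rrank d) := by
  have hlt := lrank_lt_rrank hd hne
  obtain ⟨h1, h2, h3⟩ := I.level_spec (lrank_lt hd) (rrank_lt hd) hlt.ne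
  exact ⟨h1, lt_of_le_of_ne (strip_mono _ _ hlt.le) h2, h3⟩

theorem mconnected_iff_left_right {S : Set (ℝ × ℝ)} {d : (ℤ × ℤ) × (ℤ × ℤ)} :
    MConnected S (toPlane d.1) (toPlane d.2) ↔
      MConnected S (toPlane (left d)) (toPlane (right d)) := by
  unfold left right
  split_ifs
  · rfl
  · exact ⟨MConnected.symm, MConnected.symm⟩

open Classical in
theorem coe_planeSet (I : Instance) (Q : Finset (ℝ × ℝ)) :
    ((I.P.image toPlane ∪ Q : Finset (ℝ × ℝ)) : Set (ℝ × ℝ))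
      = toPlane '' (I.P : Set (ℤ × ℤ)) ∪ Q := by
  push_cast; rfl

/-- A feasible solution yields a small set of indices that contains, for every demand, a row in
which the demand can leave its first strip, and a later row in which it can enter its last one. -/
theorem exists_hitting {Q : Finset (ℝ × ℝ)} (hQ : I.Feasible (Q : Set (ℝ × ℝ))) :
    ∃ H ⊆ Finset.range I.size, H.card ≤ 8 * Q.card ∧ ∀ d ∈ I.D, d.1 ≠ d.2 →
      ∃ v v', I.low d ≤ v ∧ v ≤ v' ∧ v' ≤ I.high d ∧
        I.outOffset d + v ∈ H ∧ I.inOffset d + v' ∈ H := by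
  classical
  rcases Nat.eq_zero_or_pos I.P.card with hP | hP
  · refine ⟨∅, by simp, by simp, fun d hd => ?_⟩
    have := (I.demand_mem d hd).1
    rw [Finset.card_eq_zero.1 hP] at this
    simp at this
  set S := I.P.image toPlane ∪ Q with hS
  set ρ := I.floorRank Prod.fst with hρ
  set φ := I.floorRank Prod.snd with hφ
  have hR : ∀ x ∈ I.P.image toPlane, ∀ y ∈ I.P.image toPlane, x.2 = y.2 → x = y := by
    intro x hx y hy hxy
    obtain ⟨p, hp, rfl⟩ := Finset.mem_image.1 hx
    obtain ⟨q, hq, rfl⟩ := Finset.mem_image.1 hy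
    have : p.2 = q.2 := by simpa [toPlane] using hxy
    rw [I.row_inj p hp q hq this]
  let g : ℕ → ℕ → ℕ × ℕ × ℝ → ℕ := fun side o c => I.offset o side c.1 c.2.1 + I.flip o (φ c.2.2)
  set C₀ := crossings S ρ I.depth I.P.card 1 with hC₀
  set C₁ := crossings S ρ I.depth I.P.card (-1) with hC₁
  have hc₀ : C₀.card ≤ 2 * Q.card := card_crossings_le floorRank_mono _ _ (Or.inl rfl) hR
  have hc₁ : C₁.card ≤ 2 * Q.card := card_crossings_le floorRank_mono _ _ (Or.inr rfl) hR
  set H := (C₀.image (g 0 0) ∪ C₀.image (g 0 1)) ∪ (C₁.image (g 1 0) ∪ C₁.image (g 1 1)) with hH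
  have hmem₀ : ∀ o < 2, ∀ l i y, (l, i, y) ∈ C₀ →
      I.offset o 0 l i + I.flip o (φ y) ∈ H := by
    intro o ho l i y hc
    have : o = 0 ∨ o = 1 := by omega
    simp only [hH, Finset.mem_union, Finset.mem_image]
    rcases this with rfl | rfl
    · exact Or.inl (Or.inl ⟨_, hc, rfl⟩)
    · exact Or.inl (Or.inr ⟨_, hc, rfl⟩)
  have hmem₁ : ∀ o < 2, ∀ l i y, (l, i, y) ∈ C₁ →
      I.offset o 1 l i + I.flip o (φ y) ∈ H := by
    intro o ho l i y hc
    have : o = 0 ∨ o = 1 := by omega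
    simp only [hH, Finset.mem_union, Finset.mem_image]
    rcases this with rfl | rfl
    · exact Or.inr (Or.inl ⟨_, hc, rfl⟩)
    · exact Or.inr (Or.inr ⟨_, hc, rfl⟩)
  refine ⟨H, ?_, ?_, ?_⟩
  · have key : ∀ side < 2, ∀ o < 2, ∀ ε, ∀ c ∈ crossings S ρ I.depth I.P.card ε,
        g side o c < I.size := by
      intro side hside o ho ε c hc
      simp only [crossings, Finset.mem_filter, Finset.mem_product, Finset.mem_range] at hc
      exact offset_add_lt ho hside hc.1.1 hc.1.2.1 (flip_lt (floorRank_lt hP _))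
    intro u hu
    simp only [hH, Finset.mem_union, Finset.mem_image] at hu
    rw [Finset.mem_range]
    rcases hu with (⟨c, hc, rfl⟩ | ⟨c, hc, rfl⟩) | (⟨c, hc, rfl⟩ | ⟨c, hc, rfl⟩)
    all_goals exact key _ (by norm_num) _ (by norm_num) _ c hc
  · have a1 := Finset.card_union_le (C₀.image (g 0 0) ∪ C₀.image (g 0 1))
      (C₁.image (g 1 0) ∪ C₁.image (g 1 1))
    have a2 := Finset.card_union_le (C₀.image (g 0 0)) (C₀.image (g 0 1))
    have a3 := Finset.card_union_le (C₁.image (g 1 0)) (C₁.image (g 1 1))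
    have b1 := Finset.card_image_le (s := C₀) (f := g 0 0)
    have b2 := Finset.card_image_le (s := C₀) (f := g 0 1)
    have b3 := Finset.card_image_le (s := C₁) (f := g 1 0)
    have b4 := Finset.card_image_le (s := C₁) (f := g 1 1)
    rw [← hH] at a1
    omega
  · intro d hd hne
    have hcon := hQ d hd
    rw [← coe_planeSet, mconnected_iff_left_right] at hcon
    have hL := left_mem hd
    have hR' := right_mem hd
    have e1 : ρ (toPlane (left d)).1 = I.lrank d := floorRank_coe (f := Prod.fst) injOn_fst hL
    have e2 : ρ (toPlane (right d)).1 = I.rrank d := floorRank_coe (f := Prod.fst) injOn_fst hR'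
    have f1 : φ (toPlane (left d)).2 = I.rank Prod.snd (left d).2 :=
      floorRank_coe (f := Prod.snd) injOn_snd hL
    have f2 : φ (toPlane (right d)).2 = I.rank Prod.snd (right d).2 :=
      floorRank_coe (f := Prod.snd) injOn_snd hR'
    obtain ⟨hl1, hl2, hl3⟩ := lev_spec hd hne
    obtain ⟨y, y', h1, h2, h3⟩ := exists_crossings (n := I.P.card) (k := I.depth) (l := I.lev d)
      (floorRank_mono (I := I) (f := Prod.fst)) (floorRank_lt hP) hl1
      (p := toPlane (left d)) (q := toPlane (right d))
      (by simpa [toPlane] using left_lt_right hd hne)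
      (by rw [← hρ, e1, e2]; exact hl2.ne) (by rw [← hρ, e1, e2]; exact hl3) hcon
    rw [← hρ, e1] at h1
    rw [← hρ, e2] at h2
    have hrows : I.low d ≤ I.flip (I.ori d) (φ y) ∧
        I.flip (I.ori d) (φ y) ≤ I.flip (I.ori d) (φ y') ∧
        I.flip (I.ori d) (φ y') ≤ I.high d := by
      have hφm : ∀ a b, a ≤ b → φ a ≤ φ b := fun a b hab => floorRank_mono hab
      unfold low high
      rcases h3 with ⟨g0, g1, g2, g3⟩ | ⟨g0, g1, g2, g3⟩
      all_goals
        have m0 := hφm _ _ g0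
        have m1 := hφm _ _ g1
        have m2 := hφm _ _ g2
        have m3 := hφm _ _ g3
        simp only [f1, f2] at m0 m1 m2 m3
      · have ho : I.ori d = 0 := if_neg (by omega)
        simp only [ho, flip, if_neg (show (0 : ℕ) ≠ 1 by norm_num)]
        omega
      · have hne2 : I.rank Prod.snd (right d).2 ≠ I.rank Prod.snd (left d).2 := fun he => by
          have h1 := eq_of_rank_eq (f := Prod.snd) injOn_snd hR' hL he
          have h2 := left_lt_right hd hne
          rw [h1] at h2
          exact lt_irrefl _ h2
        have ho : I.ori d = 1 := if_pos (by omega)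
        simp only [ho, flip, if_true]
        omega
    exact ⟨_, _, hrows.1, hrows.2.1, hrows.2.2, hmem₀ _ (ori_lt d) _ _ _ h1, hmem₁ _ (ori_lt d) _ _ _ h2⟩

/-- The end points of the nontrivial demands. -/
def ends (I : Instance) : Finset (ℤ × ℤ) :=
  (I.D.filter fun d => d.1 ≠ d.2).image left ∪ (I.D.filter fun d => d.1 ≠ d.2).image right

theorem exists_aligned {Q : Finset (ℝ × ℝ)} {p q : ℤ × ℤ} (hp : p ∈ I.P) (hne : p ≠ q)
    (h : MConnected (toPlane '' (I.P : Set (ℤ × ℤ)) ∪ Q) (toPlane p) (toPlane q)) :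
    ∃ x ∈ Q, Aligned (toPlane p) x := by
  classical
  obtain ⟨k, x, h0, hk, hS, ha, -⟩ := h
  have hpq : toPlane p ≠ toPlane q := fun he => hne (by
    simp only [toPlane, Prod.mk.injEq, Int.cast_inj] at he
    exact Prod.ext he.1 he.2)
  have hex : ∃ t, t ≤ k ∧ x t ≠ toPlane p := ⟨k, le_rfl, by rw [hk]; exact hpq.symm⟩
  obtain ⟨h1, h2⟩ := Nat.find_spec hex
  have hmin := fun m hm => Nat.find_min hex (m := m) hm
  generalize Nat.find hex = t at *
  have ht : t ≠ 0 := fun h => h2 (by rw [h, h0])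
  obtain ⟨t, rfl⟩ := Nat.exists_eq_succ_of_ne_zero ht
  have h3 : x t = toPlane p := by
    by_contra h4
    exact hmin t (by omega) ⟨by omega, h4⟩
  have h4 := ha t (by omega)
  rw [h3] at h4
  refine ⟨x (t + 1), ?_, h4⟩
  rcases hS (t + 1) h1 with ⟨r, hr, he⟩ | h5
  · exfalso
    apply h2
    rw [Nat.succ_eq_add_one, ← he]
    rw [← he] at h4
    simp only [Aligned, toPlane, Int.cast_inj] at h4
    rcases h4 with h4 | h4
    · rw [I.column_inj p hp r hr h4]
    · rw [I.row_inj p hp r hr h4]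
  · exact h5

theorem card_ends_le {Q : Finset (ℝ × ℝ)} (hQ : I.Feasible (Q : Set (ℝ × ℝ))) :
    I.ends.card ≤ 2 * Q.card := by
  classical
  have hal : ∀ p ∈ I.ends, p ∈ I.P ∧ ∃ x ∈ Q, Aligned (toPlane p) x := by
    intro p hp
    simp only [ends, Finset.mem_union, Finset.mem_image, Finset.mem_filter] at hp
    have hne : ∀ d ∈ I.D, d.1 ≠ d.2 → left d ≠ right d := fun d hd h he => by
      have := left_lt_right hd h
      rw [he] at this
      exact lt_irrefl _ this
    rcases hp with ⟨d, ⟨hd, h⟩, rfl⟩ | ⟨d, ⟨hd, h⟩, rfl⟩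
    · exact ⟨left_mem hd, exists_aligned (left_mem hd) (hne d hd h)
        (mconnected_iff_left_right.1 (hQ d hd))⟩
    · exact ⟨right_mem hd, exists_aligned (right_mem hd) (hne d hd h).symm
        (mconnected_iff_left_right.1 (hQ d hd)).symm⟩
  have h1 : (I.ends.filter fun p => ∃ x ∈ Q, (toPlane p).1 = x.1).card ≤ Q.card := by
    refine Finset.card_le_card_of_forall_subsingleton (fun p x => (toPlane p).1 = x.1)
      (fun p hp => (Finset.mem_filter.1 hp).2) ?_
    rintro x hx p ⟨hp, e⟩ q ⟨hq, e'⟩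
    refine I.column_inj p (hal p (Finset.mem_filter.1 hp).1).1 q
      (hal q (Finset.mem_filter.1 hq).1).1 ?_
    simpa [toPlane] using e.trans e'.symm
  have h2 : (I.ends.filter fun p => ¬ ∃ x ∈ Q, (toPlane p).1 = x.1).card ≤ Q.card := by
    refine Finset.card_le_card_of_forall_subsingleton (fun p x => (toPlane p).2 = x.2)
      (fun p hp => ?_) ?_
    · rw [Finset.mem_filter] at hp
      obtain ⟨x, hx, h3 | h3⟩ := (hal p hp.1).2
      · exact absurd ⟨x, hx, h3⟩ hp.2
      · exact ⟨x, hx, h3⟩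
    · rintro x hx p ⟨hp, e⟩ q ⟨hq, e'⟩
      refine I.row_inj p (hal p (Finset.mem_filter.1 hp).1).1 q
        (hal q (Finset.mem_filter.1 hq).1).1 ?_
      simpa [toPlane] using e.trans e'.symm
  have h3 := Finset.card_filter_add_card_filter_not (s := I.ends)
    (fun p => ∃ x ∈ Q, (toPlane p).1 = x.1)
  omega

end Instance

theorem mconnected_staircase {S : Set (ℝ × ℝ)} {x₀ x₁ x₂ x₃ x₄ y₀ y₁ y₂ y₃ : ℝ}
    (hx : x₀ ≤ x₁ ∧ x₁ ≤ x₂ ∧ x₂ ≤ x₃ ∧ x₃ ≤ x₄)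
    (hy : (y₀ ≤ y₁ ∧ y₁ ≤ y₂ ∧ y₂ ≤ y₃) ∨ (y₃ ≤ y₂ ∧ y₂ ≤ y₁ ∧ y₁ ≤ y₀))
    (h₀ : (x₀, y₀) ∈ S) (h₁ : (x₁, y₀) ∈ S) (h₂ : (x₁, y₁) ∈ S) (h₃ : (x₂, y₁) ∈ S)
    (h₄ : (x₂, y₂) ∈ S) (h₅ : (x₃, y₂) ∈ S) (h₆ : (x₃, y₃) ∈ S) (h₇ : (x₄, y₃) ∈ S) :
    MConnected S (x₀, y₀) (x₄, y₃) := by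
  refine ⟨7, fun i => [(x₀, y₀), (x₁, y₀), (x₁, y₁), (x₂, y₁), (x₂, y₂), (x₃, y₂), (x₃, y₃),
    (x₄, y₃)].getD i (x₄, y₃), rfl, rfl, ?_, ?_, ?_⟩
  · intro i hi
    interval_cases i <;> simpa
  · intro i hi
    interval_cases i <;> simp [Aligned]
  · obtain ⟨a, b, c, d⟩ := hx
    simp only [Finset.sum_range_succ, Finset.sum_range_zero, l1Dist, List.getD_cons_zero,
      List.getD_cons_succ, sub_self, abs_zero]
    rw [abs_of_nonpos (by linarith : x₀ - x₁ ≤ 0), abs_of_nonpos (by linarith : x₁ - x₂ ≤ 0),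
      abs_of_nonpos (by linarith : x₂ - x₃ ≤ 0), abs_of_nonpos (by linarith : x₃ - x₄ ≤ 0),
      abs_of_nonpos (by linarith : x₀ - x₄ ≤ 0)]
    rcases hy with ⟨e, f, g⟩ | ⟨e, f, g⟩
    · rw [abs_of_nonpos (by linarith : y₀ - y₁ ≤ 0), abs_of_nonpos (by linarith : y₁ - y₂ ≤ 0),
        abs_of_nonpos (by linarith : y₂ - y₃ ≤ 0), abs_of_nonpos (by linarith : y₀ - y₃ ≤ 0)]
      ring
    · rw [abs_of_nonneg (by linarith : 0 ≤ y₀ - y₁), abs_of_nonneg (by linarith : 0 ≤ y₁ - y₂),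
        abs_of_nonneg (by linarith : 0 ≤ y₂ - y₃), abs_of_nonneg (by linarith : 0 ≤ y₀ - y₃)]
      ring

/-- Two strips with the same parent are separated by a dyadic boundary. -/
theorem exists_separating_bit {k i j : ℕ} (hij : i < j) (h : i / 2 ^ k = j / 2 ^ k) :
    ∃ t < k, j / 2 ^ t = i / 2 ^ t + 1 := by
  classical
  have hex : ∃ t, i / 2 ^ t = j / 2 ^ t := ⟨k, h⟩
  have hle := Nat.find_min' hex h
  have hspec := Nat.find_spec hex
  have hmin := fun m hm => Nat.find_min hex (m := m) hm
  generalize Nat.find hex = t at *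
  have ht : t ≠ 0 := fun h0 => by
    rw [h0] at hspec
    simp at hspec
    omega
  obtain ⟨t, rfl⟩ := Nat.exists_eq_succ_of_ne_zero ht
  refine ⟨t, by omega, ?_⟩
  have h1 := hmin t (by omega)
  have h2 : i / 2 ^ t ≤ j / 2 ^ t := Nat.div_le_div_right hij.le
  rw [Nat.succ_eq_add_one, pow_succ, ← Nat.div_div_eq_div_mul, ← Nat.div_div_eq_div_mul] at hspec
  omega

namespace Instance

variable (I : Instance)

/-- The hitting set problem of an instance: the set of a demand and a threshold `h₀` consists of
the rows below `h₀` of the strip that the demand leaves, and of the rows from `h₀` on of the strip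
that it enters. -/
def problem (ds : List ((ℤ × ℤ) × (ℤ × ℤ))) : HitProblem where
  N := I.size
  M := ds.length * (I.P.card + 1)
  act c := (ds.getD (c / (I.P.card + 1)) 0).1 ≠ (ds.getD (c / (I.P.card + 1)) 0).2
  mem c u :=
    (I.outOffset (ds.getD (c / (I.P.card + 1)) 0) + I.low (ds.getD (c / (I.P.card + 1)) 0) ≤ u ∧
      u < I.outOffset (ds.getD (c / (I.P.card + 1)) 0) + c % (I.P.card + 1)) ∨
    (I.inOffset (ds.getD (c / (I.P.card + 1)) 0) + c % (I.P.card + 1) ≤ u ∧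
      u ≤ I.inOffset (ds.getD (c / (I.P.card + 1)) 0) + I.high (ds.getD (c / (I.P.card + 1)) 0))

/-- The level of an index. -/
def idxLevel (u : ℕ) : ℕ := u / I.P.card / I.P.card % I.depth

/-- The strip of an index. -/
def idxStrip (u : ℕ) : ℕ := u / I.P.card % I.P.card

/-- The side of an index. -/
def idxSide (u : ℕ) : ℕ := u / I.P.card / I.P.card / I.depth % 2

/-- The orientation of an index. -/
def idxOri (u : ℕ) : ℕ := u / I.P.card / I.P.card / I.depth / 2

/-- The rank of the `j`-th boundary for an index. -/
def boundary (u j : ℕ) : ℕ :=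
  (I.idxStrip u / 2 ^ j + (1 - I.idxSide u)) * 2 ^ (I.depth * I.idxLevel u + j)

/-- The point in the row of an index on its `j`-th boundary. -/
def slotPoint (u j : ℕ) : ℤ × ℤ :=
  (I.coord Prod.fst (I.boundary u j), I.coord Prod.snd (I.flip (I.idxOri u) (u % I.P.card)))

/-- The projection of a point to the right boundary of its strip. -/
def rightProj (l : ℕ) (p : ℤ × ℤ) : ℤ × ℤ :=
  (I.coord Prod.fst ((strip I.depth l (I.rank Prod.fst p.1) + 1) * 2 ^ (I.depth * l)), p.2)

/-- The projection of a point to the left boundary of its strip. -/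
def leftProj (l : ℕ) (p : ℤ × ℤ) : ℤ × ℤ :=
  (I.coord Prod.fst (strip I.depth l (I.rank Prod.fst p.1) * 2 ^ (I.depth * l)), p.2)

variable {I}

theorem idx_offset {o side l i v : ℕ} (hs : side < 2) (hl : l < I.depth)
    (hi : i < I.P.card) (hv : v < I.P.card) :
    I.idxLevel (I.offset o side l i + v) = l ∧ I.idxStrip (I.offset o side l i + v) = i ∧
      I.idxSide (I.offset o side l i + v) = side ∧ I.idxOri (I.offset o side l i + v) = o ∧
      (I.offset o side l i + v) % I.P.card = v := by
  have hP : 0 < I.P.card := by omega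
  have h1 : (I.offset o side l i + v) / I.P.card
      = ((o * 2 + side) * I.depth + l) * I.P.card + i := by
    unfold offset
    rw [mul_comm _ I.P.card, Nat.mul_add_div hP, Nat.div_eq_of_lt hv, add_zero]
  have h2 : (I.offset o side l i + v) / I.P.card / I.P.card = (o * 2 + side) * I.depth + l := by
    rw [h1, mul_comm _ I.P.card, Nat.mul_add_div hP, Nat.div_eq_of_lt hi, add_zero]
  have h3 : (I.offset o side l i + v) / I.P.card / I.P.card / I.depth = o * 2 + side := by
    rw [h2, mul_comm _ I.depth, Nat.mul_add_div (by omega), Nat.div_eq_of_lt hl, add_zero]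
  refine ⟨?_, ?_, ?_, ?_, ?_⟩
  · rw [idxLevel, h2, mul_comm, Nat.mul_add_mod, Nat.mod_eq_of_lt hl]
  · rw [idxStrip, h1, mul_comm, Nat.mul_add_mod, Nat.mod_eq_of_lt hi]
  · rw [idxSide, h3]; omega
  · rw [idxOri, h3]; omega
  · rw [offset, mul_comm, Nat.mul_add_mod, Nat.mod_eq_of_lt hv]

theorem feasible_of_good {ds : List ((ℤ × ℤ) × (ℤ × ℤ))} (hds : ∀ d, d ∈ ds ↔ d ∈ I.D) {K : ℤ}
    {w : ℕ → ℤ} (hK : 0 ≤ K) (hw : ∀ u, 1 ≤ w u) (hgood : (I.problem ds).Good K w)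
    {Z : Set (ℤ × ℤ)}
    (hZ : ∀ u < I.size, Jump I.size K w u → ∀ j < I.depth, I.boundary u j < I.P.card →
      I.slotPoint u j ∈ Z)
    (hZd : ∀ d ∈ I.D, d.1 ≠ d.2 →
      I.rightProj (I.lev d) (left d) ∈ Z ∧ I.leftProj (I.lev d) (right d) ∈ Z) :
    I.Feasible (toPlane '' Z) := by
  intro d hd
  by_cases hne : d.1 = d.2
  · refine ⟨0, fun _ => toPlane d.1, rfl, by rw [hne], fun i _ => ?_, by simp, ?_⟩
    · exact Or.inl ⟨d.1, (I.demand_mem d hd).1, rfl⟩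
    · simp [hne, l1Dist]
  rw [mconnected_iff_left_right]
  have hL := left_mem hd
  have hR := right_mem hd
  have hlr := lrank_lt hd
  have hrr := rrank_lt hd
  obtain ⟨hl1, hl2, hl3⟩ := lev_spec hd hne
  set n := I.P.card with hn
  set k := I.depth with hk
  set l := I.lev d with hl
  set i := strip k l (I.lrank d) with hi
  set j := strip k l (I.rrank d) with hj
  have hin : i < n := (strip_le _ _ _).trans_lt hlr
  have hjn : j < n := (strip_le _ _ _).trans_lt hrr
  have hhigh : I.high d < n := flip_lt (rank_lt_card (f := Prod.snd) hR)
  have hlow : I.low d < n := flip_lt (rank_lt_card (f := Prod.snd) hL)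
  have hsize : 0 < I.size := by
    have := offset_add_lt (I := I) (o := 0) (side := 0) (by norm_num) (by norm_num) hl1 hin hlow
    omega
  obtain ⟨v, v', hv1, hv2, hv3, hJ, hJ'⟩ := exists_jump_pair (N := I.size) (n := n) (K := K)
    (w := w) (A := I.outOffset d) (B := I.inOffset d) (a := I.low d) (b := I.high d) hw hK hsize
    hhigh (by
      intro h₀ hh
      obtain ⟨e, he, hde⟩ := List.getElem_of_mem ((hds d).2 hd)
      have hc1 : (e * (n + 1) + h₀) / (n + 1) = e := by
        rw [mul_comm, Nat.mul_add_div (by omega), Nat.div_eq_of_lt (by omega), add_zero]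
      have hc2 : (e * (n + 1) + h₀) % (n + 1) = h₀ := by
        rw [mul_comm, Nat.mul_add_mod, Nat.mod_eq_of_lt (by omega)]
      have hget : ds.getD e 0 = d := by rw [List.getD_eq_getElem _ _ he, hde]
      have := hgood (e * (n + 1) + h₀) (by
        show e * (n + 1) + h₀ < ds.length * (n + 1)
        nlinarith)
      unfold HitProblem.Light at this
      simp only [problem, HitProblem.weight, HitProblem.total, ← hn, hc1, hc2, hget] at this
      push Not at this
      refine (this hne).trans (le_of_eq ?_)
      congr 1)
  have hvn : v < n := by omega
  have hvn' : v' < n := by omega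
  obtain ⟨a1, a2, a3, a4, a5⟩ := idx_offset (I := I) (o := I.ori d) (side := 0) (by norm_num) hl1
    hin hvn
  obtain ⟨b1, b2, b3, b4, b5⟩ := idx_offset (I := I) (o := I.ori d) (side := 1) (by norm_num) hl1
    hjn hvn'
  have hzo := hZ (I.outOffset d + v) (offset_add_lt (ori_lt d) (by norm_num) hl1 hin hvn) hJ
  have hzi := hZ (I.inOffset d + v') (offset_add_lt (ori_lt d) (by norm_num) hl1 hjn hvn') hJ'
  have hout : I.outOffset d = I.offset (I.ori d) 0 l i := rfl
  have hinn : I.inOffset d = I.offset (I.ori d) 1 l j := rfl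
  simp only [slotPoint, boundary, hout, a1, a2, a3, a4, a5] at hzo
  simp only [slotPoint, boundary, hinn, b1, b2, b3, b4, b5] at hzi
  simp only [Nat.sub_zero, Nat.sub_self, add_zero] at hzo hzi
  obtain ⟨t, ht, htj⟩ := exists_separating_bit (k := k) hl2 (by
    have := hl3
    unfold strip at this
    rw [mul_add, mul_one, pow_add, ← Nat.div_div_eq_div_mul, ← Nat.div_div_eq_div_mul] at this
    exact this)
  have hpw : 0 < 2 ^ (k * l) := by positivity
  have hpt : 0 < 2 ^ t := by positivity
  -- the order of the boundaries
  have o1 : I.lrank d < (i + 1) * 2 ^ (k * l) := by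
    rw [mul_comm]; exact Nat.lt_mul_div_succ _ hpw
  have o2 : (i + 1) * 2 ^ (k * l) ≤ (i / 2 ^ t + 1) * 2 ^ (k * l + t) := by
    have : i + 1 ≤ (i / 2 ^ t + 1) * 2 ^ t := by
      rw [mul_comm]; exact Nat.lt_mul_div_succ _ hpt
    calc (i + 1) * 2 ^ (k * l) ≤ (i / 2 ^ t + 1) * 2 ^ t * 2 ^ (k * l) := by gcongr
      _ = _ := by rw [pow_add]; ring
  have o3 : (i / 2 ^ t + 1) * 2 ^ (k * l + t) ≤ j * 2 ^ (k * l) := by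
    rw [← htj]
    calc j / 2 ^ t * 2 ^ (k * l + t) = (j / 2 ^ t * 2 ^ t) * 2 ^ (k * l) := by rw [pow_add]; ring
      _ ≤ _ := by gcongr; exact Nat.div_mul_le_self _ _
  have o4 : j * 2 ^ (k * l) ≤ I.rrank d := Nat.div_mul_le_self _ _
  have z1 := hzo 0 (by omega) (by simpa using (o2.trans (o3.trans o4)).trans_lt hrr)
  have z2 := hzo t ht ((o3.trans o4).trans_lt hrr)
  have z3 := hzi t ht (by rw [htj]; exact (o3.trans o4).trans_lt hrr)
  have z4 := hzi 0 (by omega) (by simpa using o4.trans_lt hrr)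
  simp only [pow_zero, Nat.div_one, add_zero] at z1 z4
  rw [htj] at z3
  obtain ⟨z5, z6⟩ := hZd d hd hne
  have cl : I.coord Prod.fst (I.lrank d) = (left d).1 := coord_rank (f := Prod.fst) injOn_fst hL
  have cr : I.coord Prod.fst (I.rrank d) = (right d).1 := coord_rank (f := Prod.fst) injOn_fst hR
  have dl : I.coord Prod.snd (I.rank Prod.snd (left d).2) = (left d).2 :=
    coord_rank (f := Prod.snd) injOn_snd hL
  have dr : I.coord Prod.snd (I.rank Prod.snd (right d).2) = (right d).2 :=
    coord_rank (f := Prod.snd) injOn_snd hR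
  have hmemZ : ∀ {x y : ℤ}, (x, y) ∈ Z →
      ((x : ℝ), (y : ℝ)) ∈ toPlane '' (I.P : Set (ℤ × ℤ)) ∪ toPlane '' Z :=
    fun h => Or.inr ⟨_, h, rfl⟩
  refine mconnected_staircase (x₁ := I.coord Prod.fst ((i + 1) * 2 ^ (k * l)))
    (x₂ := I.coord Prod.fst ((i / 2 ^ t + 1) * 2 ^ (k * l + t)))
    (x₃ := I.coord Prod.fst (j * 2 ^ (k * l)))
    (y₁ := I.coord Prod.snd (I.flip (I.ori d) v)) (y₂ := I.coord Prod.snd (I.flip (I.ori d) v'))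
    ?_ ?_ (Or.inl ⟨_, hL, rfl⟩) (hmemZ z5) (hmemZ z1) (hmemZ z2) (hmemZ z3) (hmemZ z4) (hmemZ z6)
    (Or.inl ⟨_, hR, rfl⟩)
  · simp only [Int.cast_le]
    rw [← cl, ← cr]
    refine ⟨coord_mono injOn_fst o1.le ?_, coord_mono injOn_fst o2 ?_, coord_mono injOn_fst o3 ?_,
      coord_mono injOn_fst o4 hrr⟩ <;> omega
  · simp only [Int.cast_le]
    rw [← dl, ← dr]
    have hlr2 : I.rank Prod.snd (left d).2 < n := rank_lt_card (f := Prod.snd) hL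
    have hrr2 : I.rank Prod.snd (right d).2 < n := rank_lt_card (f := Prod.snd) hR
    unfold low at hv1
    unfold high at hv3
    rcases Nat.lt_or_ge (I.rank Prod.snd (right d).2) (I.rank Prod.snd (left d).2) with hlt | hge
    · have ho : I.ori d = 1 := if_pos hlt
      simp only [ho, flip, if_true, ← hn] at hv1 hv3 ⊢
      right
      refine ⟨coord_mono injOn_snd ?_ ?_, coord_mono injOn_snd ?_ ?_, coord_mono injOn_snd ?_ ?_⟩
        <;> omega
    · have ho : I.ori d = 0 := if_neg (by omega)
      simp only [ho, flip, if_neg (show (0 : ℕ) ≠ 1 by norm_num)] at hv1 hv3 ⊢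
      left
      refine ⟨coord_mono injOn_snd ?_ ?_, coord_mono injOn_snd ?_ ?_, coord_mono injOn_snd ?_ ?_⟩
        <;> omega

theorem card_le_of_subset {K : ℤ} {w : ℕ → ℤ} (hK : 0 ≤ K) (hw : ∀ u, 1 ≤ w u)
    {Z : Finset (ℤ × ℤ)}
    (hZ : ∀ z ∈ Z, z = 0 ∨ (∃ u < I.size, Jump I.size K w u ∧ ∃ j < I.depth, z = I.slotPoint u j) ∨
      ∃ d ∈ I.D, d.1 ≠ d.2 ∧
        (z = I.rightProj (I.lev d) (left d) ∨ z = I.leftProj (I.lev d) (right d))) :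
    (Z.card : ℤ) ≤ 1 + 8 * K * I.depth + 2 * (I.ends.card * I.depth) := by
  classical
  set J := (Finset.range I.size).filter (Jump I.size K w) with hJ
  set A := (J ×ˢ Finset.range I.depth).image fun c => I.slotPoint c.1 c.2 with hA
  set B := (I.ends ×ˢ Finset.range I.depth).image fun c => I.rightProj c.2 c.1 with hB
  set C := (I.ends ×ˢ Finset.range I.depth).image fun c => I.leftProj c.2 c.1 with hC
  have hsub : Z ⊆ {0} ∪ (A ∪ (B ∪ C)) := by
    intro z hz
    simp only [Finset.mem_union, Finset.mem_singleton, hA, hB, hC, hJ, Finset.mem_image,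
      Finset.mem_product, Finset.mem_range, Finset.mem_filter]
    rcases hZ z hz with h | ⟨u, hu, hj, j, hjk, rfl⟩ | ⟨d, hd, hne, h⟩
    · exact Or.inl h
    · exact Or.inr (Or.inl ⟨(u, j), ⟨⟨hu, hj⟩, hjk⟩, rfl⟩)
    · have hl := (lev_spec hd hne).1
      have e1 : left d ∈ I.ends := Finset.mem_union_left _
        (Finset.mem_image_of_mem _ (Finset.mem_filter.2 ⟨hd, hne⟩))
      have e2 : right d ∈ I.ends := Finset.mem_union_right _
        (Finset.mem_image_of_mem _ (Finset.mem_filter.2 ⟨hd, hne⟩))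
      rcases h with rfl | rfl
      · exact Or.inr (Or.inr (Or.inl ⟨(left d, I.lev d), ⟨e1, hl⟩, rfl⟩))
      · exact Or.inr (Or.inr (Or.inr ⟨(right d, I.lev d), ⟨e2, hl⟩, rfl⟩))
  have h1 := Finset.card_le_card hsub
  have h2 := Finset.card_union_le {0} (A ∪ (B ∪ C))
  have h3 := Finset.card_union_le A (B ∪ C)
  have h4 := Finset.card_union_le B C
  have h5 : A.card ≤ J.card * I.depth := by
    refine Finset.card_image_le.trans ?_
    simp
  have h6 : B.card ≤ I.ends.card * I.depth := by
    refine Finset.card_image_le.trans ?_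
    simp
  have h7 : C.card ≤ I.ends.card * I.depth := by
    refine Finset.card_image_le.trans ?_
    simp
  have h8 : (J.card : ℤ) ≤ 8 * K := card_jumps_le hK hw
  have h9 : (J.card : ℤ) * I.depth ≤ 8 * K * I.depth := by gcongr
  simp only [Finset.card_singleton] at h2
  zify at h1 h2 h3 h4 h5 h6 h7
  linarith

theorem depth_le (h : 2 ≤ I.P.card) : (I.depth : ℝ) ≤ 3 * √(Real.log I.P.card) := by
  have hn : (2 : ℝ) ≤ I.P.card := by exact_mod_cast h
  set L := Real.log I.P.card with hL
  have h2 : Real.log 2 ≤ L := Real.log_le_log (by norm_num) hn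
  have hl2 := Real.log_two_gt_d9
  have hkey : (I.depth : ℝ) ^ 2 ≤ 9 * L := by
    rcases Nat.eq_zero_or_pos I.depth with h0 | h0
    · rw [h0]; simp; linarith
    obtain ⟨m, hm⟩ := Nat.exists_eq_succ_of_ne_zero h0.ne'
    have h3 := I.depth_spec.2 m (by omega)
    have h4 : (2 : ℝ) ^ (m * m) ≤ I.P.card := by exact_mod_cast h3.le
    have h5 := Real.log_le_log (by positivity) h4
    rw [Real.log_pow] at h5
    push_cast at h5
    rw [hm]
    push_cast
    have h6 : (0 : ℝ) ≤ m * m := by positivity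
    nlinarith [sq_nonneg ((m : ℝ) - 1)]
  calc (I.depth : ℝ) ≤ √(9 * L) := Real.le_sqrt_of_sq_le hkey
    _ = 3 * √L := by
      rw [Real.sqrt_mul (by norm_num), show (9 : ℝ) = 3 ^ 2 by norm_num, Real.sqrt_sq (by norm_num)]

/-- The approximation guarantee. -/
theorem card_le_opt {K : ℤ} {w : ℕ → ℤ} (hK : 0 ≤ K) (hw : ∀ u, 1 ≤ w u)
    (hKQ : ∀ Q : Finset (ℝ × ℝ), I.Feasible (Q : Set (ℝ × ℝ)) → K ≤ 8 * Q.card)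
    {Z : Finset (ℤ × ℤ)}
    (hZ : ∀ z ∈ Z, z = 0 ∨ (∃ u < I.size, Jump I.size K w u ∧ ∃ j < I.depth, z = I.slotPoint u j) ∨
      ∃ d ∈ I.D, d.1 ≠ d.2 ∧
        (z = I.rightProj (I.lev d) (left d) ∨ z = I.leftProj (I.lev d) (right d)))
    (hfeas : I.Feasible (toPlane '' (Z : Set (ℤ × ℤ))))
    (hne : Z.Nonempty → ∃ d ∈ I.D, d.1 ≠ d.2) :
    (Z.card : ℝ) ≤ 207 * √(Real.log I.P.card) * (I.opt : ℝ) := by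
  classical
  rcases Z.eq_empty_or_nonempty with rfl | hZne
  · simp; positivity
  obtain ⟨d, hd, hdne⟩ := hne hZne
  have hmem : I.opt ∈ {k : ℕ | ∃ Q : Finset (ℝ × ℝ), I.Feasible (Q : Set (ℝ × ℝ)) ∧ Q.card = k} :=
    Nat.sInf_mem ⟨_, Z.image toPlane, by simpa using hfeas, rfl⟩
  obtain ⟨Q, hQ, hQc⟩ := hmem
  have h1 := card_le_of_subset hK hw hZ
  have h2 := hKQ Q hQ
  have h3 := card_ends_le hQ
  rw [hQc] at h2 h3
  have h4 : 1 ≤ I.ends.card := Finset.card_pos.2 ⟨left d, Finset.mem_union_left _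
    (Finset.mem_image_of_mem _ (Finset.mem_filter.2 ⟨hd, hdne⟩))⟩
  have hopt : 1 ≤ I.opt := by omega
  have hdep : 1 ≤ I.depth := by have := (lev_spec hd hdne).1; omega
  have hcard : 2 ≤ I.P.card := by
    have := lrank_lt_rrank hd hdne
    have := rrank_lt hd
    omega
  have h5 : (Z.card : ℤ) ≤ 69 * (I.depth * I.opt) := by
    have e1 : 8 * K * I.depth ≤ 8 * (8 * I.opt) * I.depth := by gcongr
    have e2 : (I.ends.card : ℤ) * I.depth ≤ 2 * I.opt * I.depth := by
      gcongr; exact_mod_cast h3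
    have e3 : (1 : ℤ) ≤ I.depth * I.opt := by
      have : 1 ≤ I.depth * I.opt := Nat.mul_pos hdep hopt
      exact_mod_cast this
    linarith
  have h6 : (Z.card : ℝ) ≤ 69 * (I.depth * I.opt) := by exact_mod_cast h5
  have h7 := depth_le hcard
  calc (Z.card : ℝ) ≤ 69 * (I.depth * I.opt) := h6
    _ ≤ 69 * (3 * √(Real.log I.P.card) * I.opt) := by gcongr
    _ = _ := by ring

end Instance

/-! ### Terms -/

namespace Term

instance : Add Term := ⟨.bin .add⟩
instance : Sub Term := ⟨.bin .sub⟩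
instance : Mul Term := ⟨.bin .mul⟩
instance : Div Term := ⟨.bin .div⟩
instance (n : ℕ) : OfNat Term n := ⟨.const n⟩

/-- The test `t < u`. -/
def lt (t u : Term) : Term := u - t

/-- The test `t ≤ u`. -/
def le (t u : Term) : Term := u - t + 1

/-- The conjunction of two tests. -/
def and (t u : Term) : Term := .ite t u 0

/-- The disjunction of two tests. -/
def or (t u : Term) : Term := .ite t 1 u

/-- The negation of a test. -/
def not (t : Term) : Term := .ite t 0 1

/-- The test `t = u`. -/
def eq (t u : Term) : Term := and (le t u) (le u t)

/-- The value `1` if the test succeeds, and `0` otherwise. -/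
def ind (t : Term) : Term := .ite t 1 0

/-- The remainder. -/
def mod (t u : Term) : Term := t - u * (t / u)

@[simp] theorem eval_const (c : ℤ) (s : Store) : (const c).eval s = c := rfl
@[simp] theorem eval_zero (s : Store) : (0 : Term).eval s = 0 := rfl
@[simp] theorem eval_one (s : Store) : (1 : Term).eval s = 1 := rfl
@[simp] theorem eval_two (s : Store) : (2 : Term).eval s = 2 := rfl
@[simp] theorem eval_four (s : Store) : (4 : Term).eval s = 4 := rfl
@[simp] theorem eval_eight (s : Store) : (8 : Term).eval s = 8 := rfl
@[simp] theorem eval_var (x : ℕ) (s : Store) : (var x).eval s = s.var x := rfl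
@[simp] theorem eval_read (a : ℕ) (t : Term) (s : Store) :
    (read a t).eval s = s.arr a (t.eval s) := rfl
@[simp] theorem eval_add (t u : Term) (s : Store) : (t + u).eval s = t.eval s + u.eval s := rfl
@[simp] theorem eval_sub (t u : Term) (s : Store) : (t - u).eval s = t.eval s - u.eval s := rfl
@[simp] theorem eval_mul (t u : Term) (s : Store) : (t * u).eval s = t.eval s * u.eval s := rfl
@[simp] theorem eval_div (t u : Term) (s : Store) : (t / u).eval s = t.eval s / u.eval s := rfl
@[simp] theorem eval_ite (c t u : Term) (s : Store) :
    (ite c t u).eval s = if 0 < c.eval s then t.eval s else u.eval s := rfl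
@[simp] theorem eval_sum (x r : ℕ) (t : Term) (s : Store) :
    (agg false x r t).eval s = ∑ i ∈ Finset.range (s.var r).toNat, t.eval (s.setVar x i) := by
  simp [eval, aggregate]
@[simp] theorem eval_prod (x r : ℕ) (t : Term) (s : Store) :
    (agg true x r t).eval s = ∏ i ∈ Finset.range (s.var r).toNat, t.eval (s.setVar x i) := by
  simp [eval, aggregate]
@[simp] theorem lt_pos (t u : Term) (s : Store) : 0 < (lt t u).eval s ↔ t.eval s < u.eval s := by
  simp [lt]
@[simp] theorem le_pos (t u : Term) (s : Store) : 0 < (le t u).eval s ↔ t.eval s ≤ u.eval s := by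
  simp only [le, eval_add, eval_sub, eval_one]; omega
@[simp] theorem and_pos (t u : Term) (s : Store) :
    0 < (and t u).eval s ↔ 0 < t.eval s ∧ 0 < u.eval s := by
  simp only [and, eval_ite, eval_zero]; split_ifs <;> simp_all
@[simp] theorem or_pos (t u : Term) (s : Store) :
    0 < (or t u).eval s ↔ 0 < t.eval s ∨ 0 < u.eval s := by
  simp only [or, eval_ite, eval_one]; split_ifs <;> simp_all
@[simp] theorem not_pos (t : Term) (s : Store) : 0 < (not t).eval s ↔ ¬ 0 < t.eval s := by
  simp only [not, eval_ite, eval_zero, eval_one]; split_ifs <;> simp_all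
@[simp] theorem eq_pos (t u : Term) (s : Store) : 0 < (eq t u).eval s ↔ t.eval s = u.eval s := by
  simp only [eq, and_pos, le_pos]; omega
@[simp] theorem eval_ind (t : Term) (s : Store) :
    (ind t).eval s = if 0 < t.eval s then 1 else 0 := rfl
@[simp] theorem eval_mod (t u : Term) (s : Store) : (mod t u).eval s = t.eval s % u.eval s := by
  simp only [mod, eval_sub, eval_mul, eval_div, Int.emod_def]

end Term

/-! ### Statements that increase the bit lengths polynomially -/

theorem Stm.Safe.mono {S B B' : ℕ} (hB : B ≤ B') {c : Stm} {s : Store} (h : c.Safe S B s) :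
    c.Safe S B' s := by
  induction c generalizing s with
  | set x t => exact ⟨h.1.mono hB, h.2.mono hB⟩
  | tab a x r t => exact ⟨h.1.mono hB, h.2.mono hB⟩
  | seq c d ihc ihd => exact ⟨ihc h.1, ihd h.2⟩
  | rep r c ih => exact ⟨h.1.mono hB, fun i hi => ih (h.2 i hi)⟩

/-- The statement increases bounds at most polynomially. -/
def Stm.Tame (S : ℕ) (c : Stm) : Prop :=
  ∃ q : Polynomial ℕ, ∀ B s, Bdd S B s →
    B ≤ q.eval B ∧ c.Safe S (q.eval B) s ∧ Bdd S (q.eval B) (c.den s)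

/-- The value of the term is polynomial in the bound of the registers. -/
def Term.Small (S : ℕ) (t : Term) : Prop :=
  ∃ q : Polynomial ℕ, ∀ B s, Bdd S B s → |t.eval s| ≤ q.eval B

theorem Term.small_const (S : ℕ) (c : ℤ) : (Term.const c).Small S :=
  ⟨Polynomial.C c.natAbs, fun B s _ => by simp⟩

theorem Term.small_ofNat (S n : ℕ) : (OfNat.ofNat n : Term).Small S := Term.small_const S n

theorem Term.small_var {S x : ℕ} (hx : x < S) : (Term.var x).Small S :=
  ⟨Polynomial.X, fun B s h => by simpa using h.1 x hx⟩

theorem Term.Small.add {S : ℕ} {t u : Term} (ht : t.Small S) (hu : u.Small S) :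
    (t + u).Small S := by
  obtain ⟨p, hp⟩ := ht
  obtain ⟨q, hq⟩ := hu
  refine ⟨p + q, fun B s h => ?_⟩
  rw [Polynomial.eval_add]
  push_cast
  exact (abs_add_le _ _).trans (add_le_add (hp B s h) (hq B s h))

theorem Term.Small.mul {S : ℕ} {t u : Term} (ht : t.Small S) (hu : u.Small S) :
    (t * u).Small S := by
  obtain ⟨p, hp⟩ := ht
  obtain ⟨q, hq⟩ := hu
  refine ⟨p * q, fun B s h => ?_⟩
  rw [Polynomial.eval_mul, Term.eval_mul, abs_mul]
  push_cast
  exact mul_le_mul (hp B s h) (hq B s h) (abs_nonneg _) (Nat.cast_nonneg _)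

theorem Term.Small.ite {S : ℕ} {c t u : Term} (ht : t.Small S) (hu : u.Small S) :
    (Term.ite c t u).Small S := by
  obtain ⟨p, hp⟩ := ht
  obtain ⟨q, hq⟩ := hu
  refine ⟨p + q, fun B s h => ?_⟩
  rw [Polynomial.eval_add, Term.eval_ite]
  push_cast
  split_ifs
  · exact (hp B s h).trans (by simp)
  · exact (hq B s h).trans (by simp)

theorem Term.Small.sum {S x r : ℕ} {t : Term} (hr : r < S) (ht : t.Small S) :
    (Term.agg false x r t).Small S := by
  obtain ⟨p, hp⟩ := ht
  refine ⟨Polynomial.X * p, fun B s h => ?_⟩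
  rw [Term.eval_sum, Polynomial.eval_mul, Polynomial.eval_X]
  refine (Finset.abs_sum_le_sum_abs _ _).trans ?_
  refine (Finset.sum_le_card_nsmul _ _ ((p.eval B : ℕ) : ℤ) fun i hi => ?_).trans ?_
  · exact hp B _ (h.setVar_nat hr x (Finset.mem_range.1 hi).le)
  · rw [Finset.card_range, nsmul_eq_mul]
    push_cast
    gcongr
    exact h.toNat_le hr

theorem Stm.tame_set {S x : ℕ} {t : Term} (ht : t.Small S) : (Stm.set x t).Tame S := by
  obtain ⟨p, hp⟩ := ht
  refine ⟨Polynomial.X + p, fun B s h => ?_⟩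
  simp only [Polynomial.eval_add, Polynomial.eval_X]
  have h1 := h.mono (B' := B + p.eval B) (by omega)
  have h2 : Bdd S (B + p.eval B) ((Stm.set x t).den s) :=
    h1.setVar x ((hp B s h).trans (by push_cast; linarith))
  exact ⟨by omega, ⟨h1, h2⟩, h2⟩

theorem Stm.tame_tab {S a x r : ℕ} {t : Term} (hr : r < S) (ht : t.wf S) :
    (Stm.tab a x r t).Tame S := by
  obtain ⟨p, hp⟩ := t.eval_bound ht
  refine ⟨Polynomial.X + p, fun B s h => ?_⟩
  simp only [Polynomial.eval_add, Polynomial.eval_X]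
  have h1 := h.mono (B' := B + p.eval B) (by omega)
  have h2 : Bdd S (B + p.eval B) ((Stm.tab a x r t).den s) := by
    refine h1.setCells a fun i hi hir => ?_
    have := hp B _ (h.setVar_nat hr x (i := i.toNat) (by omega))
    rw [Int.toNat_of_nonneg hi] at this
    exact this.trans (pow_le_pow_right₀ (by norm_num) (by omega))
  exact ⟨by omega, ⟨h1, h2⟩, h2⟩

theorem Stm.Tame.seq {S : ℕ} {c d : Stm} (hc : c.Tame S) (hd : d.Tame S) : (c.seq d).Tame S := by
  obtain ⟨p, hp⟩ := hc
  obtain ⟨q, hq⟩ := hd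
  refine ⟨q.comp p, fun B s h => ?_⟩
  rw [Polynomial.eval_comp]
  obtain ⟨h1, h2, h3⟩ := hp B s h
  obtain ⟨h4, h5, h6⟩ := hq _ _ h3
  exact ⟨h1.trans h4, ⟨h2.mono h4, h5⟩, h6⟩

/-! ### The algorithm -/

namespace Algo

open Term

/-- The rank of the value of `e` in the array `a` of the input points. -/
def rankT (a : ℕ) (e : Term) : Term := agg false 22 0 (ind (lt (read a (var 22)) e))

/-- Compute the depth of the tree and the sizes. -/
def sizesStm : Stm :=
  .seq (.set 3 (agg false 20 0 (ind (lt (agg true 21 20 (agg true 22 20 2)) (var 0))))) <|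
  .seq (.set 4 (4 * var 3 * var 0 * var 0)) <|
  .seq (.set 5 (var 1 * (var 0 + 1))) <|
  .seq (.set 6 (var 4 + 1)) <|
  .seq (.set 7 (2 * var 4 * var 4 + 1)) <|
  .seq (.set 8 (var 4 * var 3 + 2 * var 1)) <|
  .set 9 (var 3 + 1)

/-- The powers of `2`, and the coordinates by rank. -/
def coordsStm : Stm :=
  .seq (.tab 26 20 9 (agg true 21 20 (agg true 22 3 2))) <|
  .seq (.tab 27 20 9 (agg true 21 20 2)) <|
  .seq (.tab 19 20 0
    (agg false 21 0 (ite (eq (rankT 0 (read 0 (var 21))) (var 20)) (read 0 (var 21)) 0))) <|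
  .tab 20 20 0
    (agg false 21 0 (ite (eq (rankT 1 (read 1 (var 21))) (var 20)) (read 1 (var 21)) 0))

/-- The cell of the array `a` for the demand in register `20`. -/
def dem (a : ℕ) : Term := read a (var 20)

/-- The rank `t` in the orientation of the demand in register `20`. -/
def flipT (t : Term) : Term := ite (dem 12) (var 0 - 1 - t) t

/-- The data of the demands. -/
def demandsStm : Stm :=
  .seq (.tab 16 20 1 (ind (or (not (eq (dem 2) (dem 4))) (not (eq (dem 3) (dem 5)))))) <|
  .seq (.tab 8 20 1 (rankT 0 (ite (lt (dem 2) (dem 4)) (dem 2) (dem 4)))) <|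
  .seq (.tab 9 20 1 (rankT 0 (ite (lt (dem 2) (dem 4)) (dem 4) (dem 2)))) <|
  .seq (.tab 17 20 1 (ite (lt (dem 2) (dem 4)) (dem 3) (dem 5))) <|
  .seq (.tab 18 20 1 (ite (lt (dem 2) (dem 4)) (dem 5) (dem 3))) <|
  .seq (.tab 12 20 1 (ind (lt (rankT 1 (dem 18)) (rankT 1 (dem 17))))) <|
  .seq (.tab 13 20 1 (agg false 21 3 (ind (not
    (eq (dem 8 / read 26 (var 21 + 1)) (dem 9 / read 26 (var 21 + 1))))))) <|
  .seq (.tab 10 20 1 (flipT (rankT 1 (dem 17)))) <|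
  .seq (.tab 11 20 1 (flipT (rankT 1 (dem 18)))) <|
  .seq (.tab 14 20 1 (((dem 12 * 2 * var 3 + dem 13) * var 0
    + dem 8 / read 26 (dem 13)) * var 0)) <|
  .tab 15 20 1 ((((dem 12 * 2 + 1) * var 3 + dem 13) * var 0
    + dem 9 / read 26 (dem 13)) * var 0)

/-- The demand of the set in register `20`. -/
def setDem : Term := var 20 / (var 0 + 1)

/-- The threshold of the set in register `20`. -/
def setRow : Term := mod (var 20) (var 0 + 1)

/-- The set in register `20` contains the element in register `21`. -/
def memT : Term :=
  or (and (le (read 14 setDem + read 10 setDem) (var 21)) (lt (var 21) (read 14 setDem + setRow)))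
    (and (le (read 15 setDem + setRow) (var 21)) (le (var 21) (read 15 setDem + read 11 setDem)))

/-- Mark the light sets. -/
def lightStm : Stm :=
  .tab 23 20 5 (ind (and (read 16 setDem)
    (lt (4 * var 10 * agg false 21 4 (ite memT (read 21 (var 21)) 0))
      (agg false 21 4 (read 21 (var 21))))))

/-- Double the weights of the first light set. -/
def stepStm : Stm :=
  .seq lightStm <|
  .seq (.tab 24 20 5 (ind (and (read 23 (var 20)) (not (agg false 21 20 (read 23 (var 21))))))) <|
  .seq (.tab 22 21 4
    (read 21 (var 21) * (1 + agg false 20 5 (ite (read 24 (var 20)) (ind memT) 0)))) <|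
  .tab 21 21 4 (read 22 (var 21))

/-- Pass on to the next value of the parameter if there is a light set. -/
def resetStm : Stm :=
  .seq lightStm <|
  .seq (.set 11 (ind (agg false 20 5 (read 23 (var 20))))) <|
  .seq (.set 10 (var 10 + var 11)) <|
  .seq (.tab 22 21 4 (ite (var 11) 1 (read 21 (var 21)))) <|
  .tab 21 21 4 (read 22 (var 21))

/-- The index of the slot in register `20`. -/
def slotIdx : Term := var 20 / var 3

/-- The number of the boundary of the slot in register `20`. -/
def slotBit : Term := mod (var 20) (var 3)

/-- The slot in register `20` belongs to an index. -/
def isIdx : Term := lt (var 20) (var 4 * var 3)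

/-- The demand of the slot in register `20`. -/
def slotDem : Term := (var 20 - var 4 * var 3) / 2

/-- The slot in register `20` belongs to a left point. -/
def isLeft : Term := eq (mod (var 20 - var 4 * var 3) 2) 0

/-- The level of the index of the slot. -/
def slotLevel : Term := mod (slotIdx / var 0 / var 0) (var 3)

/-- The orientation and the side of the index of the slot. -/
def slotSide : Term := slotIdx / var 0 / var 0 / var 3

/-- The rank of the column of the slot in register `20`. -/
def columnT : Term := ite isIdx
    ((mod (slotIdx / var 0) (var 0) / read 27 slotBit + (1 - mod slotSide 2))
      * (read 26 slotLevel * read 27 slotBit))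
    (ite isLeft
      ((read 8 slotDem / read 26 (read 13 slotDem) + 1) * read 26 (read 13 slotDem))
      (read 9 slotDem / read 26 (read 13 slotDem) * read 26 (read 13 slotDem)))

/-- The second coordinate of the point of the slot in register `20`. -/
def rowT : Term := ite isIdx
    (read 20 (ite (slotSide / 2) (var 0 - 1 - mod slotIdx (var 0)) (mod slotIdx (var 0))))
    (ite isLeft (read 17 slotDem) (read 18 slotDem))

/-- The output. -/
def outputStm : Stm :=
  .seq (.tab 25 21 4 (ind (lt
    (8 * var 10 * agg false 22 21 (read 21 (var 22)) / agg false 22 4 (read 21 (var 22)))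
    (8 * var 10 * (agg false 22 21 (read 21 (var 22)) + read 21 (var 21))
      / agg false 22 4 (read 21 (var 22)))))) <|
  .seq (.tab 28 20 8 columnT) <|
  .seq (.tab 29 20 8 (ite isIdx (ind (and (read 25 slotIdx) (lt (read 28 (var 20)) (var 0))))
    (read 16 slotDem))) <|
  .seq (.tab 6 20 8 (ite (read 29 (var 20)) (read 19 (read 28 (var 20))) 0)) <|
  .seq (.tab 7 20 8 (ite (read 29 (var 20)) rowT 0)) <|
  .set 2 (ite (agg false 20 1 (read 16 (var 20))) (var 8) 0)

/-- The initial weights. -/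
def weightsStm : Stm := .tab 21 21 4 1

/-- The preparations. -/
def prepareStm : Stm := .seq sizesStm <| .seq coordsStm <| .seq demandsStm weightsStm

/-- The search for the weights. -/
def searchStm : Stm := .rep 6 (.seq resetStm (.rep 7 stepStm))

/-- The algorithm. -/
def algorithm : Stm := .seq prepareStm <| .seq searchStm outputStm

theorem algorithm_wf : algorithm.wf 50 = true := by decide

theorem prepare_tame : prepareStm.Tame 50 := by
  have hv : ∀ x < 50, (Term.var x).Small 50 := fun x hx => small_var hx
  refine Stm.Tame.seq (Stm.Tame.seq (Stm.tame_set ?_) <| Stm.Tame.seq (Stm.tame_set ?_) <|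
    Stm.Tame.seq (Stm.tame_set ?_) <| Stm.Tame.seq (Stm.tame_set ?_) <|
    Stm.Tame.seq (Stm.tame_set ?_) <| Stm.Tame.seq (Stm.tame_set ?_) (Stm.tame_set ?_)) ?_
  · exact Small.sum (by norm_num) (Small.ite (small_ofNat _ _) (small_ofNat _ _))
  · exact (((small_ofNat _ _).mul (hv 3 (by norm_num))).mul (hv 0 (by norm_num))).mul
      (hv 0 (by norm_num))
  · exact (hv 1 (by norm_num)).mul ((hv 0 (by norm_num)).add (small_ofNat _ _))
  · exact (hv 4 (by norm_num)).add (small_ofNat _ _)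
  · exact (((small_ofNat _ _).mul (hv 4 (by norm_num))).mul (hv 4 (by norm_num))).add
      (small_ofNat _ _)
  · exact ((hv 4 (by norm_num)).mul (hv 3 (by norm_num))).add
      ((small_ofNat _ _).mul (hv 1 (by norm_num)))
  · exact (hv 3 (by norm_num)).add (small_ofNat _ _)
  · unfold coordsStm demandsStm weightsStm
    repeat' first
      | exact Stm.tame_tab (by norm_num) (by decide)
      | apply Stm.Tame.seq

theorem output_tame : outputStm.Tame 50 := by
  unfold outputStm
  repeat' first
    | exact Stm.tame_tab (by norm_num) (by decide)
    | exact Stm.tame_set (Small.ite (small_var (by norm_num)) (small_ofNat _ _))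
    | apply Stm.Tame.seq

end Algo

theorem sum_range_getD {α : Type*} (l : List α) (g : α → ℤ) (x : α) :
    ∑ i ∈ Finset.range l.length, g (l.getD i x) = (l.map g).sum := by
  induction l with
  | nil => simp
  | cons a l ih =>
    simp only [List.length_cons, Finset.sum_range_succ', List.getD_cons_succ, List.getD_cons_zero,
      ih, List.map_cons, List.sum_cons, add_comm]

theorem Instance.ListedBy.sum_points {I : Instance} {ps : List (ℤ × ℤ)}
    {ds : List ((ℤ × ℤ) × (ℤ × ℤ))} (h : I.ListedBy ps ds) (g : ℤ × ℤ → ℤ) :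
    ∑ i ∈ Finset.range ps.length, g (ps.getD i 0) = ∑ p ∈ I.P, g p := by
  rw [sum_range_getD, ← List.sum_toFinset g h.nodup_points]
  exact Finset.sum_congr (by ext p; simp [h.mem_points]) fun _ _ => rfl

theorem Instance.ListedBy.length_points {I : Instance} {ps : List (ℤ × ℤ)}
    {ds : List ((ℤ × ℤ) × (ℤ × ℤ))} (h : I.ListedBy ps ds) : ps.length = I.P.card := by
  have := h.sum_points fun _ => 1
  simpa using this

theorem Instance.ListedBy.getD_mem {I : Instance} {ps : List (ℤ × ℤ)}
    {ds : List ((ℤ × ℤ) × (ℤ × ℤ))} (h : I.ListedBy ps ds) {i : ℕ} (hi : i < ds.length) :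
    ds.getD i 0 ∈ I.D := by
  rw [List.getD_eq_getElem _ _ hi, ← h.mem_demands]
  exact List.getElem_mem hi

namespace Algo

open Term Instance

variable (I : Instance) (ps : List (ℤ × ℤ)) (ds : List ((ℤ × ℤ) × (ℤ × ℤ)))

/-- The values of the registers after the preparations. -/
def specVar : ℕ → ℤ
  | 0 => I.P.card
  | 1 => ds.length
  | 3 => I.depth
  | 4 => I.size
  | 5 => (I.problem ds).M
  | 6 => I.size + 1
  | 7 => (I.problem ds).rounds
  | 8 => I.size * I.depth + 2 * ds.length
  | 9 => I.depth + 1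
  | _ => 0

/-- The number of cells of the arrays that are used. -/
def specLen : ℕ → ℕ
  | 0 | 1 | 19 | 20 => I.P.card
  | 26 | 27 => I.depth + 1
  | _ => ds.length

open Classical in
/-- The contents of the arrays after the preparations. -/
noncomputable def specArr : ℕ → ℕ → ℤ
  | 0, i => (ps.getD i 0).1
  | 1, i => (ps.getD i 0).2
  | 2, i => (ds.getD i 0).1.1
  | 3, i => (ds.getD i 0).1.2
  | 4, i => (ds.getD i 0).2.1
  | 5, i => (ds.getD i 0).2.2
  | 8, i => I.lrank (ds.getD i 0)
  | 9, i => I.rrank (ds.getD i 0)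
  | 10, i => I.low (ds.getD i 0)
  | 11, i => I.high (ds.getD i 0)
  | 12, i => I.ori (ds.getD i 0)
  | 13, i => I.lev (ds.getD i 0)
  | 14, i => I.outOffset (ds.getD i 0)
  | 15, i => I.inOffset (ds.getD i 0)
  | 16, i => if (ds.getD i 0).1 ≠ (ds.getD i 0).2 then 1 else 0
  | 17, i => (left (ds.getD i 0)).2
  | 18, i => (right (ds.getD i 0)).2
  | 19, i => I.coord Prod.fst i
  | 20, i => I.coord Prod.snd i
  | 26, i => 2 ^ (I.depth * i)
  | 27, i => 2 ^ i
  | _, _ => 0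

/-- The registers below `10`, except `2`, and the arrays in `L` have the specified contents. -/
structure Known (L : List ℕ) (s : Store) : Prop where
  var_eq : ∀ x < 10, x ≠ 2 → s.var x = specVar I ds x
  arr_eq : ∀ a ∈ L, ∀ i < specLen I ds a, s.arr a i = specArr I ps ds a i

variable {I ps ds}

theorem Known.tab {L : List ℕ} {s : Store} (h : Known I ps ds L s) {a x r : ℕ} {t : Term}
    (hr : s.var r = specLen I ds a)
    (ht : ∀ i < specLen I ds a, t.eval (s.setVar x (i : ℤ)) = specArr I ps ds a i) :
    Known I ps ds (a :: L) ((Stm.tab a x r t).den s) := by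
  refine ⟨h.1, fun b hb i hi => ?_⟩
  simp only [Stm.den, Store.setCells_arr]
  split_ifs with h1 h2
  · subst h1; exact ht i hi
  · subst h1; omega
  · exact h.2 b ((List.mem_cons.1 hb).resolve_left h1) i hi

theorem Known.tab_seq {L L' : List ℕ} {s : Store} (h : Known I ps ds L s) {a x r : ℕ} {t : Term}
    {c : Stm} (hr : s.var r = specLen I ds a)
    (ht : ∀ i < specLen I ds a, t.eval (s.setVar x (i : ℤ)) = specArr I ps ds a i)
    (hc : ∀ s', Known I ps ds (a :: L) s' → Known I ps ds L' (c.den s')) :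
    Known I ps ds L' ((Stm.seq (.tab a x r t) c).den s) :=
  hc _ (h.tab hr ht)

theorem Known.of_frame {L : List ℕ} {s s' : Store} (h : Known I ps ds L s)
    (hv : ∀ x < 10, x ≠ 2 → s'.var x = s.var x) (ha : ∀ a ∈ L, s'.arr a = s.arr a) :
    Known I ps ds L s' :=
  ⟨fun x hx hx2 => (hv x hx hx2).trans (h.1 x hx hx2),
    fun a haL i hi => by rw [ha a haL]; exact h.2 a haL i hi⟩

theorem rank_eq_sum {f : ℤ × ℤ → ℤ} (hl : I.ListedBy ps ds) (z : ℤ) :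
    (∑ i ∈ Finset.range I.P.card, if f (ps.getD i 0) < z then (1 : ℤ) else 0) = I.rank f z := by
  have := hl.sum_points fun p => if f p < z then 1 else 0
  rw [hl.length_points] at this
  rw [this, Instance.rank]
  simp

theorem eval_rankT_fst {L : List ℕ} {s s' : Store} (h : Known I ps ds L s) (hl : I.ListedBy ps ds)
    (hL : 0 ∈ L) (hs : s'.arr = s.arr) (h0 : s'.var 0 = s.var 0) {e : Term} {z : ℤ}
    (he : ∀ i : ℕ, e.eval (s'.setVar 22 i) = z) :
    (rankT 0 e).eval s' = I.rank Prod.fst z := by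
  rw [← rank_eq_sum hl]
  simp only [rankT, eval_sum, h0, h.1 0 (by norm_num) (by norm_num), specVar, Int.toNat_natCast,
    eval_ind, lt_pos, eval_read, eval_var, Store.setVar_var, if_true, Store.setVar_arr, hs, he]
  refine Finset.sum_congr rfl fun i hi => ?_
  rw [h.2 0 hL i (Finset.mem_range.1 hi)]
  rfl

theorem eval_rankT_snd {L : List ℕ} {s s' : Store} (h : Known I ps ds L s) (hl : I.ListedBy ps ds)
    (hL : 1 ∈ L) (hs : s'.arr = s.arr) (h0 : s'.var 0 = s.var 0) {e : Term} {z : ℤ}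
    (he : ∀ i : ℕ, e.eval (s'.setVar 22 i) = z) :
    (rankT 1 e).eval s' = I.rank Prod.snd z := by
  rw [← rank_eq_sum hl]
  simp only [rankT, eval_sum, h0, h.1 0 (by norm_num) (by norm_num), specVar, Int.toNat_natCast,
    eval_ind, lt_pos, eval_read, eval_var, Store.setVar_var, if_true, Store.setVar_arr, hs, he]
  refine Finset.sum_congr rfl fun i hi => ?_
  rw [h.2 1 hL i (Finset.mem_range.1 hi)]
  rfl

theorem known_sizes {s : Store} (h0 : s.var 0 = I.P.card) (h1 : s.var 1 = ds.length) {L : List ℕ}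
    (hL : ∀ a ∈ L, ∀ i < specLen I ds a, s.arr a i = specArr I ps ds a i) :
    Known I ps ds L (sizesStm.den s) ∧ (sizesStm.den s).var 10 = s.var 10 := by
  have hk : (agg false 20 0 (ind (lt (agg true 21 20 (agg true 22 20 2)) (var 0)))).eval s
      = I.depth := by
    have : ∀ i : ℕ, ((2 : ℤ) ^ i) ^ i < I.P.card ↔ 2 ^ (i * i) < I.P.card := fun i => by
      rw [← pow_mul]; norm_cast
    simp [h0, Instance.depth, this]
  refine ⟨⟨?_, ?_⟩, ?_⟩
  · intro x hx hx2
    simp only [sizesStm, Stm.den, hk]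
    clear hk
    interval_cases x <;>
      simp [h0, h1, specVar, Instance.size, Instance.problem, HitProblem.rounds] at *
  · exact hL
  · simp [sizesStm, Stm.den]

theorem Known.eval_coord_fst {L : List ℕ} {s : Store} (h : Known I ps ds L s)
    (hl : I.ListedBy ps ds) (hL : 0 ∈ L) (m : ℕ) :
    (agg false 21 0 (ite (eq (rankT 0 (read 0 (var 21))) (var 20)) (read 0 (var 21)) 0)).eval
      (s.setVar 20 m) = I.coord Prod.fst m := by
  have hsum := hl.sum_points fun p => if I.rank Prod.fst p.1 = m then p.1 else 0
  rw [Instance.coord, ← hsum, hl.length_points, eval_sum]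
  simp only [Store.setVar_var, h.1 0 (by norm_num) (by norm_num), specVar]
  refine Finset.sum_congr (by simp) fun i hi => ?_
  have hi' : i < I.P.card := by simpa using hi
  have hr := eval_rankT_fst h hl hL (s' := (s.setVar 20 m).setVar 21 i) rfl rfl
    (e := read 0 (var 21)) (z := s.arr 0 i) (fun j => by simp)
  simp only [eval_ite, eq_pos, hr]
  simp [h.2 0 hL i hi', specArr]

theorem Known.eval_coord_snd {L : List ℕ} {s : Store} (h : Known I ps ds L s)
    (hl : I.ListedBy ps ds) (hL : 1 ∈ L) (m : ℕ) :
    (agg false 21 0 (ite (eq (rankT 1 (read 1 (var 21))) (var 20)) (read 1 (var 21)) 0)).eval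
      (s.setVar 20 m) = I.coord Prod.snd m := by
  have hsum := hl.sum_points fun p => if I.rank Prod.snd p.2 = m then p.2 else 0
  rw [Instance.coord, ← hsum, hl.length_points, eval_sum]
  simp only [Store.setVar_var, h.1 0 (by norm_num) (by norm_num), specVar]
  refine Finset.sum_congr (by simp) fun i hi => ?_
  have hi' : i < I.P.card := by simpa using hi
  have hr := eval_rankT_snd h hl hL (s' := (s.setVar 20 m).setVar 21 i) rfl rfl
    (e := read 1 (var 21)) (z := s.arr 1 i) (fun j => by simp)
  simp only [eval_ite, eq_pos, hr]
  simp [h.2 1 hL i hi', specArr]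

theorem Known.coords {L : List ℕ} {s : Store} (h : Known I ps ds L s) (hl : I.ListedBy ps ds)
    (h0 : 0 ∈ L) (h1 : 1 ∈ L) :
    Known I ps ds (20 :: 19 :: 27 :: 26 :: L) (coordsStm.den s) := by
  have hv9 : s.var 9 = ((I.depth + 1 : ℕ) : ℤ) := by
    rw [h.1 9 (by norm_num) (by norm_num)]; simp [specVar]
  have k1 := Known.tab h (a := 26) (x := 20) (r := 9) (t := agg true 21 20 (agg true 22 3 2)) hv9
    fun i _ => by simp [h.1 3 (by norm_num) (by norm_num), specVar, specArr, pow_mul]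
  have k2 := Known.tab k1 (a := 27) (x := 20) (r := 9) (t := agg true 21 20 2) hv9
    fun i _ => by simp [specArr]
  have k3 := Known.tab k2 (a := 19) (x := 20) (r := 0) (k2.1 0 (by norm_num) (by norm_num))
    fun i _ => k2.eval_coord_fst hl (by simp [h0]) i
  exact Known.tab k3 (a := 20) (x := 20) (r := 0) (k3.1 0 (by norm_num) (by norm_num))
    fun i _ => k3.eval_coord_snd hl (by simp [h1]) i

theorem Known.demands {L : List ℕ} {s : Store} (h : Known I ps ds L s) (hl : I.ListedBy ps ds)
    (h0 : 0 ∈ L) (h1 : 1 ∈ L) (h2 : 2 ∈ L) (h3 : 3 ∈ L) (h4 : 4 ∈ L) (h5 : 5 ∈ L) (h26 : 26 ∈ L) :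
    Known I ps ds (15 :: 14 :: 11 :: 10 :: 13 :: 12 :: 18 :: 17 :: 9 :: 8 :: 16 :: L)
      (demandsStm.den s) := by
  have hleft : ∀ i, left (ds.getD i 0) = if specArr I ps ds 2 i < specArr I ps ds 4 i then
    (specArr I ps ds 2 i, specArr I ps ds 3 i) else (specArr I ps ds 4 i, specArr I ps ds 5 i) :=
    fun i => rfl
  have hright : ∀ i, right (ds.getD i 0) = if specArr I ps ds 2 i < specArr I ps ds 4 i then
    (specArr I ps ds 4 i, specArr I ps ds 5 i) else (specArr I ps ds 2 i, specArr I ps ds 3 i) :=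
    fun i => rfl
  have hry : ∀ {L' : List ℕ} {s' : Store}, Known I ps ds L' s' → 1 ∈ L' → 17 ∈ L' → 18 ∈ L' →
      ∀ i < ds.length,
      (rankT 1 (dem 17)).eval (s'.setVar 20 i) = I.rank Prod.snd (left (ds.getD i 0)).2 ∧
      (rankT 1 (dem 18)).eval (s'.setVar 20 i) = I.rank Prod.snd (right (ds.getD i 0)).2 := by
    intro L' s' h' e1 e17 e18 i hi
    constructor
    · refine eval_rankT_snd (s' := s'.setVar 20 i) h' hl e1 rfl rfl fun j => ?_
      simp [dem, h'.2 17 e17 i hi, specArr]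
    · refine eval_rankT_snd (s' := s'.setVar 20 i) h' hl e1 rfl rfl fun j => ?_
      simp [dem, h'.2 18 e18 i hi, specArr]
  have hlev : ∀ i, I.lev (ds.getD i 0) < specLen I ds 26 := fun i => by
    show I.lev (ds.getD i 0) < I.depth + 1
    have : I.lev (ds.getD i 0) ≤ I.depth := by
      unfold Instance.lev Instance.level
      exact (Finset.card_filter_le _ _).trans (by simp)
    omega
  unfold demandsStm
  refine Known.tab_seq h (x := 20) (r := 1)
    (h.1 1 (by norm_num) (by norm_num)) (fun i hi => by
      simp only [eval_ind, or_pos, not_pos, eq_pos, dem, eval_read, eval_var, Store.setVar_var,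
        if_true, Store.setVar_arr, h.2 2 h2 i hi, h.2 3 h3 i hi, h.2 4 h4 i hi, h.2 5 h5 i hi]
      simp only [specArr, ne_eq, Prod.ext_iff]
      refine if_congr ?_ rfl rfl
      tauto)
    fun s1 k1 => ?_
  refine Known.tab_seq k1 (x := 20) (r := 1)
    (k1.1 1 (by norm_num) (by norm_num)) (fun i hi => by
      refine Eq.trans (eval_rankT_fst (s' := s1.setVar 20 i) k1 hl (by simp [h0]) rfl rfl
        (z := (left (ds.getD i 0)).1) fun j => ?_) (by simp only [specArr, Instance.lrank])
      rw [hleft]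
      simp only [eval_ite, lt_pos, dem, eval_read, eval_var, Store.setVar_var, Store.setVar_arr]
      simp only [show (20 : ℕ) ≠ 22 by norm_num, if_false, if_true]
      rw [k1.2 2 (by simp [h2]) i hi, k1.2 4 (by simp [h4]) i hi]
      split_ifs <;> rfl)
    fun s2 k2 => ?_
  refine Known.tab_seq k2 (x := 20) (r := 1)
    (k2.1 1 (by norm_num) (by norm_num)) (fun i hi => by
      refine Eq.trans (eval_rankT_fst (s' := s2.setVar 20 i) k2 hl (by simp [h0]) rfl rfl
        (z := (right (ds.getD i 0)).1) fun j => ?_) (by simp only [specArr, Instance.rrank])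
      rw [hright]
      simp only [eval_ite, lt_pos, dem, eval_read, eval_var, Store.setVar_var, Store.setVar_arr]
      simp only [show (20 : ℕ) ≠ 22 by norm_num, if_false, if_true]
      rw [k2.2 2 (by simp [h2]) i hi, k2.2 4 (by simp [h4]) i hi]
      split_ifs <;> rfl)
    fun s3 k3 => ?_
  refine Known.tab_seq k3 (x := 20) (r := 1)
    (k3.1 1 (by norm_num) (by norm_num)) (fun i hi => by
      simp only [eval_ite, lt_pos, dem, eval_read, eval_var, Store.setVar_var, Store.setVar_arr,
        if_true]
      rw [k3.2 2 (by simp [h2]) i hi, k3.2 4 (by simp [h4]) i hi, k3.2 3 (by simp [h3]) i hi,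
        k3.2 5 (by simp [h5]) i hi]
      show _ = (left (ds.getD i 0)).2
      rw [hleft]
      split_ifs <;> rfl)
    fun s4 k4 => ?_
  refine Known.tab_seq k4 (x := 20) (r := 1)
    (k4.1 1 (by norm_num) (by norm_num)) (fun i hi => by
      simp only [eval_ite, lt_pos, dem, eval_read, eval_var, Store.setVar_var, Store.setVar_arr,
        if_true]
      rw [k4.2 2 (by simp [h2]) i hi, k4.2 4 (by simp [h4]) i hi, k4.2 3 (by simp [h3]) i hi,
        k4.2 5 (by simp [h5]) i hi]
      show _ = (right (ds.getD i 0)).2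
      rw [hright]
      split_ifs <;> rfl)
    fun s5 k5 => ?_
  refine Known.tab_seq k5 (x := 20) (r := 1)
    (k5.1 1 (by norm_num) (by norm_num)) (fun i hi => by
      obtain ⟨e1, e2⟩ := hry k5 (by simp [h1]) (by simp) (by simp) i hi
      simp only [eval_ind, lt_pos, e1, e2]
      simp [specArr, Instance.ori])
    fun s6 k6 => ?_
  refine Known.tab_seq k6 (x := 20) (r := 1)
    (k6.1 1 (by norm_num) (by norm_num)) (fun i hi => by
      have e3 := k6.1 3 (by norm_num) (by norm_num)
      simp only [eval_sum, Store.setVar_var, show (3 : ℕ) ≠ 20 by norm_num, if_false, e3]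
      simp only [specVar, Int.toNat_natCast, specArr, Instance.lev, Instance.level,
        Finset.card_filter, Nat.cast_sum]
      refine Finset.sum_congr rfl fun l hlk => ?_
      have hl1 : l + 1 < specLen I ds 26 := by
        have := Finset.mem_range.1 hlk
        show l + 1 < I.depth + 1
        omega
      simp only [eval_ind, not_pos, eq_pos, eval_div, dem, eval_read, eval_var, eval_add, eval_one,
        Store.setVar_var, Store.setVar_arr, if_true, show (20 : ℕ) ≠ 21 by norm_num, if_false]
      have e26 := k6.2 26 (by simp [h26]) (l + 1) hl1
      push_cast at e26
      rw [k6.2 8 (by simp) i hi, k6.2 9 (by simp) i hi, e26]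
      simp only [specArr, strip]
      norm_cast)
    fun s7 k7 => ?_
  refine Known.tab_seq k7 (x := 20) (r := 1)
    (k7.1 1 (by norm_num) (by norm_num)) (fun i hi => by
      obtain ⟨e1, e2⟩ := hry k7 (by simp [h1]) (by simp) (by simp) i hi
      have hlt : I.rank Prod.snd (left (ds.getD i 0)).2 < I.P.card :=
        rank_lt_card (f := Prod.snd) (left_mem (hl.getD_mem hi))
      simp only [flipT, eval_ite, eval_sub, eval_var, e1]
      simp only [dem, eval_read, eval_var, Store.setVar_var, Store.setVar_arr, if_true,
        show (0 : ℕ) ≠ 20 by norm_num, if_false, k7.1 0 (by norm_num) (by norm_num),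
        k7.2 12 (by simp) i hi, eval_one]
      simp only [specArr, specVar, Instance.low, Instance.flip]
      have := ori_lt (I := I) (ds.getD i 0)
      split_ifs <;> omega)
    fun s8 k8 => ?_
  refine Known.tab_seq k8 (x := 20) (r := 1)
    (k8.1 1 (by norm_num) (by norm_num)) (fun i hi => by
      obtain ⟨e1, e2⟩ := hry k8 (by simp [h1]) (by simp) (by simp) i hi
      have hlt : I.rank Prod.snd (right (ds.getD i 0)).2 < I.P.card :=
        rank_lt_card (f := Prod.snd) (right_mem (hl.getD_mem hi))
      simp only [flipT, eval_ite, eval_sub, eval_var, e2]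
      simp only [dem, eval_read, eval_var, Store.setVar_var, Store.setVar_arr, if_true,
        show (0 : ℕ) ≠ 20 by norm_num, if_false, k8.1 0 (by norm_num) (by norm_num),
        k8.2 12 (by simp) i hi, eval_one]
      simp only [specArr, specVar, Instance.high, Instance.flip]
      have := ori_lt (I := I) (ds.getD i 0)
      split_ifs <;> omega)
    fun s9 k9 => ?_
  refine Known.tab_seq k9 (x := 20) (r := 1)
    (k9.1 1 (by norm_num) (by norm_num)) (fun i hi => by
      simp only [eval_add, eval_mul, eval_div, dem, eval_read, eval_var, Store.setVar_var,
        Store.setVar_arr, if_true, show (0 : ℕ) ≠ 20 by norm_num, show (3 : ℕ) ≠ 20 by norm_num,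
        if_false, k9.1 0 (by norm_num) (by norm_num), k9.1 3 (by norm_num) (by norm_num),
        k9.2 12 (by simp) i hi, k9.2 13 (by simp) i hi, k9.2 8 (by simp) i hi, eval_two]
      have e26 := k9.2 26 (by simp [h26]) _ (hlev i)
      simp only [specArr, specVar] at e26 ⊢
      rw [e26]
      simp only [Instance.outOffset, Instance.offset, strip]
      push_cast
      ring)
    fun s10 k10 => ?_
  exact Known.tab k10 (a := 15) (x := 20) (r := 1)
    (k10.1 1 (by norm_num) (by norm_num)) fun i hi => by
      simp only [eval_add, eval_mul, eval_div, dem, eval_read, eval_var, Store.setVar_var,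
        Store.setVar_arr, if_true, show (0 : ℕ) ≠ 20 by norm_num, show (3 : ℕ) ≠ 20 by norm_num,
        if_false, k10.1 0 (by norm_num) (by norm_num), k10.1 3 (by norm_num) (by norm_num),
        k10.2 12 (by simp) i hi, k10.2 13 (by simp) i hi, k10.2 9 (by simp) i hi, eval_two,
        eval_one]
      have e26 := k10.2 26 (by simp [h26]) _ (hlev i)
      simp only [specArr, specVar] at e26 ⊢
      rw [e26]
      simp only [Instance.inOffset, Instance.offset, strip]
      push_cast
      ring

end Algo

theorem Stm.tab_arr {a x r : ℕ} {t : Term} {s : Store} {i : ℕ} (hi : (i : ℤ) < s.var r) :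
    ((Stm.tab a x r t).den s).arr a i = t.eval (s.setVar x i) := by
  simp [Stm.den, Store.setCells_arr, hi]

theorem Stm.tab_arr_ne {a x r b : ℕ} {t : Term} {s : Store} (hb : b ≠ a) :
    ((Stm.tab a x r t).den s).arr b = s.arr b := by
  funext i
  simp [Stm.den, Store.setCells_arr, hb]

namespace Algo

open Term Instance

/-- The arrays of the input. -/
def inputArrays : List ℕ := [0, 1, 2, 3, 4, 5]

/-- The arrays that are filled by the preparations. -/
def preparedArrays : List ℕ :=
  15 :: 14 :: 11 :: 10 :: 13 :: 12 :: 18 :: 17 :: 9 :: 8 :: 16 :: 20 :: 19 :: 27 :: 26 ::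
    inputArrays

/-- Started in a store with `P`, the statement is safe, and it ends in a store with `Q`. -/
def Triple (B : ℕ) (P : Store → Prop) (c : Stm) (Q : Store → Prop) : Prop :=
  ∀ s, P s → c.Safe 50 B s ∧ Q (c.den s)

theorem Triple.seq {B : ℕ} {P Q R : Store → Prop} {c d : Stm} (hc : Triple B P c Q)
    (hd : Triple B Q d R) : Triple B P (c.seq d) R := fun s hs =>
  ⟨⟨(hc s hs).1, (hd _ (hc s hs).2).1⟩, (hd _ (hc s hs).2).2⟩

theorem Triple.rep {B r n : ℕ} {P : ℕ → Store → Prop} {c : Stm}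
    (hr : ∀ s, P 0 s → Bdd 50 B s ∧ s.var r = n) (hc : ∀ i < n, Triple B (P i) c (P (i + 1))) :
    Triple B (P 0) (.rep r c) (P n) := by
  intro s hs
  obtain ⟨hb, hn⟩ := hr s hs
  have key : ∀ i ≤ n, P i (c.den^[i] s) := by
    intro i
    induction i with
    | zero => exact fun _ => hs
    | succ i ih =>
      intro hi
      rw [Function.iterate_succ_apply']
      exact (hc i hi _ (ih (by omega))).2
  simp only [Stm.Safe, Stm.den, hn, Int.toNat_natCast]
  exact ⟨⟨hb, fun i hi => (hc i hi _ (key i hi.le)).1⟩, key n le_rfl⟩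

/-- The state of the search: the parameter `K`, and the weights `w`. -/
structure Search (I : Instance) (ps : List (ℤ × ℤ)) (ds : List ((ℤ × ℤ) × (ℤ × ℤ))) (B : ℕ)
    (K : ℤ) (w : ℕ → ℤ) (s : Store) : Prop where
  known : Known I ps ds preparedArrays s
  K_eq : s.var 10 = K
  w_eq : ∀ u < I.size, s.arr 21 u = w u
  bdd : Bdd 50 B s

variable {I : Instance} {ps : List (ℤ × ℤ)} {ds : List ((ℤ × ℤ) × (ℤ × ℤ))} {B : ℕ} {K : ℤ}
  {w : ℕ → ℤ} {s : Store}

theorem Known.setVar {L : List ℕ} (h : Known I ps ds L s) {x : ℕ} (hx : 10 ≤ x) (v : ℤ) :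
    Known I ps ds L (s.setVar x v) :=
  h.of_frame (fun y hy _ => by rw [Store.setVar_var, if_neg (by omega)]) fun _ _ => rfl

theorem Known.tab_ne {L : List ℕ} (h : Known I ps ds L s) {a x r : ℕ} {t : Term} (ha : a ∉ L) :
    Known I ps ds L ((Stm.tab a x r t).den s) :=
  h.of_frame (fun _ _ _ => rfl) fun _ hb => Stm.tab_arr_ne fun e => ha (e ▸ hb)

theorem Search.var_eq (h : Search I ps ds B K w s) {x : ℕ} (hx : x < 10) (hx2 : x ≠ 2) :
    s.var x = specVar I ds x := h.known.1 x hx hx2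

theorem bdd_tab {a x r : ℕ} {t : Term} (h : Bdd 50 B s)
    (ht : ∀ i : ℕ, (i : ℤ) < s.var r → |t.eval (s.setVar x i)| ≤ 2 ^ B) :
    Bdd 50 B ((Stm.tab a x r t).den s) := by
  refine h.setCells a fun i hi hir => ?_
  have := ht i.toNat (by omega)
  rwa [Int.toNat_of_nonneg hi] at this

theorem Search.tab (h : Search I ps ds B K w s) {a x r : ℕ} {t : Term}
    (ha : a ∉ 21 :: preparedArrays)
    (ht : ∀ i : ℕ, (i : ℤ) < s.var r → |t.eval (s.setVar x i)| ≤ 2 ^ B) :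
    (Stm.tab a x r t).Safe 50 B s ∧ Search I ps ds B K w ((Stm.tab a x r t).den s) := by
  rw [List.mem_cons, not_or] at ha
  have hb := bdd_tab (a := a) h.bdd ht
  refine ⟨⟨h.bdd, hb⟩, h.known.tab_ne ha.2, h.K_eq, fun u hu => ?_, hb⟩
  rw [Stm.tab_arr_ne (Ne.symm ha.1), h.w_eq u hu]

/-- Replace the weights by those in the array `22`. -/
theorem Search.copy (h : Search I ps ds B K w s) {w' : ℕ → ℤ}
    (hw : ∀ u < I.size, s.arr 22 u = w' u) :
    (Stm.tab 21 21 4 (read 22 (var 21))).Safe 50 B s ∧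
      Search I ps ds B K w' ((Stm.tab 21 21 4 (read 22 (var 21))).den s) := by
  have hb := bdd_tab (a := 21) (x := 21) (r := 4) (t := read 22 (var 21)) h.bdd
    fun i _ => by simpa using h.bdd.2 22 i
  refine ⟨⟨h.bdd, hb⟩, h.known.tab_ne (by decide), h.K_eq, fun u hu => ?_, hb⟩
  have e4 : s.var 4 = (I.size : ℤ) := h.var_eq (by norm_num) (by norm_num)
  rw [Stm.tab_arr (by rw [e4]; exact_mod_cast hu)]
  simpa using hw u hu

theorem memT_pos (h : Known I ps ds preparedArrays s) {c u : ℕ} (hc : c < (I.problem ds).M)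
    (h20 : s.var 20 = c) (h21 : s.var 21 = u) :
    0 < memT.eval s ↔ (I.problem ds).mem c u := by
  have hd : c / (I.P.card + 1) < ds.length := Nat.div_lt_of_lt_mul (by
    rw [mul_comm]; exact hc)
  have e0 : s.var 0 = I.P.card := h.1 0 (by norm_num) (by norm_num)
  have e1 : setDem.eval s = ((c / (I.P.card + 1) : ℕ) : ℤ) := by
    simp [setDem, h20, e0]
  have e2 : setRow.eval s = ((c % (I.P.card + 1) : ℕ) : ℤ) := by
    simp [setRow, h20, e0]
  simp only [memT, or_pos, and_pos, le_pos, lt_pos, eval_add, eval_read, eval_var, h21, e1, e2,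
    h.2 14 (by decide) _ hd, h.2 10 (by decide) _ hd, h.2 15 (by decide) _ hd,
    h.2 11 (by decide) _ hd]
  simp only [specArr, Instance.problem]
  norm_cast

open Classical in
theorem Search.light (h : Search I ps ds B K w s) :
    lightStm.Safe 50 B s ∧ Search I ps ds B K w (lightStm.den s) ∧
      ∀ c < (I.problem ds).M, (lightStm.den s).arr 23 c =
        if (I.problem ds).Light K w c then 1 else 0 := by
  have e5 : s.var 5 = ((I.problem ds).M : ℤ) := h.var_eq (by norm_num) (by norm_num)
  have e4 : s.var 4 = (I.size : ℤ) := h.var_eq (by norm_num) (by norm_num)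
  obtain ⟨h1, h2⟩ := h.tab (a := 23) (x := 20) (r := 5) (t := ind (and (read 16 setDem)
    (lt (4 * var 10 * agg false 21 4 (ite memT (read 21 (var 21)) 0))
      (agg false 21 4 (read 21 (var 21)))))) (by decide) (fun i _ => by
        rw [eval_ind]
        split_ifs
        · simpa using one_le_pow₀ (by norm_num : (1 : ℤ) ≤ 2)
        · simp)
  refine ⟨h1, h2, fun c hc => ?_⟩
  have hd : c / (I.P.card + 1) < ds.length := Nat.div_lt_of_lt_mul (by
    rw [mul_comm]; exact hc)
  rw [lightStm, Stm.tab_arr (by rw [e5]; exact_mod_cast hc), eval_ind]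
  refine if_congr ?_ rfl rfl
  have e0 : s.var 0 = I.P.card := h.var_eq (by norm_num) (by norm_num)
  have e1 : setDem.eval (s.setVar 20 c) = ((c / (I.P.card + 1) : ℕ) : ℤ) := by
    simp [setDem, e0]
  have etot : (agg false 21 4 (read 21 (var 21))).eval (s.setVar 20 c) = (I.problem ds).total w := by
    simp only [eval_sum, Store.setVar_var, show (4 : ℕ) ≠ 20 by norm_num, if_false, e4,
      Int.toNat_natCast, HitProblem.total]
    refine Finset.sum_congr rfl fun u hu => ?_
    simpa using h.w_eq u (Finset.mem_range.1 hu)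
  have ewt : (agg false 21 4 (ite memT (read 21 (var 21)) 0)).eval (s.setVar 20 c)
      = (I.problem ds).weight w c := by
    simp only [eval_sum, Store.setVar_var, show (4 : ℕ) ≠ 20 by norm_num, if_false, e4,
      Int.toNat_natCast, HitProblem.weight]
    refine Finset.sum_congr rfl fun u hu => ?_
    rw [eval_ite]
    refine if_congr ?_ ?_ rfl
    · exact memT_pos ((h.known.setVar (by norm_num) _).setVar (by norm_num) _) hc
        (by simp) (by simp)
    · simpa using h.w_eq u (Finset.mem_range.1 hu)
  rw [and_pos, lt_pos, eval_read, e1, eval_mul, ewt, etot, Store.setVar_arr,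
    h.known.2 16 (by decide) _ hd]
  simp only [specArr, HitProblem.Light, Instance.problem, eval_mul, eval_four, eval_var,
    Store.setVar_var, show (10 : ℕ) ≠ 20 by norm_num, if_false, h.K_eq]
  refine and_congr ?_ Iff.rfl
  split_ifs with hne
  · exact ⟨fun _ => hne, fun _ => by norm_num⟩
  · exact ⟨fun h => absurd h (by norm_num), fun h => absurd h hne⟩

theorem abs_ind_le (t : Term) (s : Store) (B : ℕ) : |(ind t).eval s| ≤ 2 ^ B := by
  rw [eval_ind]
  split_ifs
  · simpa using one_le_pow₀ (by norm_num : (1 : ℤ) ≤ 2)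
  · simp

open Classical in
theorem triple_light (B : ℕ) (K : ℤ) (w : ℕ → ℤ) :
    Triple B (Search I ps ds B K w) lightStm fun s => Search I ps ds B K w s ∧
      ∀ c < (I.problem ds).M, s.arr 23 c = if (I.problem ds).Light K w c then 1 else 0 :=
  fun _ h => h.light

theorem triple_step (hw : ∀ u < I.size, |(I.problem ds).step K w u| ≤ 2 ^ B) :
    Triple B (Search I ps ds B K w) stepStm (Search I ps ds B K ((I.problem ds).step K w)) := by
  classical
  refine Triple.seq (triple_light B K w) (Triple.seq (Q := fun s => Search I ps ds B K w s ∧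
      ∀ c < (I.problem ds).M, s.arr 24 c = if (I.problem ds).First K w c then 1 else 0) ?_
    (Triple.seq (Q := fun s => Search I ps ds B K w s ∧
      ∀ u < I.size, s.arr 22 u = (I.problem ds).step K w u) ?_ fun s h => h.1.copy h.2))
  · rintro s ⟨h, h23⟩
    obtain ⟨b1, b2⟩ := h.tab (a := 24) (x := 20) (r := 5)
      (t := ind (and (read 23 (var 20)) (not (agg false 21 20 (read 23 (var 21))))))
      (by decide) (fun i _ => abs_ind_le _ _ _)
    refine ⟨b1, b2, fun c hc => ?_⟩
    have e5 : s.var 5 = ((I.problem ds).M : ℤ) := h.var_eq (by norm_num) (by norm_num)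
    rw [Stm.tab_arr (by rw [e5]; exact_mod_cast hc), eval_ind]
    refine if_congr ?_ rfl rfl
    rw [and_pos, not_pos, eval_sum]
    simp only [eval_read, eval_var, Store.setVar_var, if_true, Store.setVar_arr,
      Int.toNat_natCast, h23 c hc]
    rw [Finset.sum_congr rfl fun c' hc' => h23 c' ((Finset.mem_range.1 hc').trans hc)]
    unfold HitProblem.First
    refine and_congr ?_ ?_
    · split_ifs with hl <;> simp [hl]
    · simp only [Finset.sum_boole, Nat.cast_pos, Finset.card_pos, Finset.not_nonempty_iff_eq_empty,
        Finset.filter_eq_empty_iff, Finset.mem_range]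
  · rintro s ⟨h, h24⟩
    have e4 : s.var 4 = (I.size : ℤ) := h.var_eq (by norm_num) (by norm_num)
    have e5 : s.var 5 = ((I.problem ds).M : ℤ) := h.var_eq (by norm_num) (by norm_num)
    have hval : ∀ u < I.size, (read 21 (var 21) * (1 + agg false 20 5 (ite (read 24 (var 20))
        (ind memT) 0))).eval (s.setVar 21 u) = (I.problem ds).step K w u := by
      intro u hu
      simp only [eval_mul, eval_add, eval_sum, eval_read, eval_var, Store.setVar_var, if_true,
        Store.setVar_arr, eval_one, show (5 : ℕ) ≠ 21 by norm_num, if_false, e5,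
        Int.toNat_natCast, h.w_eq u hu, HitProblem.step]
      congr 2
      refine Finset.sum_congr rfl fun c hc => ?_
      have hc' := Finset.mem_range.1 hc
      have hm := memT_pos (u := u) ((h.known.setVar (x := 21) (by norm_num) u).setVar (x := 20)
        (by norm_num) c) hc' (by simp) (by simp)
      simp only [eval_ite, eval_read, eval_var, Store.setVar_var, if_true, Store.setVar_arr,
        h24 c hc', eval_ind, eval_zero]
      refine if_congr ?_ (if_congr hm rfl rfl) rfl
      split_ifs with hf <;> simp [hf]
    obtain ⟨c1, c2⟩ := h.tab (a := 22) (x := 21) (r := 4)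
      (t := read 21 (var 21) * (1 + agg false 20 5 (ite (read 24 (var 20)) (ind memT) 0)))
      (by decide) (fun i hi => by
        rw [e4] at hi
        have hi' : i < I.size := by exact_mod_cast hi
        rw [hval i hi']
        exact hw i hi')
    exact ⟨c1, c2, fun u hu => by rw [Stm.tab_arr (by rw [e4]; exact_mod_cast hu), hval u hu]⟩

open Classical in
theorem triple_reset (hK : 0 ≤ K) (hKB : K + 1 ≤ B) :
    Triple B (Search I ps ds B K w) resetStm (Search I ps ds B
      (if (I.problem ds).Good K w then K else K + 1)
      (if (I.problem ds).Good K w then w else fun _ => 1)) := by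
  have h1B : (1 : ℤ) ≤ 2 ^ B := one_le_pow₀ (by norm_num)
  set bad : ℤ := if (I.problem ds).Good K w then 0 else 1 with hbad
  refine Triple.seq (triple_light B K w) (Triple.seq
    (Q := fun s => Search I ps ds B K w s ∧ s.var 11 = bad) ?_
    (Triple.seq (Q := fun s => Search I ps ds B (K + bad) w s ∧ s.var 11 = bad) ?_
    (Triple.seq (Q := fun s => Search I ps ds B (K + bad) w s ∧
      ∀ u < I.size, s.arr 22 u = (if (I.problem ds).Good K w then w else fun _ => 1) u) ?_
      fun s h => ?_)))
  · rintro s ⟨h, h23⟩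
    have e5 : s.var 5 = ((I.problem ds).M : ℤ) := h.var_eq (by norm_num) (by norm_num)
    have hval : (ind (agg false 20 5 (read 23 (var 20)))).eval s = bad := by
      rw [eval_ind, eval_sum, e5, Int.toNat_natCast]
      simp only [eval_read, eval_var, Store.setVar_var, if_true, Store.setVar_arr]
      rw [Finset.sum_congr rfl fun c hc => h23 c (Finset.mem_range.1 hc)]
      simp only [Finset.sum_boole, Nat.cast_pos, Finset.card_pos, hbad]
      have : (Finset.filter ((I.problem ds).Light K w) (Finset.range (I.problem ds).M)).Nonempty ↔
          ¬ (I.problem ds).Good K w := by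
        simp only [HitProblem.Good, Finset.Nonempty, Finset.mem_filter, Finset.mem_range]
        push Not
        rfl
      by_cases hg : (I.problem ds).Good K w
      · rw [if_pos hg, if_neg (by rw [this]; simpa using hg)]
      · rw [if_neg hg, if_pos (this.2 hg)]
    have hb : Bdd 50 B ((Stm.set 11 (ind (agg false 20 5 (read 23 (var 20))))).den s) := by
      refine h.bdd.setVar 11 ?_
      rw [hval, hbad]
      split_ifs
      · simp
      · simp; omega
    refine ⟨⟨h.bdd, hb⟩, ⟨h.known.setVar (by norm_num) _, ?_, h.w_eq, hb⟩, ?_⟩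
    · simpa [Stm.den] using h.K_eq
    · simp only [Stm.den, Store.setVar_var, if_true, hval]
  · rintro s ⟨h, h11⟩
    have hval : (var 10 + var 11).eval s = K + bad := by
      simp [h.K_eq, h11]
    have hb : Bdd 50 B ((Stm.set 10 (var 10 + var 11)).den s) := by
      refine h.bdd.setVar 10 ?_
      rw [hval, hbad]
      split_ifs <;> rw [abs_of_nonneg (by omega)] <;> omega
    refine ⟨⟨h.bdd, hb⟩, ⟨h.known.setVar (by norm_num) _, ?_, h.w_eq, hb⟩, ?_⟩
    · simp only [Stm.den, Store.setVar_var, if_true, hval]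
    · simpa [Stm.den] using h11
  · rintro s ⟨h, h11⟩
    have e4 : s.var 4 = (I.size : ℤ) := h.var_eq (by norm_num) (by norm_num)
    have hval : ∀ u < I.size, (ite (var 11) 1 (read 21 (var 21))).eval (s.setVar 21 u)
        = (if (I.problem ds).Good K w then w else fun _ => 1) u := by
      intro u hu
      simp only [eval_ite, eval_var, eval_one, eval_read, Store.setVar_var, Store.setVar_arr,
        if_true, show (11 : ℕ) ≠ 21 by norm_num, if_false, h11, h.w_eq u hu, hbad]
      by_cases hg : (I.problem ds).Good K w <;> simp [hg]
    obtain ⟨c1, c2⟩ := h.tab (a := 22) (x := 21) (r := 4) (t := ite (var 11) 1 (read 21 (var 21)))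
      (by decide) (fun i hi => by
        rw [eval_ite]
        split_ifs
        · simpa using h1B
        · simpa using h.bdd.2 21 i)
    exact ⟨c1, c2, fun u hu => by rw [Stm.tab_arr (by rw [e4]; exact_mod_cast hu), hval u hu]⟩
  · have := h.1.copy h.2
    have e : K + bad = if (I.problem ds).Good K w then K else K + 1 := by
      rw [hbad]; split_ifs <;> simp
    rwa [e] at this

theorem triple_advance {z : ℤ × (ℕ → ℤ)} (hK : 0 ≤ z.1) (hKB : z.1 + 1 ≤ B)
    (hB : (I.problem ds).rounds ≤ B) (hw : ∀ u, 1 ≤ z.2 u ∧ z.2 u ≤ 2 ^ B) :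
    Triple B (Search I ps ds B z.1 z.2) (.seq resetStm (.rep 7 stepStm))
      (Search I ps ds B ((I.problem ds).advance z).1 ((I.problem ds).advance z).2) := by
  classical
  have habs : ∀ {v : ℤ}, 1 ≤ v → v ≤ 2 ^ B → |v| ≤ 2 ^ B := fun h1 h2 => by
    rwa [abs_of_nonneg (by omega)]
  by_cases hg : (I.problem ds).Good z.1 z.2
  · have hr := triple_reset (I := I) (ps := ps) (ds := ds) (w := z.2) hK hKB
    simp only [if_pos hg] at hr
    simp only [HitProblem.advance, if_pos hg]
    refine Triple.seq hr (Triple.rep (n := (I.problem ds).rounds)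
      (P := fun _ => Search I ps ds B z.1 z.2)
      (fun s h => ⟨h.bdd, h.var_eq (by norm_num) (by norm_num)⟩) fun i _ => ?_)
    have hst := triple_step (I := I) (ps := ps) (ds := ds) (B := B) (K := z.1) (w := z.2) (by
      rw [HitProblem.step_of_good hg]
      exact fun u _ => habs (hw u).1 (hw u).2)
    rwa [HitProblem.step_of_good hg] at hst
  · have hr := triple_reset (I := I) (ps := ps) (ds := ds) (w := z.2) hK hKB
    simp only [if_neg hg] at hr
    simp only [HitProblem.advance, if_neg hg]
    refine Triple.seq hr (Triple.rep (n := (I.problem ds).rounds)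
      (P := fun i => Search I ps ds B (z.1 + 1)
        (((I.problem ds).step (z.1 + 1))^[i] fun _ => 1))
      (fun s h => ⟨h.bdd, h.var_eq (by norm_num) (by norm_num)⟩) fun i hi => ?_)
    rw [Function.iterate_succ_apply']
    refine triple_step fun u _ => ?_
    rw [← Function.iterate_succ_apply' ((I.problem ds).step (z.1 + 1))]
    have := HitProblem.iterate_step_bounds (X := I.problem ds) (K := z.1 + 1) (i + 1) u
    exact habs this.1 (this.2.trans (pow_le_pow_right₀ (by norm_num) (by omega)))

theorem triple_search (hB : (I.problem ds).rounds ≤ B) (hB' : I.size + 1 ≤ B) :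
    Triple B (Search I ps ds B 0 fun _ => 1) searchStm
      (Search I ps ds B ((I.problem ds).advance^[I.size + 1] (0, fun _ => 1)).1
        ((I.problem ds).advance^[I.size + 1] (0, fun _ => 1)).2) := by
  refine Triple.rep (n := I.size + 1)
    (P := fun i => Search I ps ds B ((I.problem ds).advance^[i] (0, fun _ => 1)).1
        ((I.problem ds).advance^[i] (0, fun _ => 1)).2)
    (fun s h => ⟨h.bdd, h.var_eq (by norm_num) (by norm_num)⟩) fun i hi => ?_
  rw [Function.iterate_succ_apply']
  obtain ⟨h1, h2, h3⟩ := HitProblem.advance_bounds (X := I.problem ds) i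
  refine triple_advance h1 (by omega) hB fun u => ⟨(h3 u).1, (h3 u).2.trans ?_⟩
  exact pow_le_pow_right₀ (by norm_num) hB

end Algo

namespace Algo

open Term Instance

variable (I : Instance) (ds : List ((ℤ × ℤ) × (ℤ × ℤ)))

/-- The demand of a slot. -/
def demandOf (z : ℕ) : (ℤ × ℤ) × (ℤ × ℤ) := ds.getD ((z - I.size * I.depth) / 2) 0

/-- The rank of the column of a slot. -/
def slotRank (z : ℕ) : ℕ :=
  if z < I.size * I.depth then I.boundary (z / I.depth) (z % I.depth)
  else if (z - I.size * I.depth) % 2 = 0 then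
    (strip I.depth (I.lev (demandOf I ds z)) (I.lrank (demandOf I ds z)) + 1)
      * 2 ^ (I.depth * I.lev (demandOf I ds z))
  else strip I.depth (I.lev (demandOf I ds z)) (I.rrank (demandOf I ds z))
      * 2 ^ (I.depth * I.lev (demandOf I ds z))

/-- The slot contributes a point to the output. -/
def SlotValid (K : ℤ) (w : ℕ → ℤ) (z : ℕ) : Prop :=
  if z < I.size * I.depth then Jump I.size K w (z / I.depth) ∧ slotRank I ds z < I.P.card
  else (demandOf I ds z).1 ≠ (demandOf I ds z).2

/-- The second coordinate of the point of a slot. -/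
noncomputable def slotRow (z : ℕ) : ℤ :=
  if z < I.size * I.depth then
    I.coord Prod.snd (I.flip (I.idxOri (z / I.depth)) (z / I.depth % I.P.card))
  else if (z - I.size * I.depth) % 2 = 0 then (left (demandOf I ds z)).2
  else (right (demandOf I ds z)).2

variable {I ds} {ps : List (ℤ × ℤ)} {B : ℕ} {K : ℤ} {w : ℕ → ℤ} {s : Store}

theorem demandOf_mem (hl : I.ListedBy ps ds) {z : ℕ} (hz : z < I.size * I.depth + 2 * ds.length)
    (hzi : ¬ z < I.size * I.depth) : demandOf I ds z ∈ I.D := hl.getD_mem (by omega)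

theorem slotRank_lt (hl : I.ListedBy ps ds) {z : ℕ}
    (hz : z < I.size * I.depth + 2 * ds.length) (hv : SlotValid I ds K w z) :
    slotRank I ds z < I.P.card := by
  unfold SlotValid at hv
  split_ifs at hv with hzi
  · exact hv.2
  · have hd := demandOf_mem hl hz hzi
    obtain ⟨h1, h2, h3⟩ := lev_spec hd hv
    have h4 := rrank_lt hd
    have h5 : strip I.depth (I.lev (demandOf I ds z)) (I.rrank (demandOf I ds z))
      * 2 ^ (I.depth * I.lev (demandOf I ds z)) ≤ I.rrank (demandOf I ds z) :=
      Nat.div_mul_le_self _ _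
    rw [slotRank, if_neg hzi]
    split_ifs
    · refine lt_of_le_of_lt ?_ h4
      refine le_trans ?_ h5
      gcongr
      exact h2
    · exact h5.trans_lt h4

theorem lev_lt_specLen (d : (ℤ × ℤ) × (ℤ × ℤ)) : I.lev d < specLen I ds 26 := by
  have : I.lev d ≤ I.depth := by
    unfold Instance.lev Instance.level
    exact (Finset.card_filter_le _ _).trans (by simp)
  exact Nat.lt_succ_of_le this

/-- The values of the terms that decompose the number of a slot. -/
theorem eval_slot (h : Known I ps ds preparedArrays s) {z : ℕ} (h20 : s.var 20 = z) :
    slotIdx.eval s = ((z / I.depth : ℕ) : ℤ) ∧ slotBit.eval s = ((z % I.depth : ℕ) : ℤ) ∧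
    (0 < isIdx.eval s ↔ z < I.size * I.depth) ∧
    slotLevel.eval s = (I.idxLevel (z / I.depth) : ℤ) ∧
    (mod (slotIdx / var 0) (var 0)).eval s = (I.idxStrip (z / I.depth) : ℤ) ∧
    (mod slotSide 2).eval s = (I.idxSide (z / I.depth) : ℤ) ∧
    (slotSide / 2).eval s = (I.idxOri (z / I.depth) : ℤ) ∧
    (¬ z < I.size * I.depth →
      slotDem.eval s = (((z - I.size * I.depth) / 2 : ℕ) : ℤ) ∧
      (0 < isLeft.eval s ↔ (z - I.size * I.depth) % 2 = 0)) := by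
  have e0 : s.var 0 = I.P.card := h.1 0 (by norm_num) (by norm_num)
  have e3 : s.var 3 = I.depth := h.1 3 (by norm_num) (by norm_num)
  have e4 : s.var 4 = I.size := h.1 4 (by norm_num) (by norm_num)
  refine ⟨?_, ?_, ?_, ?_, ?_, ?_, ?_, fun hz => ⟨?_, ?_⟩⟩
  · simp [slotIdx, h20, e3]
  · simp [slotBit, h20, e3]
  · simp only [isIdx, lt_pos, eval_mul, eval_var, h20, e3, e4]
    norm_cast
  · simp [slotLevel, slotIdx, h20, e0, e3, idxLevel]
  · simp [slotIdx, h20, e0, e3, idxStrip]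
  · simp [slotSide, slotIdx, h20, e0, e3, idxSide]
  · simp [slotSide, slotIdx, h20, e0, e3, idxOri]
  · simp only [slotDem, eval_div, eval_sub, eval_mul, eval_var, h20, e3, e4, eval_two]
    push_cast [Nat.cast_sub (not_lt.1 hz)]
    rfl
  · simp only [isLeft, eq_pos, eval_mod, eval_sub, eval_mul, eval_var, h20, e3, e4, eval_two,
      eval_zero]
    zify [not_lt.1 hz]

theorem idxOri_lt {u : ℕ} (hu : u < I.size) : I.idxOri u < 2 := by
  unfold idxOri
  rw [Nat.div_div_eq_div_mul, Nat.div_div_eq_div_mul, Nat.div_div_eq_div_mul]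
  refine Nat.div_lt_of_lt_mul (hu.trans_eq ?_)
  unfold size
  ring

theorem eval_columnT (h : Known I ps ds preparedArrays s) {z : ℕ} (h20 : s.var 20 = z)
    (hz : z < I.size * I.depth + 2 * ds.length) : columnT.eval s = slotRank I ds z := by
  obtain ⟨a1, a2, a3, a4, a5, a6, a7, a8⟩ := eval_slot h h20
  rw [columnT, slotRank, eval_ite]
  by_cases hzi : z < I.size * I.depth
  · have hd : 0 < I.depth := by
      rcases Nat.eq_zero_or_pos I.depth with h0 | h0
      · simp [h0] at hzi
      · exact h0
    have b1 : z % I.depth < specLen I ds 27 := (Nat.mod_lt _ hd).trans (Nat.lt_succ_self _)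
    have b2 : I.idxLevel (z / I.depth) < specLen I ds 26 :=
      (Nat.mod_lt _ hd).trans (Nat.lt_succ_self _)
    have b3 : I.idxSide (z / I.depth) ≤ 1 := by unfold idxSide; omega
    rw [if_pos (a3.2 hzi), if_pos hzi, eval_mul, eval_mul, eval_add, eval_sub, eval_div, a5, a6,
      eval_read, eval_read, a2, a4, h.2 27 (by decide) _ b1, h.2 26 (by decide) _ b2, eval_one]
    simp only [specArr, boundary, pow_add]
    push_cast [Nat.cast_sub b3]
    rfl
  · obtain ⟨c1, c2⟩ := a8 hzi
    have he : (z - I.size * I.depth) / 2 < ds.length := by omega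
    have e13 : (read 13 slotDem).eval s = (I.lev (demandOf I ds z) : ℤ) := by
      rw [eval_read, c1, h.2 13 (by decide) _ he]; rfl
    have e26 : (read 26 (read 13 slotDem)).eval s
        = ((2 ^ (I.depth * I.lev (demandOf I ds z)) : ℕ) : ℤ) := by
      rw [eval_read, e13, h.2 26 (by decide) _ (lev_lt_specLen _)]
      simp [specArr]
    have e8 : (read 8 slotDem).eval s = (I.lrank (demandOf I ds z) : ℤ) := by
      rw [eval_read, c1, h.2 8 (by decide) _ he]; rfl
    have e9 : (read 9 slotDem).eval s = (I.rrank (demandOf I ds z) : ℤ) := by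
      rw [eval_read, c1, h.2 9 (by decide) _ he]; rfl
    rw [if_neg (by rwa [a3]), if_neg hzi, eval_ite, eval_mul, eval_mul, eval_add, eval_div,
      eval_div, e26, e8, e9, eval_one]
    by_cases hp : (z - I.size * I.depth) % 2 = 0
    · rw [if_pos (c2.2 hp), if_pos hp]
      simp [strip]
    · rw [if_neg (by rwa [c2]), if_neg hp]
      simp [strip]

open Classical in
theorem Search.output (h : Search I ps ds B K w s) (hl : I.ListedBy ps ds) :
    (∀ z < I.size * I.depth + 2 * ds.length,
      ((outputStm.den s).arr 6 (z : ℤ), (outputStm.den s).arr 7 (z : ℤ)) =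
        if SlotValid I ds K w z then (I.coord Prod.fst (slotRank I ds z), slotRow I ds z)
        else 0) ∧
    (outputStm.den s).var 2 =
      if ∃ d ∈ I.D, d.1 ≠ d.2 then ((I.size * I.depth + 2 * ds.length : ℕ) : ℤ) else 0 := by
  have e0 : s.var 0 = I.P.card := h.var_eq (by norm_num) (by norm_num)
  have e1 : s.var 1 = ds.length := h.var_eq (by norm_num) (by norm_num)
  have e4 : s.var 4 = (I.size : ℤ) := h.var_eq (by norm_num) (by norm_num)
  have e8 : s.var 8 = ((I.size * I.depth + 2 * ds.length : ℕ) : ℤ) := by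
    rw [h.var_eq (by norm_num) (by norm_num)]; simp [specVar]
  have hz8 : ∀ {z : ℕ}, z < I.size * I.depth + 2 * ds.length → (z : ℤ) < s.var 8 := fun hz => by
    rw [e8]; exact_mod_cast hz
  set s₁ := (Stm.tab 25 21 4 (ind (lt
    (8 * var 10 * agg false 22 21 (read 21 (var 22)) / agg false 22 4 (read 21 (var 22)))
    (8 * var 10 * (agg false 22 21 (read 21 (var 22)) + read 21 (var 21))
      / agg false 22 4 (read 21 (var 22)))))).den s with hs₁
  set s₂ := (Stm.tab 28 20 8 columnT).den s₁ with hs₂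
  set s₃ := (Stm.tab 29 20 8 (ite isIdx
    (ind (and (read 25 slotIdx) (lt (read 28 (var 20)) (var 0))))
    (read 16 slotDem))).den s₂ with hs₃
  set s₄ := (Stm.tab 6 20 8 (ite (read 29 (var 20)) (read 19 (read 28 (var 20))) 0)).den s₃ with hs₄
  set s₅ := (Stm.tab 7 20 8 (ite (read 29 (var 20)) rowT 0)).den s₄ with hs₅
  have hout : outputStm.den s
      = (Stm.set 2 (ite (agg false 20 1 (read 16 (var 20))) (var 8) 0)).den s₅ := rfl
  have k1 : Known I ps ds preparedArrays s₁ := h.known.tab_ne (by decide)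
  have k2 : Known I ps ds preparedArrays s₂ := k1.tab_ne (by decide)
  have k3 : Known I ps ds preparedArrays s₃ := k2.tab_ne (by decide)
  have k4 : Known I ps ds preparedArrays s₄ := k3.tab_ne (by decide)
  have k5 : Known I ps ds preparedArrays s₅ := k4.tab_ne (by decide)
  have hsum : ∀ m ≤ I.size, ∑ v ∈ Finset.range m, s.arr 21 (v : ℤ) = ∑ v ∈ Finset.range m, w v :=
    fun m hm => Finset.sum_congr rfl fun v hv => h.w_eq v ((Finset.mem_range.1 hv).trans_le hm)
  have a25 : ∀ u < I.size, s₁.arr 25 u = if Jump I.size K w u then 1 else 0 := by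
    intro u hu
    rw [hs₁, Stm.tab_arr (by rw [e4]; exact_mod_cast hu), eval_ind]
    refine if_congr ?_ rfl rfl
    simp only [lt_pos, eval_div, eval_mul, eval_add, eval_sum, eval_eight, eval_read, eval_var,
      Store.setVar_var, Store.setVar_arr, if_true, show (10 : ℕ) ≠ 21 by norm_num,
      show (4 : ℕ) ≠ 21 by norm_num, if_false, h.K_eq, e4, Int.toNat_natCast, hsum u hu.le,
      hsum _ le_rfl, h.w_eq u hu]
    rw [Jump, Finset.sum_range_succ _ u]
  have a28 : ∀ z < I.size * I.depth + 2 * ds.length, s₂.arr 28 z = slotRank I ds z := by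
    intro z hz
    rw [hs₂, Stm.tab_arr (s := s₁) (hz8 hz)]
    exact eval_columnT (k1.setVar (by norm_num) _) (by simp) hz
  have a25' : s₂.arr 25 = s₁.arr 25 := Stm.tab_arr_ne (by norm_num)
  have a29 : ∀ z < I.size * I.depth + 2 * ds.length,
      (0 < s₃.arr 29 z ↔ SlotValid I ds K w z) := by
    intro z hz
    obtain ⟨a1, a2, a3, a4, a5, a6, a7, a8⟩ :=
      eval_slot (z := z) (k2.setVar (x := 20) (by norm_num) z) (by simp)
    rw [hs₃, Stm.tab_arr (s := s₂) (hz8 hz), eval_ite, SlotValid]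
    by_cases hzi : z < I.size * I.depth
    · have hu : z / I.depth < I.size := Nat.div_lt_of_lt_mul (by rwa [mul_comm])
      rw [if_pos (a3.2 hzi), if_pos hzi, eval_ind]
      simp only [and_pos, lt_pos, eval_read, a1, eval_var, Store.setVar_var, Store.setVar_arr,
        if_true, show (0 : ℕ) ≠ 20 by norm_num, if_false, a25', a25 _ hu, a28 z hz,
        show s₂.var 0 = I.P.card from e0, Nat.cast_lt]
      by_cases hj : Jump I.size K w (z / I.depth) <;>
        by_cases hr : slotRank I ds z < I.P.card <;> simp [hj, hr]
    · obtain ⟨c1, c2⟩ := a8 hzi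
      have he : (z - I.size * I.depth) / 2 < ds.length := by omega
      rw [if_neg (by rwa [a3]), if_neg hzi, eval_read, c1, Store.setVar_arr,
        k2.2 16 (by decide) _ he]
      show 0 < (if (demandOf I ds z).1 ≠ (demandOf I ds z).2 then (1 : ℤ) else 0) ↔ _
      by_cases hne : (demandOf I ds z).1 = (demandOf I ds z).2 <;> simp [hne]
  have b28 : s₃.arr 28 = s₂.arr 28 := Stm.tab_arr_ne (by norm_num)
  have b29 : s₄.arr 29 = s₃.arr 29 := Stm.tab_arr_ne (by norm_num)
  refine ⟨fun z hz => ?_, ?_⟩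
  · have c6 : (outputStm.den s).arr 6 z
        = if SlotValid I ds K w z then I.coord Prod.fst (slotRank I ds z) else 0 := by
      have : (outputStm.den s).arr 6 = s₄.arr 6 := by
        show s₅.arr 6 = s₄.arr 6
        exact Stm.tab_arr_ne (by norm_num)
      rw [this, hs₄, Stm.tab_arr (s := s₃) (hz8 hz), eval_ite]
      by_cases hv : SlotValid I ds K w z
      · rw [if_pos (by simpa using (a29 z hz).2 hv), if_pos hv]
        simp only [eval_read, eval_var, Store.setVar_var, Store.setVar_arr, if_true, b28, a28 z hz]
        exact k3.2 19 (by decide) _ (slotRank_lt hl hz hv)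
      · rw [if_neg (by simpa using mt (a29 z hz).1 hv), if_neg hv, eval_zero]
    have c7 : (outputStm.den s).arr 7 z = if SlotValid I ds K w z then slotRow I ds z else 0 := by
      have : (outputStm.den s).arr 7 = s₅.arr 7 := by rw [hout]; rfl
      rw [this, hs₅, Stm.tab_arr (s := s₄) (hz8 hz), eval_ite]
      by_cases hv : SlotValid I ds K w z
      · rw [if_pos (by simpa [b29] using (a29 z hz).2 hv), if_pos hv]
        obtain ⟨a1, a2, a3, a4, a5, a6, a7, a8⟩ :=
          eval_slot (z := z) (k4.setVar (x := 20) (by norm_num) z) (by simp)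
        rw [rowT, eval_ite, slotRow]
        by_cases hzi : z < I.size * I.depth
        · have hu : z / I.depth < I.size := Nat.div_lt_of_lt_mul (by rwa [mul_comm])
          have ho := idxOri_lt hu
          have hP : 0 < I.P.card := by
            rcases Nat.eq_zero_or_pos I.P.card with h0 | h0
            · simp [Instance.size, h0] at hzi
            · exact h0
          have hm := Nat.mod_lt (z / I.depth) hP
          have hflip : (Term.ite (slotSide / 2) (var 0 - 1 - mod slotIdx (var 0))
              (mod slotIdx (var 0))).eval (s₄.setVar 20 z)
              = (I.flip (I.idxOri (z / I.depth)) (z / I.depth % I.P.card) : ℤ) := by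
            rw [eval_ite, a7, eval_sub, eval_sub, eval_mod, a1]
            simp only [eval_var, Store.setVar_var, show (0 : ℕ) ≠ 20 by norm_num, if_false,
              show s₄.var 0 = I.P.card from e0, eval_one, Instance.flip]
            rw [← Int.natCast_mod]
            generalize z / I.depth % I.P.card = m at hm ⊢
            split_ifs <;> omega
          rw [if_pos (a3.2 hzi), if_pos hzi, eval_read, hflip]
          exact k4.2 20 (by decide) _ (flip_lt hm)
        · obtain ⟨c1, c2⟩ := a8 hzi
          have he : (z - I.size * I.depth) / 2 < ds.length := by omega
          rw [if_neg (by rwa [a3]), if_neg hzi, eval_ite, eval_read, eval_read, c1,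
            Store.setVar_arr, k4.2 17 (by decide) _ he, k4.2 18 (by decide) _ he]
          exact if_congr c2 rfl rfl
      · rw [if_neg (by simpa [b29] using mt (a29 z hz).1 hv), if_neg hv, eval_zero]
    rw [c6, c7]
    split_ifs <;> rfl
  · rw [hout]
    simp only [Stm.den, Store.setVar_var, if_true, eval_ite, eval_var, eval_zero, eval_sum,
      eval_read, Store.setVar_arr, show s₅.var 1 = ds.length from e1, Int.toNat_natCast,
      show s₅.var 8 = _ from e8]
    rw [Finset.sum_congr (s₁ := Finset.range ds.length) rfl fun i hi =>
      k5.2 16 (by decide) i (Finset.mem_range.1 hi)]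
    refine if_congr ?_ rfl rfl
    show 0 < ∑ i ∈ Finset.range ds.length,
      (if (ds.getD i 0).1 ≠ (ds.getD i 0).2 then (1 : ℤ) else 0) ↔ _
    simp only [Finset.sum_boole, Nat.cast_pos, Finset.card_pos, Finset.Nonempty,
      Finset.mem_filter, Finset.mem_range]
    constructor
    · rintro ⟨i, hi, hne⟩
      exact ⟨_, hl.getD_mem hi, hne⟩
    · rintro ⟨d, hd, hne⟩
      obtain ⟨e, he, hde⟩ := List.getElem_of_mem ((hl.mem_demands d).2 hd)
      exact ⟨e, he, by rw [List.getD_eq_getElem _ _ he, hde]; exact hne⟩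

end Algo

theorem arrayOf_map {α : Type*} [Zero α] (l : List α) (f : α → ℤ) {i : ℕ} (hi : i < l.length) :
    arrayOf (l.map f) i = f (l.getD i 0) := by
  simp [arrayOf, hi]

theorem abs_le_two_pow_bitLength (x : ℤ) : |x| ≤ 2 ^ bitLength x := by
  have h := (Nat.lt_size_self x.natAbs).le
  rw [Int.abs_eq_natAbs]
  calc (x.natAbs : ℤ) ≤ 2 ^ Nat.size x.natAbs := by exact_mod_cast h
    _ ≤ _ := pow_le_pow_right₀ (by norm_num) (by simp [bitLength])

theorem abs_arrayOf_map_le {α : Type*} {l : List α} {f : α → ℤ} {g : α → ℕ} {B : ℕ}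
    (hg : ∀ x, bitLength (f x) ≤ g x) (hB : (l.map g).sum ≤ B) (i : ℤ) :
    |arrayOf (l.map f) i| ≤ 2 ^ B := by
  have hzero : |(0 : ℤ)| ≤ 2 ^ B := by simp
  unfold arrayOf
  split_ifs
  · rcases Nat.lt_or_ge i.toNat (l.map f).length with hi | hi
    · rw [List.getD_eq_getElem _ _ hi]
      obtain ⟨x, hx, hfx⟩ := List.mem_map.1 (List.getElem_mem hi)
      rw [← hfx]
      refine (abs_le_two_pow_bitLength _).trans (pow_le_pow_right₀ (by norm_num) ?_)
      exact (hg x).trans ((List.le_sum_of_mem (List.mem_map_of_mem hx)).trans hB)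
    · rwa [List.getD_eq_default _ _ hi]
  · exact hzero

theorem length_le_sum_map {α : Type*} (l : List α) {g : α → ℕ} (hg : ∀ x, 1 ≤ g x) :
    l.length ≤ (l.map g).sum := by
  induction l with
  | nil => simp
  | cons a l ih =>
    have := hg a
    simp only [List.length_cons, List.map_cons, List.sum_cons]
    omega

theorem bdd_inputStore (ps : List (ℤ × ℤ)) (ds : List ((ℤ × ℤ) × (ℤ × ℤ))) :
    Bdd 50 (inputSize ps ds) (inputStore ps ds) := by
  have hp := length_le_sum_map ps (g := fun p => bitLength p.1 + bitLength p.2) fun p => by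
    simp only [bitLength]; omega
  have hd := length_le_sum_map ds (g := fun d => bitLength d.1.1 + bitLength d.1.2
    + bitLength d.2.1 + bitLength d.2.2) fun d => by simp only [bitLength]; omega
  have hpB : (ps.map fun p => bitLength p.1 + bitLength p.2).sum ≤ inputSize ps ds := by
    unfold inputSize; omega
  have hdB : (ds.map fun d => bitLength d.1.1 + bitLength d.1.2 + bitLength d.2.1
      + bitLength d.2.2).sum ≤ inputSize ps ds := by
    unfold inputSize; omega
  refine ⟨fun x _ => ?_, fun a i => ?_⟩
  · match x with
    | 0 => simpa [inputStore] using hp.trans hpB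
    | 1 => simpa [inputStore] using hd.trans hdB
    | x + 2 => simp [inputStore]
  · match a with
    | 0 => exact abs_arrayOf_map_le (fun p => by omega) hpB i
    | 1 => exact abs_arrayOf_map_le (fun p => by omega) hpB i
    | 2 => exact abs_arrayOf_map_le (fun d => by omega) hdB i
    | 3 => exact abs_arrayOf_map_le (fun d => by omega) hdB i
    | 4 => exact abs_arrayOf_map_le (fun d => by omega) hdB i
    | 5 => exact abs_arrayOf_map_le (fun d => by omega) hdB i
    | a + 6 => simp [inputStore]

/-- Without demands between distinct points, every set is feasible. -/
theorem Instance.feasible_of_trivial {I : Instance} (h : ¬ ∃ d ∈ I.D, d.1 ≠ d.2)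
    (Q : Set (ℝ × ℝ)) : I.Feasible Q := by
  intro d hd
  have hne : d.1 = d.2 := by
    by_contra hne
    exact h ⟨d, hd, hne⟩
  refine ⟨0, fun _ => toPlane d.1, rfl, by rw [hne], fun i _ => ?_, by simp, ?_⟩
  · exact Or.inl ⟨d.1, (I.demand_mem d hd).1, rfl⟩
  · simp [hne, l1Dist]

theorem Instance.exists_feasible (I : Instance) :
    ∃ Q : Finset (ℝ × ℝ), I.Feasible (Q : Set (ℝ × ℝ)) := by
  classical
  refine ⟨I.D.image fun d => toPlane (d.1.1, d.2.2), fun d hd => ?_⟩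
  refine ⟨2, fun i => [toPlane d.1, toPlane (d.1.1, d.2.2), toPlane d.2].getD i 0, rfl, rfl,
    fun i hi => ?_, fun i hi => ?_, ?_⟩
  · interval_cases i
    · exact Or.inl ⟨d.1, (I.demand_mem d hd).1, rfl⟩
    · exact Or.inr (by simpa using ⟨_, _, _, _, hd, rfl⟩)
    · exact Or.inl ⟨d.2, (I.demand_mem d hd).2, rfl⟩
  · interval_cases i <;> simp [Aligned, toPlane]
  · simp [Finset.sum_range_succ, l1Dist, toPlane, add_comm]

/-- A feasible set gives a small hitting set. -/
theorem Instance.exists_hitting_problem {I : Instance} {ps : List (ℤ × ℤ)}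
    {ds : List ((ℤ × ℤ) × (ℤ × ℤ))} (hl : I.ListedBy ps ds) {Q : Finset (ℝ × ℝ)}
    (hQ : I.Feasible (Q : Set (ℝ × ℝ))) :
    ∃ H ⊆ Finset.range (I.problem ds).N, H.card ≤ 8 * Q.card ∧
      ∀ c < (I.problem ds).M, (I.problem ds).act c → ∃ u ∈ H, (I.problem ds).mem c u := by
  obtain ⟨H, hH, hcard, hhit⟩ := exists_hitting hQ
  refine ⟨H, hH, hcard, fun c hc hact => ?_⟩
  have hd : c / (I.P.card + 1) < ds.length := Nat.div_lt_of_lt_mul (by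
    rw [mul_comm]; exact hc)
  obtain ⟨v, v', h1, h2, h3, h4, h5⟩ := hhit _ (hl.getD_mem hd) hact
  rcases Nat.lt_or_ge v (c % (I.P.card + 1)) with h | h
  · exact ⟨_, h4, Or.inl ⟨by omega, by omega⟩⟩
  · exact ⟨_, h5, Or.inr ⟨by omega, by omega⟩⟩

namespace Algo

open Term Instance

variable {I : Instance} {ps : List (ℤ × ℤ)} {ds : List ((ℤ × ℤ) × (ℤ × ℤ))} {B : ℕ} {K : ℤ}
  {w : ℕ → ℤ} {s : Store}

theorem search_prepare (hl : I.ListedBy ps ds) (hb : Bdd 50 B (prepareStm.den (inputStore ps ds))) :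
    Search I ps ds B 0 (fun _ => 1) (prepareStm.den (inputStore ps ds)) := by
  obtain ⟨k1, h10⟩ := known_sizes (I := I) (ps := ps) (ds := ds) (s := inputStore ps ds)
    (L := inputArrays) (by simp [inputStore, hl.length_points]) rfl (by
      intro a ha i hi
      simp only [inputArrays, List.mem_cons, List.not_mem_nil, or_false] at ha
      rcases ha with rfl | rfl | rfl | rfl | rfl | rfl
      · exact arrayOf_map ps _ (by rw [hl.length_points]; exact hi)
      · exact arrayOf_map ps _ (by rw [hl.length_points]; exact hi)
      · exact arrayOf_map ds (fun d => d.1.1) hi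
      · exact arrayOf_map ds (fun d => d.1.2) hi
      · exact arrayOf_map ds (fun d => d.2.1) hi
      · exact arrayOf_map ds (fun d => d.2.2) hi)
  have k2 := k1.coords hl (by decide) (by decide)
  have k3 := k2.demands hl (by decide) (by decide) (by decide) (by decide) (by decide) (by decide)
    (by decide)
  refine ⟨k3.tab_ne (a := 21) (x := 21) (r := 4) (t := 1) (by decide), h10, fun u hu => ?_, hb⟩
  refine Stm.tab_arr (s := demandsStm.den (coordsStm.den (sizesStm.den (inputStore ps ds)))) ?_
  rw [k3.1 4 (by norm_num) (by norm_num)]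
  exact Nat.cast_lt.2 hu

/-- The output of a good state of the search. -/
theorem Search.correct (h : Search I ps ds B K w s) (hl : I.ListedBy ps ds) (hK : 0 ≤ K)
    (hw : ∀ u, 1 ≤ w u) (hgood : (I.problem ds).Good K w)
    (hKQ : ∀ Q : Finset (ℝ × ℝ), I.Feasible (Q : Set (ℝ × ℝ)) → K ≤ 8 * Q.card) :
    I.Feasible (toPlane '' (outputPoints (outputStm.den s) : Set (ℤ × ℤ))) ∧
      ((outputPoints (outputStm.den s)).card : ℝ)
        ≤ 207 * √(Real.log I.P.card) * (I.opt : ℝ) := by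
  classical
  obtain ⟨hval, h2⟩ := h.output hl
  by_cases hne : ∃ d ∈ I.D, d.1 ≠ d.2
  · rw [if_pos hne] at h2
    have hmem : ∀ p, p ∈ outputPoints (outputStm.den s) ↔
        ∃ z < I.size * I.depth + 2 * ds.length, (if SlotValid I ds K w z then
          (I.coord Prod.fst (slotRank I ds z), slotRow I ds z) else 0) = p := by
      intro p
      simp only [outputPoints, h2, Int.toNat_natCast, Finset.mem_image, Finset.mem_range]
      exact exists_congr fun z => and_congr_right fun hz => by rw [hval z hz]
    have hfeas : I.Feasible (toPlane '' (outputPoints (outputStm.den s) : Set (ℤ × ℤ))) := by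
      refine feasible_of_good hl.mem_demands hK hw hgood (fun u hu hJ j hj hbd => ?_)
        fun d hd hdne => ?_
      · have hz : u * I.depth + j < I.size * I.depth := by nlinarith
        have hz1 : (u * I.depth + j) / I.depth = u := by
          rw [mul_comm, Nat.mul_add_div (by omega), Nat.div_eq_of_lt hj, add_zero]
        have hz2 : (u * I.depth + j) % I.depth = j := by
          rw [mul_comm, Nat.mul_add_mod, Nat.mod_eq_of_lt hj]
        refine (hmem _).2 ⟨u * I.depth + j, by omega, ?_⟩
        have hr : slotRank I ds (u * I.depth + j) = I.boundary u j := by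
          rw [slotRank, if_pos hz, hz1, hz2]
        rw [if_pos (by rw [SlotValid, if_pos hz, hz1, hr]; exact ⟨hJ, hbd⟩), hr, slotRow,
          if_pos hz, hz1]
        rfl
      · obtain ⟨e, he, hde⟩ := List.getElem_of_mem ((hl.mem_demands d).2 hd)
        have hget : ds.getD e 0 = d := by rw [List.getD_eq_getElem _ _ he, hde]
        refine ⟨(hmem _).2 ⟨I.size * I.depth + 2 * e, by omega, ?_⟩,
          (hmem _).2 ⟨I.size * I.depth + (2 * e + 1), by omega, ?_⟩⟩
        · have hdem : demandOf I ds (I.size * I.depth + 2 * e) = d := by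
            rw [demandOf, Nat.add_sub_cancel_left, Nat.mul_div_cancel_left _ (by norm_num), hget]
          have hn : ¬ I.size * I.depth + 2 * e < I.size * I.depth := by omega
          have hp : (I.size * I.depth + 2 * e - I.size * I.depth) % 2 = 0 := by omega
          rw [if_pos (by rw [SlotValid, if_neg hn, hdem]; exact hdne), slotRank, slotRow,
            if_neg hn, if_neg hn, if_pos hp, if_pos hp, hdem]
          rfl
        · have hdem : demandOf I ds (I.size * I.depth + (2 * e + 1)) = d := by
            rw [demandOf, Nat.add_sub_cancel_left, show (2 * e + 1) / 2 = e by omega, hget]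
          have hn : ¬ I.size * I.depth + (2 * e + 1) < I.size * I.depth := by omega
          have hp : ¬ (I.size * I.depth + (2 * e + 1) - I.size * I.depth) % 2 = 0 := by omega
          rw [if_pos (by rw [SlotValid, if_neg hn, hdem]; exact hdne), slotRank, slotRow,
            if_neg hn, if_neg hn, if_neg hp, if_neg hp, hdem]
          rfl
    refine ⟨hfeas, card_le_opt hK hw hKQ (fun p hp => ?_) hfeas fun _ => hne⟩
    obtain ⟨z, hz, rfl⟩ := (hmem p).1 hp
    split_ifs with hv
    · right
      by_cases hzi : z < I.size * I.depth
      · rw [SlotValid, if_pos hzi] at hv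
        have hd : 0 < I.depth := by
          rcases Nat.eq_zero_or_pos I.depth with h0 | h0
          · simp [h0] at hzi
          · exact h0
        refine Or.inl ⟨z / I.depth, Nat.div_lt_of_lt_mul (by rwa [mul_comm]), hv.1, z % I.depth,
          Nat.mod_lt _ hd, ?_⟩
        rw [slotRank, slotRow, if_pos hzi, if_pos hzi]
        rfl
      · rw [SlotValid, if_neg hzi] at hv
        refine Or.inr ⟨_, demandOf_mem hl hz hzi, hv, ?_⟩
        rw [slotRank, slotRow, if_neg hzi, if_neg hzi]
        split_ifs
        · exact Or.inl rfl
        · exact Or.inr rfl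
    · exact Or.inl rfl
  · rw [if_neg hne] at h2
    have hempty : outputPoints (outputStm.den s) = ∅ := by simp [outputPoints, h2]
    refine ⟨feasible_of_trivial hne _, ?_⟩
    rw [hempty]
    simp
    positivity

theorem isPolyTimeApproximation : IsPolyTimeApproximation (algorithm.comp 50)
    fun n : ℕ => 207 * √(Real.log n) := by
  obtain ⟨p, hp⟩ := Stm.exec algorithm algorithm_wf
  obtain ⟨q, hq⟩ := prepare_tame
  obtain ⟨q', hq'⟩ := output_tame
  refine ⟨p.comp (q'.comp q), fun I ps ds hl => ?_⟩
  set B := q.eval (inputSize ps ds) with hB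
  obtain ⟨-, hsafe, hbdd⟩ := hq _ _ (bdd_inputStore ps ds)
  have hS := search_prepare hl hbdd
  have hrounds : (I.problem ds).rounds ≤ B := by
    have := hS.bdd.1 7 (by norm_num)
    rw [hS.var_eq (by norm_num) (by norm_num)] at this
    simpa [specVar] using this
  have hsize : I.size + 1 ≤ B := by
    have := hS.bdd.1 6 (by norm_num)
    rw [hS.var_eq (by norm_num) (by norm_num)] at this
    simp only [specVar] at this
    rw [abs_of_nonneg (by positivity)] at this
    exact_mod_cast this
  obtain ⟨hsafe', hS'⟩ := triple_search hrounds hsize _ hS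
  obtain ⟨hle, hsafe'', -⟩ := hq' _ _ hS'.bdd
  obtain ⟨T, s₁, hexec, hT, hag, -⟩ := hp (q'.eval B) (inputStore ps ds) (inputStore ps ds) 50
    le_rfl ⟨hsafe.mono hle, hsafe'.mono hle, hsafe''⟩ (Agree.refl _ _)
  have hout : outputPoints s₁ = outputPoints (algorithm.den (inputStore ps ds)) := by
    rw [outputPoints, outputPoints, hag.1, hag.2 2 (by norm_num)]
  have hKQ : ∀ Q : Finset (ℝ × ℝ), I.Feasible (Q : Set (ℝ × ℝ)) →
      (I.problem ds).Good ((I.problem ds).advance^[I.size + 1] (0, fun _ => 1)).1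
        ((I.problem ds).advance^[I.size + 1] (0, fun _ => 1)).2 ∧
      ((I.problem ds).advance^[I.size + 1] (0, fun _ => 1)).1 ≤ 8 * Q.card := by
    intro Q hQ
    obtain ⟨H, hH, hcard, hhit⟩ := exists_hitting_problem hl hQ
    obtain ⟨h1, -, h3⟩ := HitProblem.iterate_advance hH hhit
    exact ⟨h1, h3.trans (by exact_mod_cast hcard)⟩
  obtain ⟨Q₀, hQ₀⟩ := I.exists_feasible
  obtain ⟨hK, -, hw⟩ := HitProblem.advance_bounds (X := I.problem ds) (I.size + 1)
  have := hS'.correct hl hK (fun u => (hw u).1) (hKQ Q₀ hQ₀).1 fun Q hQ => (hKQ Q hQ).2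
  refine ⟨T, s₁, hexec, ?_, ?_⟩
  · rw [Polynomial.eval_comp, Polynomial.eval_comp]
    exact hT
  · rw [hout]
    exact this

end Algo

end MinGMConn

theorem theorem3 :
    ∃ (prog : MinGMConn.Program) (C : ℝ),
      MinGMConn.IsPolyTimeApproximation prog (fun n : ℕ => C * Real.sqrt (Real.log (n : ℝ))) :=
  ⟨_, 207, MinGMConn.Algo.isPolyTimeApproximation⟩
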